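/- For each sample size $n\ge 1$ let $\mathbf y=X\beta^0+\epsilon$, where $X$ is an $n\times p$ design matrix ($p=p_n$), either deterministic or random and independent of $\epsilon$, $\epsilon\sim N(0,\sigma_0^2I_n)$ with $\sigma_0>0$ fixed, and $\beta^0\in\mathbb R^p$ is deterministic. A model is a subset $\gamma\subset\{1,\dots,p\}$; $X_\gamma$ is the submatrix of the columns of $X$ indexed by $\gamma$, $P_\gamma=X_\gamma(X_\gamma^TX_\gamma)^{-1}X_\gamma^T$ (with $P_\emptyset=0$), and $\gamma^0=\{j:\beta^0_j\ne0\}$ is the true model, with $s_n=|\gamma^0|$. Write $\lambda_-$ and $\lambda_+$ for the minimal and maximal eigenvalue. Given hyperparameters $c_1,\dots,c_p>0$, a fixed $\nu>0$ and a prior probability $p(\gamma)$ on the models, consider the Bayesian model $$\mathbf y\mid\beta,\sigma^2\sim N(X\beta,\sigma^2I_n),\quad \beta_j\mid\gamma,\sigma^2\sim N(0,c_j\sigma^2)\text{ for } j\in\gamma,\quad \beta_j=0\text{ for } j\notin\gamma,\quad 1/\sigma^2\sim\chi^2_\nu,\quad \gamma\sim p(\gamma),$$ the $\beta_j$ being independent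 given $\gamma,\sigma^2$, and let $p(\gamma\mid Z)$ be the posterior probability of $\gamma$ given $Z=(\mathbf y,X)$. Let $S_1=\{\gamma:\gamma^0\subsetneq\gamma\}$, $S_2=\{\gamma:\gamma^0\not\subset\gamma\}$, and $$\varphi_{\min}(n)=\min_{\gamma\in S_2}\lambda_-\Bigl(\tfrac1nX_{\gamma^0\setminus\gamma}^T(I_n-P_\gamma)X_{\gamma^0\setminus\gamma}\Bigr),\qquad \varphi_{\max}(n)=\max_{\gamma\in S_2}\lambda_+\Bigl(\tfrac1nX_{\gamma^0\setminus\gamma}^TX_{\gamma^0\setminus\gamma}\Bigr).$$ Suppose that $\gamma^0\neq\emptyset$ for every $n\ge1$ and that the following hold. 1. $p(\gamma^0)>0$ and there is a constant $C_0>0$ with $\max_\gamma p(\gamma)/p(\gamma^0)\le C_0$ for every $n$. 2. There are constants $C_1,C_2>0$ such that, with probability one, $\liminf_n\varphi_{\min}(n)\ge C_1$ and $\limsup_n\varphi_{\max}(n)\le C_2$. 3. There is a positive sequence $\psi_n$ with $\min_{j\in\gamma^0}|\beta^0_j|\ge\psi_n$ and $\sqrt n\,\psi_n\to\infty$. 4.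 $p\to\infty$, $s_n\le p\le n$ and $p\log n=o\bigl(n\log(1+\min\{\psi_n^2,1\})\bigr)$. 5. There are sequences $0<\underline\phi_n\le\bar\phi_n$ with $\bar\phi_n=O(n^{\delta_0})$ for some $\delta_0>0$ and $\|\beta^0\|_2^2=O(\underline\phi_n)$. 6. There are $C_3>0$ and $\delta\ge0$ such that $n^{1-\delta}\underline\phi_n\to\infty$ and, for every $n$, with probability one, $$\lambda_-\Bigl(\tfrac1nX_{\gamma\setminus\gamma^0}^T(I_n-P_{\gamma^0})X_{\gamma\setminus\gamma^0}\Bigr)\ge C_3n^{-\delta}\quad\text{for all }\gamma\in S_1.$$ Then, as $n\to\infty$: (a) If $p^{\alpha_0}=o(n^{1-\delta}\underline\phi_n)$ for some $\alpha_0>2$, then $$\sup_{c_1,\dots,c_p\in[\underline\phi_n,\bar\phi_n]}\ \max_{\gamma\ne\gamma^0}\ \frac{p(\gamma\mid Z)}{p(\gamma^0\mid Z)}\to0\quad\text{in probability.}$$ (b) If $p^{\alpha_0+2}=o(n^{1-\delta}\underline\phi_n)$ for some $\alpha_0>2$, then $$\sup_{c_1,\dots,c_p\in[\underline\phi_n,\bar\phi_n]}\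 \sum_{\gamma\ne\gamma^0}p(\gamma\mid Z)\to0\quad\text{and}\quad \inf_{c_1,\dots,c_p\in[\underline\phi_n,\bar\phi_n]}p(\gamma^0\mid Z)\to1\quad\text{in probability.}$$ -/

import Mathlib

open MeasureTheory ProbabilityTheory Filter Topology Asymptotics
open scoped ENNReal NNReal Matrix

/-! A model (state vector) `γ` on `p` covariates is the finite set of the indices it includes. -/

/-- The state vector of a coefficient vector: the set of its nonzero coordinates. -/
noncomputable def stateVector {p : ℕ} (β : Fin p → ℝ) : Finset (Fin p) :=
  Finset.univ.filter fun j => β j ≠ 0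

/-- The submatrix `X_γ` of the columns of `X` that belong to `γ`. -/
def colSub {n p : ℕ} (X : Matrix (Fin n) (Fin p) ℝ) (γ : Finset (Fin p)) :
    Matrix (Fin n) {j // j ∈ γ} ℝ :=
  X.submatrix id Subtype.val

/-- `P_γ = X_γ (X_γᵀ X_γ)⁻¹ X_γᵀ`; it is `0` for the empty model. -/
noncomputable def projMat {n p : ℕ} (X : Matrix (Fin n) (Fin p) ℝ) (γ : Finset (Fin p)) :
    Matrix (Fin n) (Fin n) ℝ :=
  colSub X γ * ((colSub X γ)ᵀ * colSub X γ)⁻¹ * (colSub X γ)ᵀ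

/-- The minimal eigenvalue of a real symmetric matrix (of positive size). -/
noncomputable def minEig {ι : Type*} [Fintype ι] [DecidableEq ι] (A : Matrix ι ι ℝ) : ℝ :=
  sInf (spectrum ℝ A)

/-- The maximal eigenvalue of a real symmetric matrix (of positive size). -/
noncomputable def maxEig {ι : Type*} [Fintype ι] [DecidableEq ι] (A : Matrix ι ι ℝ) : ℝ :=
  sSup (spectrum ℝ A)

/-- `S₁`: the models that strictly contain `γ₀`. -/
def overModels {p : ℕ} (γ₀ : Finset (Fin p)) : Set (Finset (Fin p)) :=
  {γ | γ₀ ⊆ γ ∧ γ ≠ γ₀}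

/-- `S₂`: the models that do not contain `γ₀`. -/
def nonOverModels {p : ℕ} (γ₀ : Finset (Fin p)) : Set (Finset (Fin p)) :=
  {γ | ¬ γ₀ ⊆ γ}

/-- `n⁻¹ X_ηᵀ (I - P_γ) X_η`. -/
noncomputable def residGram {n p : ℕ} (X : Matrix (Fin n) (Fin p) ℝ) (η γ : Finset (Fin p)) :
    Matrix {j // j ∈ η} {j // j ∈ η} ℝ :=
  (1 / (n : ℝ)) • ((colSub X η)ᵀ * (1 - projMat X γ) * colSub X η)

/-- `φ_min`, the minimum over `γ ∈ S₂` of `λ₋(n⁻¹ X_{γ₀∖γ}ᵀ (I - P_γ) X_{γ₀∖γ})`. -/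
noncomputable def phiMin {n p : ℕ} (X : Matrix (Fin n) (Fin p) ℝ) (γ₀ : Finset (Fin p)) : ℝ :=
  sInf ((fun γ => minEig (residGram X (γ₀ \ γ) γ)) '' nonOverModels γ₀)

/-- `φ_max`, the maximum over `γ ∈ S₂` of `λ₊(n⁻¹ X_{γ₀∖γ}ᵀ X_{γ₀∖γ})`. -/
noncomputable def phiMax {n p : ℕ} (X : Matrix (Fin n) (Fin p) ℝ) (γ₀ : Finset (Fin p)) : ℝ :=
  sSup ((fun γ => maxEig ((1 / (n : ℝ)) • ((colSub X (γ₀ \ γ))ᵀ * colSub X (γ₀ \ γ)))) ''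
    nonOverModels γ₀)

/-! The hierarchical Bayesian model. -/

/-- The density at `y` of `N(X β, σ² I_n)`. -/
noncomputable def likelihood {n p : ℕ} (X : Matrix (Fin n) (Fin p) ℝ) (β : Fin p → ℝ)
    (σsq : ℝ) (y : Fin n → ℝ) : ℝ :=
  ∏ i, gaussianPDFReal ((X *ᵥ β) i) σsq.toNNReal (y i)

/-- The prior of `β` given `γ` and `σ²`: the coordinates are independent, with
`β_j ∼ N(0, c_j σ²)` for `j ∈ γ` and `β_j = 0` for `j ∉ γ`. -/
noncomputable def coefPrior {p : ℕ} (c : Fin p → ℝ) (γ : Finset (Fin p)) (σsq : ℝ) :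
    Measure (Fin p → ℝ) :=
  Measure.pi fun j =>
    if j ∈ γ then gaussianReal 0 (c j * σsq).toNNReal else Measure.dirac 0

/-- The chi-squared distribution with `ν` degrees of freedom. -/
noncomputable def chiSquared (ν : ℝ) : Measure ℝ :=
  gammaMeasure (ν / 2) (1 / 2)

/-- The marginal density of `y` given the model `γ` (and `X`), where `1/σ² ∼ χ²_ν`: here the
variable `τ` stands for `1/σ²`. -/
noncomputable def marginalLikelihood {n p : ℕ} (ν : ℝ) (c : Fin p → ℝ)
    (X : Matrix (Fin n) (Fin p) ℝ) (y : Fin n → ℝ) (γ : Finset (Fin p)) : ℝ :=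
  ∫ τ, ∫ β, likelihood X β τ⁻¹ y ∂(coefPrior c γ τ⁻¹) ∂(chiSquared ν)

/-- The posterior probability `p(γ | Z)` of the model `γ`, given `Z = (y, X)`. -/
noncomputable def posterior {n p : ℕ} (ν : ℝ) (prior : PMF (Finset (Fin p))) (c : Fin p → ℝ)
    (X : Matrix (Fin n) (Fin p) ℝ) (y : Fin n → ℝ) (γ : Finset (Fin p)) : ℝ :=
  (prior γ).toReal * marginalLikelihood ν c X y γ /
    ∑ γ', (prior γ').toReal * marginalLikelihood ν c X y γ'

/-! Integrating out the coefficients and the precision gives, up to a factor common to all models,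
the score det(1 + W Wᵀ)^(-1/2) (1 + R_γ)^(-(n+ν)/2) (`marginalLikelihood_eq`). Here W is X_γ with
columns scaled by √c_j, and R_γ = yᵀ(1 + W Wᵀ)⁻¹y is the minimum of the ridge objective |y - Wb|² +
|b|². Since prior odds are bounded, it suffices to bound score ratios. Trial coefficients bound R_γ
from above, and projection arguments bound it from below. All these bounds are uniform in c over the
box, so the supremum over c costs nothing.

Models missing a true covariate: the residual picks up at least n C₁ψ²/4 beyond the noise, up to
O(p). The base of the power is then at most 1/(1 + c₀ min(ψ²,1)), and its power of order n beats the
determinant factor exp(O(p log n)) by the growth condition. The ratio is at most exp(-2p)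
(`eventually_score_miss_le`), which also beats the 2^p models.

Models with k extra covariates: the matrix determinant lemma yields (1 + h φ)^(-k/2), with h = C₃
n^(1-δ) and φ the lower end of the prior variances. The ridge values differ by a bounded term plus
the noise energy in a k-dimensional space. A Chernoff and union bound makes that energy at most σ² k
α log p for all models at once, provided α > 2. Since R_γ is about n σ² or larger, the power costs
at most a constant times p^(α₀k/2), where α < α₀ leaves room for the lower-order losses. The ratio
is at most K z^k with z = √(p^α₀/(h φ)) (`eventually_score_over_le`). For (a), z → 0 suffices. For
(b), the sum of z^k over supersets is at most exp(pz) - 1, and pz → 0 is what the exponent α₀ + 2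
provides.

The exceptional events are collected in `exists_bad_event`. A random design is handled by fixing its
value and using tail bounds valid for every fixed matrix. -/

/-! ### Symmetric idempotents and orthogonal projections onto column spaces -/

section LinearAlgebra

set_option linter.unusedSectionVars false

variable {m ι : Type*} [Fintype m] [Fintype ι] [DecidableEq m] [DecidableEq ι]

/-- Moving a matrix to the other side of a dot product. -/
lemma dotProduct_mulVec_transpose (A : Matrix m ι ℝ) (x : m → ℝ) (z : ι → ℝ) :
    x ⬝ᵥ A *ᵥ z = (Aᵀ *ᵥ x) ⬝ᵥ z := by
  rw [Matrix.dotProduct_mulVec, Matrix.mulVec_transpose]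

lemma dotProduct_self_nonneg' (x : m → ℝ) : 0 ≤ x ⬝ᵥ x :=
  Finset.sum_nonneg fun i _ => mul_self_nonneg (x i)

lemma dotProduct_self_add (x z : m → ℝ) :
    (x + z) ⬝ᵥ (x + z) = x ⬝ᵥ x + 2 * (x ⬝ᵥ z) + z ⬝ᵥ z := by
  rw [add_dotProduct, dotProduct_add, dotProduct_add, dotProduct_comm z x]; ring

lemma dotProduct_self_sub (x z : m → ℝ) :
    (x - z) ⬝ᵥ (x - z) = x ⬝ᵥ x - 2 * (x ⬝ᵥ z) + z ⬝ᵥ z := by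
  rw [sub_dotProduct, dotProduct_sub, dotProduct_sub, dotProduct_comm z x]; ring

lemma dotProduct_self_add_le (x z : m → ℝ) :
    (x + z) ⬝ᵥ (x + z) ≤ 2 * (x ⬝ᵥ x + z ⬝ᵥ z) := by
  have h := dotProduct_self_nonneg' (x - z)
  rw [dotProduct_self_sub] at h
  rw [dotProduct_self_add]; linarith

lemma dotProduct_gram (W : Matrix m ι ℝ) (x : ι → ℝ) :
    x ⬝ᵥ (Wᵀ * W) *ᵥ x = (W *ᵥ x) ⬝ᵥ (W *ᵥ x) := by
  rw [← Matrix.mulVec_mulVec, dotProduct_mulVec_transpose, Matrix.transpose_transpose]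

lemma dotProduct_mulVec_of_symm_idem {A : Matrix m m ℝ} (hs : Aᵀ = A) (hi : A * A = A)
    (x : m → ℝ) : x ⬝ᵥ A *ᵥ x = (A *ᵥ x) ⬝ᵥ (A *ᵥ x) := by
  conv_lhs => rw [← hi]
  conv_lhs => enter [2, 1, 1]; rw [← hs]
  exact dotProduct_gram A x

lemma dotProduct_mulVec_nonneg_of_symm_idem {A : Matrix m m ℝ} (hs : Aᵀ = A) (hi : A * A = A)
    (x : m → ℝ) : 0 ≤ x ⬝ᵥ A *ᵥ x := by
  rw [dotProduct_mulVec_of_symm_idem hs hi]; exact dotProduct_self_nonneg' _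

lemma one_sub_symm {A : Matrix m m ℝ} (hs : Aᵀ = A) : (1 - A)ᵀ = 1 - A := by simp [hs]

lemma one_sub_idem {A : Matrix m m ℝ} (hi : A * A = A) : (1 - A) * (1 - A) = 1 - A := by
  simp [mul_sub, sub_mul, hi]

lemma dotProduct_one_sub_mulVec (A : Matrix m m ℝ) (x : m → ℝ) :
    x ⬝ᵥ (1 - A) *ᵥ x = x ⬝ᵥ x - x ⬝ᵥ A *ᵥ x := by
  rw [Matrix.sub_mulVec, Matrix.one_mulVec, dotProduct_sub]

lemma dotProduct_mulVec_le_of_symm_idem {A : Matrix m m ℝ} (hs : Aᵀ = A) (hi : A * A = A)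
    (x : m → ℝ) : x ⬝ᵥ A *ᵥ x ≤ x ⬝ᵥ x := by
  have := dotProduct_mulVec_nonneg_of_symm_idem (one_sub_symm hs) (one_sub_idem hi) x
  rw [dotProduct_one_sub_mulVec] at this; linarith

/-- The orthogonal projection onto the column space of `W` (when `W` has full column rank). -/
noncomputable def hat (W : Matrix m ι ℝ) : Matrix m m ℝ := W * (Wᵀ * W)⁻¹ * Wᵀ

lemma hat_transpose (W : Matrix m ι ℝ) : (hat W)ᵀ = hat W := by
  simp [hat, Matrix.transpose_mul, Matrix.transpose_nonsing_inv, Matrix.mul_assoc]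

lemma hat_mul_self {W : Matrix m ι ℝ} (h : IsUnit (Wᵀ * W).det) : hat W * W = W := by
  rw [hat, Matrix.mul_assoc, Matrix.mul_assoc, Matrix.nonsing_inv_mul _ h, Matrix.mul_one]

lemma hat_mul_hat (W : Matrix m ι ℝ) : hat W * hat W = hat W := by
  by_cases h : IsUnit (Wᵀ * W).det
  · nth_rewrite 2 [hat]
    rw [← Matrix.mul_assoc, ← Matrix.mul_assoc, hat_mul_self h, hat]
  -- The inverse of a singular matrix is 0 by convention, so `hat W` is 0; hence no rank hypothesis
  -- is needed.
  · simp [hat, Matrix.nonsing_inv_apply_not_isUnit _ h]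

lemma one_sub_hat_mulVec {W : Matrix m ι ℝ} (h : IsUnit (Wᵀ * W).det) (d : ι → ℝ) :
    (1 - hat W) *ᵥ (W *ᵥ d) = 0 := by
  rw [Matrix.mulVec_mulVec, Matrix.sub_mul, Matrix.one_mul, hat_mul_self h, sub_self, Matrix.zero_mulVec]

lemma dotProduct_hat_nonneg (W : Matrix m ι ℝ) (x : m → ℝ) : 0 ≤ x ⬝ᵥ hat W *ᵥ x :=
  dotProduct_mulVec_nonneg_of_symm_idem (hat_transpose W) (hat_mul_hat W) x

lemma dotProduct_hat_le (W : Matrix m ι ℝ) (x : m → ℝ) : x ⬝ᵥ hat W *ᵥ x ≤ x ⬝ᵥ x :=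
  dotProduct_mulVec_le_of_symm_idem (hat_transpose W) (hat_mul_hat W) x

lemma dotProduct_one_sub_hat_le (W : Matrix m ι ℝ) (x : m → ℝ) :
    x ⬝ᵥ (1 - hat W) *ᵥ x ≤ x ⬝ᵥ x := by
  rw [dotProduct_one_sub_mulVec]; linarith [dotProduct_hat_nonneg W x]

lemma dotProduct_one_sub_hat (W : Matrix m ι ℝ) (x : m → ℝ) :
    x ⬝ᵥ (1 - hat W) *ᵥ x = ((1 - hat W) *ᵥ x) ⬝ᵥ ((1 - hat W) *ᵥ x) :=
  dotProduct_mulVec_of_symm_idem (one_sub_symm (hat_transpose W)) (one_sub_idem (hat_mul_hat W)) x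

/-- The residual quadratic form does not see the column space. -/
lemma one_sub_hat_quad_sub {W : Matrix m ι ℝ} (h : IsUnit (Wᵀ * W).det) (z : m → ℝ) (d : ι → ℝ) :
    (z - W *ᵥ d) ⬝ᵥ (1 - hat W) *ᵥ (z - W *ᵥ d) = z ⬝ᵥ (1 - hat W) *ᵥ z := by
  rw [dotProduct_one_sub_hat, dotProduct_one_sub_hat, Matrix.mulVec_sub, one_sub_hat_mulVec h,
    sub_zero]

/-- The projection residual is the smallest one. -/
lemma one_sub_hat_quad_le {W : Matrix m ι ℝ} (h : IsUnit (Wᵀ * W).det) (z : m → ℝ) (d : ι → ℝ) :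
    z ⬝ᵥ (1 - hat W) *ᵥ z ≤ (z - W *ᵥ d) ⬝ᵥ (z - W *ᵥ d) := by
  rw [← one_sub_hat_quad_sub h z d]; exact dotProduct_one_sub_hat_le W _

lemma isUnit_det_gram {W : Matrix m ι ℝ} (h : ∀ v, W *ᵥ v = 0 → v = 0) :
    IsUnit (Wᵀ * W).det := by
  have hinj : Function.Injective W.mulVec := by
    intro v w hvw
    have := h (v - w) (by rw [Matrix.mulVec_sub]; exact sub_eq_zero.2 hvw)
    exact sub_eq_zero.1 this
  have := (Matrix.PosDef.conjTranspose_mul_self W hinj).isUnit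
  rw [Matrix.conjTranspose_eq_transpose_of_trivial] at this
  exact (Matrix.isUnit_iff_isUnit_det _).1 this

/-! ### Eigenvalue bounds -/

lemma isHermitian_of_transpose {A : Matrix ι ι ℝ} (hA : Aᵀ = A) : A.IsHermitian := by
  rw [Matrix.IsHermitian, Matrix.conjTranspose_eq_transpose_of_trivial, hA]

lemma eigenvalue_eq_quad {A : Matrix ι ι ℝ} (hA : A.IsHermitian) (i : ι) :
    ∃ v : ι → ℝ, v ⬝ᵥ v = 1 ∧ hA.eigenvalues i = v ⬝ᵥ A *ᵥ v := by
  refine ⟨(hA.eigenvectorBasis i).ofLp, ?_, ?_⟩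
  · have h1 := hA.eigenvectorBasis.orthonormal.1 i
    have h2 : ‖hA.eigenvectorBasis i‖ ^ 2 = 1 := by rw [h1]; norm_num
    rw [EuclideanSpace.real_norm_sq_eq] at h2
    rw [← h2, dotProduct]
    exact Finset.sum_congr rfl fun j _ => (sq _).symm
  · simpa using hA.eigenvalues_eq i

lemma pow_card_le_det {A : Matrix ι ι ℝ} (hA : Aᵀ = A) {a : ℝ} (ha : 0 ≤ a)
    (h : ∀ x, a * (x ⬝ᵥ x) ≤ x ⬝ᵥ A *ᵥ x) : a ^ Fintype.card ι ≤ A.det := by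
  have hH := isHermitian_of_transpose hA
  rw [hH.det_eq_prod_eigenvalues, ← Finset.card_univ, ← Finset.prod_const]
  refine Finset.prod_le_prod (fun _ _ => ha) fun i _ => ?_
  obtain ⟨v, hv, he⟩ := eigenvalue_eq_quad hH i
  have := h v
  rw [hv, mul_one] at this
  simpa [he] using this

lemma det_le_pow_card {A : Matrix ι ι ℝ} (hA : Aᵀ = A) {a : ℝ}
    (h0 : ∀ x, 0 ≤ x ⬝ᵥ A *ᵥ x) (h : ∀ x, x ⬝ᵥ A *ᵥ x ≤ a * (x ⬝ᵥ x)) :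
    A.det ≤ a ^ Fintype.card ι := by
  have hH := isHermitian_of_transpose hA
  rw [hH.det_eq_prod_eigenvalues, ← Finset.card_univ, ← Finset.prod_const]
  refine Finset.prod_le_prod (fun i _ => ?_) fun i _ => ?_ <;>
    obtain ⟨v, hv, he⟩ := eigenvalue_eq_quad hH i
  · simpa [he] using h0 v
  · have := h v
    rw [hv, mul_one] at this
    simpa [he] using this

lemma spectrum_finite {A : Matrix ι ι ℝ} (hA : Aᵀ = A) : (spectrum ℝ A).Finite := by
  rw [(isHermitian_of_transpose hA).spectrum_real_eq_range_eigenvalues]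
  exact Set.finite_range _

/-- Subtracting `minEig A` times the identity shifts the spectrum into the nonnegative reals, so the
difference is positive semidefinite. -/
lemma minEig_mul_le {A : Matrix ι ι ℝ} (hA : Aᵀ = A) (x : ι → ℝ) :
    minEig A * (x ⬝ᵥ x) ≤ x ⬝ᵥ A *ᵥ x := by
  have hH := isHermitian_of_transpose hA
  have hps : (A - algebraMap ℝ _ (minEig A)).PosSemidef := by
    rw [Matrix.posSemidef_iff_isHermitian_and_spectrum_nonneg]
    refine ⟨isHermitian_of_transpose (by
      simp [Matrix.transpose_sub, hA, Matrix.algebraMap_eq_diagonal]), ?_⟩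
    rw [← spectrum.sub_singleton_eq]
    rintro _ ⟨a, ha, _, rfl, rfl⟩
    exact sub_nonneg.2 (csInf_le (spectrum_finite hA).bddBelow ha)
  have := hps.dotProduct_mulVec_nonneg x
  rw [Matrix.sub_mulVec, dotProduct_sub, Algebra.algebraMap_eq_smul_one, Matrix.smul_mulVec,
    Matrix.one_mulVec, dotProduct_smul, smul_eq_mul, star_trivial] at this
  linarith

lemma le_maxEig_mul {A : Matrix ι ι ℝ} (hA : Aᵀ = A) (x : ι → ℝ) :
    x ⬝ᵥ A *ᵥ x ≤ maxEig A * (x ⬝ᵥ x) := by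
  have hps : (algebraMap ℝ _ (maxEig A) - A).PosSemidef := by
    rw [Matrix.posSemidef_iff_isHermitian_and_spectrum_nonneg]
    refine ⟨isHermitian_of_transpose (by
      simp [Matrix.transpose_sub, hA, Matrix.algebraMap_eq_diagonal]), ?_⟩
    rw [← spectrum.singleton_sub_eq]
    rintro _ ⟨_, rfl, a, ha, rfl⟩
    exact sub_nonneg.2 (le_csSup (spectrum_finite hA).bddAbove ha)
  have := hps.dotProduct_mulVec_nonneg x
  rw [Matrix.sub_mulVec, dotProduct_sub, Algebra.algebraMap_eq_smul_one, Matrix.smul_mulVec,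
    Matrix.one_mulVec, dotProduct_smul, smul_eq_mul, star_trivial] at this
  linarith

end LinearAlgebra

/-! ### Submatrices of columns and supported vectors -/

section Columns

variable {n p : ℕ} (X : Matrix (Fin n) (Fin p) ℝ)

lemma projMat_eq_hat (γ : Finset (Fin p)) : projMat X γ = hat (colSub X γ) := rfl

lemma sum_supported {M : Type*} [AddCommMonoid M] {γ : Finset (Fin p)} {f : Fin p → M}
    (hf : ∀ j ∉ γ, f j = 0) : ∑ j, f j = ∑ j : {j // j ∈ γ}, f j := by
  rw [Finset.univ_eq_attach, Finset.sum_attach γ f]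
  exact (Finset.sum_subset (Finset.subset_univ γ) fun j _ hj => hf j hj).symm

lemma mulVec_eq_colSub {γ : Finset (Fin p)} {v : Fin p → ℝ} (hv : ∀ j ∉ γ, v j = 0) :
    X *ᵥ v = colSub X γ *ᵥ fun j => v j := by
  ext i
  exact sum_supported (f := fun j => X i j * v j) fun j hj => by rw [hv j hj, mul_zero]

lemma dotProduct_self_eq_restrict {γ : Finset (Fin p)} {v : Fin p → ℝ} (hv : ∀ j ∉ γ, v j = 0) :
    v ⬝ᵥ v = (fun j : {j // j ∈ γ} => v j) ⬝ᵥ fun j => v j :=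
  sum_supported (f := fun j => v j * v j) fun j hj => by rw [hv j hj, mul_zero]

/-- The extension by zero of a vector indexed by a model. -/
noncomputable def extendZero {γ : Finset (Fin p)} (d : {j // j ∈ γ} → ℝ) : Fin p → ℝ :=
  fun j => if h : j ∈ γ then d ⟨j, h⟩ else 0

lemma extendZero_notMem {γ : Finset (Fin p)} (d : {j // j ∈ γ} → ℝ) {j : Fin p} (hj : j ∉ γ) :
    extendZero d j = 0 := dif_neg hj

lemma extendZero_val {γ : Finset (Fin p)} (d : {j // j ∈ γ} → ℝ) :
    (fun j : {j // j ∈ γ} => extendZero d j) = d := by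
  ext j; simp [extendZero]

lemma colSub_mulVec {γ : Finset (Fin p)} (d : {j // j ∈ γ} → ℝ) :
    colSub X γ *ᵥ d = X *ᵥ extendZero d := by
  rw [mulVec_eq_colSub X (γ := γ) fun j hj => extendZero_notMem d hj, extendZero_val]

lemma extendZero_dotProduct_self {γ : Finset (Fin p)} (d : {j // j ∈ γ} → ℝ) :
    extendZero d ⬝ᵥ extendZero d = d ⬝ᵥ d := by
  rw [dotProduct_self_eq_restrict (γ := γ) fun j hj => extendZero_notMem d hj, extendZero_val]

lemma residGram_transpose (η γ : Finset (Fin p)) : (residGram X η γ)ᵀ = residGram X η γ := by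
  simp [residGram, projMat_eq_hat, Matrix.transpose_mul, hat_transpose, Matrix.mul_assoc]

lemma residGram_quad (η γ : Finset (Fin p)) (x : {j // j ∈ η} → ℝ) :
    x ⬝ᵥ residGram X η γ *ᵥ x =
      (1 / (n : ℝ)) * ((colSub X η *ᵥ x) ⬝ᵥ (1 - projMat X γ) *ᵥ (colSub X η *ᵥ x)) := by
  rw [residGram, Matrix.smul_mulVec, dotProduct_smul, smul_eq_mul, ← Matrix.mulVec_mulVec,
    ← Matrix.mulVec_mulVec, dotProduct_mulVec_transpose, Matrix.transpose_transpose]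

lemma minEig_residGram_bound (hn : 0 < n) {η γ : Finset (Fin p)} {a : ℝ}
    (h : a ≤ minEig (residGram X η γ)) {v : Fin p → ℝ} (hv : ∀ j ∉ η, v j = 0) :
    n * a * (v ⬝ᵥ v) ≤ (X *ᵥ v) ⬝ᵥ (1 - projMat X γ) *ᵥ (X *ᵥ v) := by
  have hn' : (0 : ℝ) < n := by exact_mod_cast hn
  have h1 := minEig_mul_le (residGram_transpose X η γ) fun j => v j
  rw [residGram_quad, ← mulVec_eq_colSub X hv, ← dotProduct_self_eq_restrict hv] at h1
  have h2 := (mul_le_mul_of_nonneg_right h (dotProduct_self_nonneg' v)).trans h1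
  rw [one_div, ← div_eq_inv_mul, le_div_iff₀ hn'] at h2
  linarith

lemma maxEig_gram_bound (hn : 0 < n) {η : Finset (Fin p)} {b : ℝ}
    (h : maxEig ((1 / (n : ℝ)) • ((colSub X η)ᵀ * colSub X η)) ≤ b) {v : Fin p → ℝ}
    (hv : ∀ j ∉ η, v j = 0) : (X *ᵥ v) ⬝ᵥ (X *ᵥ v) ≤ n * b * (v ⬝ᵥ v) := by
  have hn' : (0 : ℝ) < n := by exact_mod_cast hn
  have h1 := le_maxEig_mul (A := (1 / (n : ℝ)) • ((colSub X η)ᵀ * colSub X η))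
    (by simp [Matrix.transpose_mul]) fun j => v j
  rw [Matrix.smul_mulVec, dotProduct_smul, smul_eq_mul, dotProduct_gram,
    ← mulVec_eq_colSub X hv, ← dotProduct_self_eq_restrict hv] at h1
  have h2 := h1.trans (mul_le_mul_of_nonneg_right h (dotProduct_self_nonneg' v))
  rw [one_div, ← div_eq_inv_mul, div_le_iff₀ hn'] at h2
  linarith

lemma phiMin_bound (hn : 0 < n) {γ₀ : Finset (Fin p)} {a : ℝ} (h : a ≤ phiMin X γ₀)
    (γ : Finset (Fin p)) {v : Fin p → ℝ} (hv : ∀ j ∉ γ₀ \ γ, v j = 0) :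
    n * a * (v ⬝ᵥ v) ≤ (X *ᵥ v) ⬝ᵥ (1 - projMat X γ) *ᵥ (X *ᵥ v) := by
  by_cases hγ : γ₀ ⊆ γ
  · have : v = 0 := by
      ext j
      exact hv j (by rw [Finset.sdiff_eq_empty_iff_subset.2 hγ]; simp)
    simp [this]
  · exact minEig_residGram_bound X hn
      (h.trans (csInf_le (Set.toFinite _).bddBelow ⟨γ, hγ, rfl⟩)) hv

/-- The empty model misses a true covariate because γ₀ is nonempty, and γ₀ \ ∅ = γ₀, so the maximum
controls the whole Gram matrix of the true model. -/
lemma phiMax_bound (hn : 0 < n) {γ₀ : Finset (Fin p)} (h₀ : γ₀.Nonempty) {b : ℝ}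
    (h : phiMax X γ₀ ≤ b) {v : Fin p → ℝ} (hv : ∀ j ∉ γ₀, v j = 0) :
    (X *ᵥ v) ⬝ᵥ (X *ᵥ v) ≤ n * b * (v ⬝ᵥ v) := by
  refine maxEig_gram_bound X hn (η := γ₀ \ ∅) (le_trans ?_ h) (by simpa using hv)
  refine le_csSup (Set.toFinite _).bddAbove ⟨∅, ?_, rfl⟩
  simpa [nonOverModels, Finset.subset_empty] using h₀.ne_empty

end Columns

/-! ### Gaussian integrals -/

section GaussianIntegral

variable {ι : Type*} [Fintype ι]

/-- The standard Gaussian measure on `ι → ℝ`. -/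
noncomputable abbrev stdGauss (ι : Type*) [Fintype ι] : Measure (ι → ℝ) :=
  Measure.pi fun _ => gaussianReal 0 1

lemma stdGauss_eq_withDensity :
    stdGauss ι = (volume : Measure (ι → ℝ)).withDensity
      fun x => ENNReal.ofReal (∏ i, gaussianPDFReal 0 1 (x i)) := by
  symm
  refine (Measure.pi_eq fun s hs => ?_).symm
  have hms : MeasurableSet (Set.univ.pi s) := MeasurableSet.univ_pi hs
  have hint : Integrable (fun x : ι → ℝ => ∏ i, gaussianPDFReal 0 1 (x i))
      (Measure.pi fun i => (volume : Measure ℝ).restrict (s i)) :=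
    Integrable.fintype_prod fun i => (integrable_gaussianPDFReal 0 1).restrict
  rw [withDensity_apply _ hms, volume_pi, Measure.restrict_pi_pi,
    ← ofReal_integral_eq_lintegral_ofReal hint
      (Eventually.of_forall fun x => Finset.prod_nonneg fun i _ => gaussianPDFReal_nonneg _ _ _),
    integral_fintype_prod_eq_prod, ENNReal.ofReal_prod_of_nonneg
      (fun i _ => integral_nonneg fun x => gaussianPDFReal_nonneg _ _ _)]
  exact Finset.prod_congr rfl fun i _ => (gaussianReal_apply_eq_integral 0 one_ne_zero _).symm

lemma prod_gaussianPDFReal_std (x : ι → ℝ) :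
    ∏ i, gaussianPDFReal 0 1 (x i) =
      (√(2 * Real.pi))⁻¹ ^ Fintype.card ι * Real.exp (-(x ⬝ᵥ x) / 2) := by
  simp only [gaussianPDFReal, NNReal.coe_one, mul_one, sub_zero]
  rw [Finset.prod_mul_distrib, Finset.prod_const, Finset.card_univ, ← Real.exp_sum,
    ← Finset.sum_div, Finset.sum_neg_distrib, dotProduct]
  simp only [sq]

lemma integral_stdGauss (f : (ι → ℝ) → ℝ) :
    ∫ x, f x ∂stdGauss ι =
      (√(2 * Real.pi))⁻¹ ^ Fintype.card ι * ∫ x, Real.exp (-(x ⬝ᵥ x) / 2) * f x := by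
  have hmeas : Measurable fun x : ι → ℝ => ∏ i, gaussianPDFReal 0 1 (x i) :=
    Finset.measurable_prod _ fun i _ =>
      (measurable_gaussianPDFReal 0 1).comp (measurable_pi_apply i)
  rw [stdGauss_eq_withDensity, integral_withDensity_eq_integral_toReal_smul hmeas.ennreal_ofReal
    (Eventually.of_forall fun x => ENNReal.ofReal_lt_top), ← integral_const_mul]
  refine integral_congr_ae (Eventually.of_forall fun x => ?_)
  simp only
  rw [ENNReal.toReal_ofReal (Finset.prod_nonneg fun i _ => gaussianPDFReal_nonneg _ _ _),
    prod_gaussianPDFReal_std, smul_eq_mul, mul_assoc]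

lemma integral_exp_neg_dotProduct_self :
    ∫ x : ι → ℝ, Real.exp (-(x ⬝ᵥ x) / 2) = √(2 * Real.pi) ^ Fintype.card ι := by
  have h := integral_stdGauss (ι := ι) fun _ => 1
  simp only [integral_const, probReal_univ, smul_eq_mul, mul_one] at h
  have hpos : 0 < √(2 * Real.pi) := Real.sqrt_pos.2 (by positivity)
  rw [inv_pow, eq_comm, inv_mul_eq_iff_eq_mul₀ (by positivity), mul_one] at h
  exact h

variable [DecidableEq ι]

open scoped MatrixOrder in
-- Substitute B x for x with B the positive square root of A; the Jacobian is |det B| = √(det A).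
lemma integral_exp_neg_quad {A : Matrix ι ι ℝ} (hA : A.PosDef) :
    ∫ x : ι → ℝ, Real.exp (-(x ⬝ᵥ A *ᵥ x) / 2) =
      √(2 * Real.pi) ^ Fintype.card ι / √A.det := by
  set B := CFC.sqrt A with hB
  have hA0 : 0 ≤ A := hA.posSemidef.nonneg
  have hBB : B * B = A := CFC.sqrt_mul_sqrt_self A hA0
  have hBt : Bᵀ = B := by
    have := (Matrix.nonneg_iff_posSemidef.1 (CFC.sqrt_nonneg A)).isHermitian
    rwa [Matrix.IsHermitian, Matrix.conjTranspose_eq_transpose_of_trivial] at this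
  have hdet : B.det * B.det = A.det := by rw [← Matrix.det_mul, hBB]
  have hAdet := hA.det_pos
  have hB0 : B.det ≠ 0 := by
    intro h; rw [h, mul_zero] at hdet; exact hAdet.ne hdet
  have habs : |B.det⁻¹| = (√A.det)⁻¹ := by
    rw [← hdet, Real.sqrt_mul_self_eq_abs, abs_inv]
  have hmap := Real.map_matrix_volume_pi_eq_smul_volume_pi hB0
  have hcont : Continuous fun x : ι → ℝ => Real.exp (-(x ⬝ᵥ x) / 2) := by
    unfold dotProduct; fun_prop
  have h1 : ∫ x : ι → ℝ, Real.exp (-(Matrix.toLin' B x ⬝ᵥ Matrix.toLin' B x) / 2) =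
      ∫ x, Real.exp (-(x ⬝ᵥ x) / 2) ∂(Measure.map (Matrix.toLin' B) volume) :=
    (integral_map (LinearMap.continuous_of_finiteDimensional _).measurable.aemeasurable
      hcont.aestronglyMeasurable).symm
  rw [hmap, integral_smul_measure, integral_exp_neg_dotProduct_self,
    ENNReal.toReal_ofReal (abs_nonneg _), habs, smul_eq_mul] at h1
  rw [div_eq_inv_mul, ← h1]
  refine integral_congr_ae (Eventually.of_forall fun x => ?_)
  simp only [Matrix.toLin'_apply]
  rw [← dotProduct_gram, hBt, hBB]

/-- A Gaussian integral, in relation to the standard Gaussian measure. -/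
lemma integral_stdGauss_quad {A : Matrix ι ι ℝ} (hA : A.PosDef) (b : ι → ℝ) :
    ∫ x, Real.exp ((x ⬝ᵥ x) / 2 - ((x - b) ⬝ᵥ A *ᵥ (x - b)) / 2) ∂stdGauss ι = (√A.det)⁻¹ := by
  rw [integral_stdGauss]
  have h : ∀ x : ι → ℝ, Real.exp (-(x ⬝ᵥ x) / 2) *
      Real.exp ((x ⬝ᵥ x) / 2 - ((x - b) ⬝ᵥ A *ᵥ (x - b)) / 2) =
      Real.exp (-((x - b) ⬝ᵥ A *ᵥ (x - b)) / 2) := by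
    intro x; rw [← Real.exp_add]; congr 1; ring
  simp_rw [h]
  rw [integral_sub_right_eq_self (fun x => Real.exp (-(x ⬝ᵥ A *ᵥ x) / 2)) b,
    integral_exp_neg_quad hA]
  have hpos : 0 < √(2 * Real.pi) := Real.sqrt_pos.2 (by positivity)
  rw [inv_pow, div_eq_mul_inv, inv_mul_cancel_left₀ (by positivity)]

end GaussianIntegral

/-! ### Ridge quadratic form -/

section Ridge

set_option linter.unusedSectionVars false

variable {m ι : Type*} [Fintype m] [Fintype ι] [DecidableEq m] [DecidableEq ι]

lemma transpose_one_add_mul_transpose (W : Matrix m ι ℝ) : (1 + W * Wᵀ)ᵀ = 1 + W * Wᵀ := by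
  simp [Matrix.transpose_mul]

lemma quad_one_add_mul_transpose (W : Matrix m ι ℝ) (x : m → ℝ) :
    x ⬝ᵥ (1 + W * Wᵀ) *ᵥ x = x ⬝ᵥ x + (Wᵀ *ᵥ x) ⬝ᵥ (Wᵀ *ᵥ x) := by
  have := dotProduct_gram Wᵀ x
  rw [Matrix.transpose_transpose] at this
  rw [Matrix.add_mulVec, Matrix.one_mulVec, dotProduct_add, this]

lemma posDef_one_add_mul_transpose (W : Matrix m ι ℝ) : (1 + W * Wᵀ).PosDef := by
  have := Matrix.posSemidef_self_mul_conjTranspose W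
  rw [Matrix.conjTranspose_eq_transpose_of_trivial] at this
  exact Matrix.PosDef.one.add_posSemidef this

/-- The ridge quadratic form `yᵀ (1 + W Wᵀ)⁻¹ y`. -/
noncomputable def ridgeQuad (W : Matrix m ι ℝ) (z : m → ℝ) : ℝ := z ⬝ᵥ (1 + W * Wᵀ)⁻¹ *ᵥ z

lemma ridge_solution (W : Matrix m ι ℝ) (z : m → ℝ) :
    (1 + W * Wᵀ)⁻¹ *ᵥ z + W *ᵥ (Wᵀ *ᵥ ((1 + W * Wᵀ)⁻¹ *ᵥ z)) = z := by
  have hu : IsUnit (1 + W * Wᵀ).det :=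
    (Matrix.isUnit_iff_isUnit_det _).1 (posDef_one_add_mul_transpose W).isUnit
  have h : (1 + W * Wᵀ) *ᵥ ((1 + W * Wᵀ)⁻¹ *ᵥ z) = z := by
    rw [Matrix.mulVec_mulVec, Matrix.mul_nonsing_inv _ hu, Matrix.one_mulVec]
  rwa [Matrix.add_mulVec, Matrix.one_mulVec, ← Matrix.mulVec_mulVec] at h

/-- Completion of the square in the ridge regression objective. -/
lemma ridge_complete_square (W : Matrix m ι ℝ) (z : m → ℝ) (b : ι → ℝ) :
    (z - W *ᵥ b) ⬝ᵥ (z - W *ᵥ b) + b ⬝ᵥ b = ridgeQuad W z +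
      (b - Wᵀ *ᵥ ((1 + W * Wᵀ)⁻¹ *ᵥ z)) ⬝ᵥ
        (1 + Wᵀ * W) *ᵥ (b - Wᵀ *ᵥ ((1 + W * Wᵀ)⁻¹ *ᵥ z)) := by
  have hz := ridge_solution W z
  rw [ridgeQuad]
  -- The minimiser is Wᵀu and its residual is u, since z = u + W Wᵀu; h is the deviation from the
  -- minimiser.
  set u := (1 + W * Wᵀ)⁻¹ *ᵥ z
  set h := b - Wᵀ *ᵥ u with hh
  have hb : b = Wᵀ *ᵥ u + h := by rw [hh]; abel
  have hr : z - W *ᵥ b = u - W *ᵥ h := by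
    conv_lhs => rw [← hz, hb, Matrix.mulVec_add]
    abel
  have h1 : z ⬝ᵥ u = u ⬝ᵥ u + (Wᵀ *ᵥ u) ⬝ᵥ (Wᵀ *ᵥ u) := by
    conv_lhs => rw [← hz]
    rw [add_dotProduct, dotProduct_comm (W *ᵥ _) u, dotProduct_mulVec_transpose W u]
  have h2 := quad_one_add_mul_transpose Wᵀ h
  rw [Matrix.transpose_transpose] at h2
  rw [hr, h1, h2, dotProduct_self_sub, dotProduct_mulVec_transpose W u, hb, dotProduct_self_add]
  ring

lemma quad_one_add_gram_nonneg (W : Matrix m ι ℝ) (x : ι → ℝ) :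
    0 ≤ x ⬝ᵥ (1 + Wᵀ * W) *ᵥ x := by
  have := quad_one_add_mul_transpose Wᵀ x
  rw [Matrix.transpose_transpose] at this
  rw [this]
  exact add_nonneg (dotProduct_self_nonneg' _) (dotProduct_self_nonneg' _)

lemma ridgeQuad_le (W : Matrix m ι ℝ) (z : m → ℝ) (b : ι → ℝ) :
    ridgeQuad W z ≤ (z - W *ᵥ b) ⬝ᵥ (z - W *ᵥ b) + b ⬝ᵥ b := by
  rw [ridge_complete_square]
  linarith [quad_one_add_gram_nonneg W (b - Wᵀ *ᵥ ((1 + W * Wᵀ)⁻¹ *ᵥ z))]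

/-- Take the ridge minimiser and drop its penalty. This turns lower bounds for residuals into lower
bounds for the ridge form, as `ridgeQuad_le` turns trial vectors into upper bounds. -/
lemma exists_le_ridgeQuad (W : Matrix m ι ℝ) (z : m → ℝ) :
    ∃ b, (z - W *ᵥ b) ⬝ᵥ (z - W *ᵥ b) ≤ ridgeQuad W z := by
  refine ⟨Wᵀ *ᵥ ((1 + W * Wᵀ)⁻¹ *ᵥ z), ?_⟩
  have := ridge_complete_square W z (Wᵀ *ᵥ ((1 + W * Wᵀ)⁻¹ *ᵥ z))
  rw [sub_self (Wᵀ *ᵥ _), zero_dotProduct, add_zero] at this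
  linarith [dotProduct_self_nonneg' (Wᵀ *ᵥ ((1 + W * Wᵀ)⁻¹ *ᵥ z))]

lemma ridgeQuad_nonneg (W : Matrix m ι ℝ) (z : m → ℝ) : 0 ≤ ridgeQuad W z := by
  obtain ⟨b, hb⟩ := exists_le_ridgeQuad W z
  exact (dotProduct_self_nonneg' _).trans hb

lemma ridgeQuad_smul (W : Matrix m ι ℝ) (t : ℝ) (z : m → ℝ) :
    ridgeQuad W (t • z) = t ^ 2 * ridgeQuad W z := by
  rw [ridgeQuad, ridgeQuad, Matrix.mulVec_smul, smul_dotProduct, dotProduct_smul, smul_eq_mul,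
    smul_eq_mul]; ring

end Ridge

/-! ### Closed form of the marginal likelihood -/

section Marginal

variable {n p : ℕ}

/-- The scaling of the coefficients in the model `γ`. -/
noncomputable def priorScale (c : Fin p → ℝ) (γ : Finset (Fin p)) : Fin p → ℝ :=
  fun j => if j ∈ γ then √(c j) else 0

/-- The design matrix with the columns of `γ` scaled by the prior standard deviations and the
others replaced by zero. -/
noncomputable def scaledDesign (c : Fin p → ℝ) (X : Matrix (Fin n) (Fin p) ℝ)
    (γ : Finset (Fin p)) : Matrix (Fin n) (Fin p) ℝ :=
  X * Matrix.diagonal (priorScale c γ)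

lemma scaledDesign_mulVec (c : Fin p → ℝ) (X : Matrix (Fin n) (Fin p) ℝ) (γ : Finset (Fin p))
    (b : Fin p → ℝ) :
    scaledDesign c X γ *ᵥ b = X *ᵥ fun j => priorScale c γ j * b j := by
  rw [scaledDesign, ← Matrix.mulVec_mulVec]
  congr 1
  ext j
  rw [Matrix.mulVec_diagonal]

/-- A point mass at 0 is a Gaussian of variance 0, so excluded coordinates are standard normals
scaled by 0, and every model is integrated over the same space. -/
lemma coefPrior_eq_map {c : Fin p → ℝ} (hc : ∀ j, 0 ≤ c j) (γ : Finset (Fin p)) {s : ℝ}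
    (hs : 0 ≤ s) :
    coefPrior c γ s = (stdGauss (Fin p)).map fun b j => (√s * priorScale c γ j) * b j := by
  rw [Measure.pi_map_pi (fun j => by fun_prop), coefPrior]
  congr 1
  ext1 j
  rw [gaussianReal_map_const_mul, mul_zero, mul_one]
  by_cases hj : j ∈ γ
  · rw [if_pos hj, priorScale, if_pos hj]
    congr 1
    ext
    rw [NNReal.coe_mk, Real.coe_toNNReal _ (mul_nonneg (hc j) hs), mul_pow, Real.sq_sqrt hs,
      Real.sq_sqrt (hc j), mul_comm]
  · rw [if_neg hj, priorScale, if_neg hj, mul_zero, ← gaussianReal_zero_var]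
    congr 1
    ext
    simp

lemma likelihood_eq (X : Matrix (Fin n) (Fin p) ℝ) (β : Fin p → ℝ) {s : ℝ} (hs : 0 < s)
    (y : Fin n → ℝ) :
    likelihood X β s y =
      (√(2 * Real.pi * s))⁻¹ ^ n * Real.exp (-((y - X *ᵥ β) ⬝ᵥ (y - X *ᵥ β)) / (2 * s)) := by
  simp only [likelihood, gaussianPDFReal, Real.coe_toNNReal _ hs.le]
  rw [Finset.prod_mul_distrib, Finset.prod_const, Finset.card_univ, Fintype.card_fin,
    ← Real.exp_sum, ← Finset.sum_div, Finset.sum_neg_distrib, dotProduct]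
  simp only [sq, Pi.sub_apply]

lemma posDef_one_add_gram (W : Matrix (Fin n) (Fin p) ℝ) : (1 + Wᵀ * W).PosDef := by
  simpa using posDef_one_add_mul_transpose Wᵀ

/-- In standard normal coordinates the exponent is the ridge objective for √τ y, its penalty coming
from the Gaussian density. Completing the square leaves a Gaussian integral, whose determinant moves
from size p to size n by Sylvester's identity. -/
lemma integral_likelihood {c : Fin p → ℝ} (hc : ∀ j, 0 ≤ c j) (X : Matrix (Fin n) (Fin p) ℝ)
    (γ : Finset (Fin p)) {τ : ℝ} (hτ : 0 < τ) (y : Fin n → ℝ) :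
    ∫ β, likelihood X β τ⁻¹ y ∂(coefPrior c γ τ⁻¹) =
      (√(1 + scaledDesign c X γ * (scaledDesign c X γ)ᵀ).det)⁻¹ * (√(2 * Real.pi))⁻¹ ^ n *
        (τ ^ ((n : ℝ) / 2) * Real.exp (-(ridgeQuad (scaledDesign c X γ) y / 2 * τ))) := by
  have hτi : 0 < τ⁻¹ := inv_pos.2 hτ
  have hcont : Continuous fun β : Fin p → ℝ => likelihood X β τ⁻¹ y := by
    simp only [likelihood_eq X _ hτi]
    simp only [dotProduct, Matrix.mulVec, Pi.sub_apply]
    fun_prop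
  rw [coefPrior_eq_map hc γ hτi.le, integral_map
    (measurable_pi_lambda _ fun j => (measurable_pi_apply j).const_mul _).aemeasurable hcont.aestronglyMeasurable]
  simp only [likelihood_eq X _ hτi]
  set W := scaledDesign c X γ with hW
  set z : Fin n → ℝ := √τ • y with hz
  set bs := Wᵀ *ᵥ ((1 + W * Wᵀ)⁻¹ *ᵥ z) with hbs
  have hsq : √τ * √τ = τ := Real.mul_self_sqrt hτ.le
  have hkey : ∀ b : Fin p → ℝ,
      Real.exp (-((y - X *ᵥ fun j => √τ⁻¹ * priorScale c γ j * b j) ⬝ᵥ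
        (y - X *ᵥ fun j => √τ⁻¹ * priorScale c γ j * b j)) / (2 * τ⁻¹)) =
      Real.exp (-(ridgeQuad W y / 2 * τ)) *
        Real.exp ((b ⬝ᵥ b) / 2 - ((b - bs) ⬝ᵥ (1 + Wᵀ * W) *ᵥ (b - bs)) / 2) := by
    intro b
    have h1 : (X *ᵥ fun j => √τ⁻¹ * priorScale c γ j * b j) = √τ⁻¹ • (W *ᵥ b) := by
      rw [hW, scaledDesign_mulVec, ← Matrix.mulVec_smul]
      congr 1
      ext j
      simp [mul_assoc]
    have h2 : z - W *ᵥ b = √τ • (y - √τ⁻¹ • (W *ᵥ b)) := by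
      rw [smul_sub, smul_smul, Real.sqrt_inv, mul_inv_cancel₀ (Real.sqrt_pos.2 hτ).ne', one_smul]
    have h3 := ridge_complete_square W z b
    rw [← hbs, h2, smul_dotProduct, dotProduct_smul, smul_eq_mul, smul_eq_mul, ← mul_assoc, hsq,
      hz, ridgeQuad_smul, Real.sq_sqrt hτ.le] at h3
    rw [h1, ← Real.exp_add]
    congr 1
    rw [div_mul_eq_div_div, div_inv_eq_mul]
    linarith
  simp_rw [hkey]
  rw [integral_const_mul, integral_const_mul, integral_stdGauss_quad (posDef_one_add_gram W),
    ← Matrix.det_one_add_mul_comm]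
  have hpow : (√(2 * Real.pi * τ⁻¹))⁻¹ ^ n = (√(2 * Real.pi))⁻¹ ^ n * τ ^ ((n : ℝ) / 2) := by
    rw [Real.sqrt_mul (by positivity), Real.sqrt_inv, mul_inv, inv_inv, mul_pow,
      Real.sqrt_eq_rpow τ, ← Real.rpow_natCast (τ ^ (1 / 2 : ℝ)) n, ← Real.rpow_mul hτ.le]
    congr 2
    ring
  rw [hpow]
  ring

lemma integral_chiSquared {ν : ℝ} (hν : 0 < ν) (f : ℝ → ℝ) :
    ∫ τ, f τ ∂(chiSquared ν) = ∫ τ in Set.Ioi 0,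
      ((1 / 2) ^ (ν / 2) / Real.Gamma (ν / 2) * τ ^ (ν / 2 - 1) * Real.exp (-(1 / 2 * τ))) *
        f τ := by
  have hG : 0 < Real.Gamma (ν / 2) := Real.Gamma_pos_of_pos (by positivity)
  have hm : Measurable (gammaPDF (ν / 2) (1 / 2)) :=
    (measurable_gammaPDFReal _ _).ennreal_ofReal
  rw [chiSquared, gammaMeasure, integral_withDensity_eq_integral_toReal_smul hm
    (Eventually.of_forall fun x => ENNReal.ofReal_lt_top),
    ← setIntegral_eq_integral_of_forall_compl_eq_zero (s := Set.Ici 0),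
    integral_Ici_eq_integral_Ioi]
  · refine setIntegral_congr_fun measurableSet_Ioi fun τ hτ => ?_
    have hτ' : 0 ≤ τ := le_of_lt hτ
    rw [gammaPDF_of_nonneg hτ', ENNReal.toReal_ofReal (by positivity), smul_eq_mul]
  · intro τ hτ
    simp only [Set.mem_Ici, not_le] at hτ
    simp [gammaPDF_of_neg hτ]

/-- The marginal likelihood of a model, up to a factor common to all models. -/
noncomputable def modelScore (ν : ℝ) (c : Fin p → ℝ) (X : Matrix (Fin n) (Fin p) ℝ)
    (y : Fin n → ℝ) (γ : Finset (Fin p)) : ℝ :=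
  (√(1 + scaledDesign c X γ * (scaledDesign c X γ)ᵀ).det)⁻¹ *
    (1 + ridgeQuad (scaledDesign c X γ) y) ^ (-(((n : ℝ) + ν) / 2))

lemma modelScore_pos (ν : ℝ) (c : Fin p → ℝ) (X : Matrix (Fin n) (Fin p) ℝ)
    (y : Fin n → ℝ) (γ : Finset (Fin p)) : 0 < modelScore ν c X y γ := by
  have h1 := (posDef_one_add_mul_transpose (scaledDesign c X γ)).det_pos
  have h2 := ridgeQuad_nonneg (scaledDesign c X γ) y
  exact mul_pos (inv_pos.2 (Real.sqrt_pos.2 h1)) (Real.rpow_pos_of_pos (by linarith) _)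

/-- The remaining integral over τ is a Gamma integral. The constant is chosen before p, c, X, y and
γ, hence cancels in the posterior. -/
lemma marginalLikelihood_eq {ν : ℝ} (hν : 0 < ν) (n : ℕ) : ∃ K : ℝ, 0 < K ∧
    ∀ {p : ℕ} {c : Fin p → ℝ}, (∀ j, 0 ≤ c j) → ∀ (X : Matrix (Fin n) (Fin p) ℝ)
      (y : Fin n → ℝ) (γ : Finset (Fin p)),
      marginalLikelihood ν c X y γ = K * modelScore ν c X y γ := by
  have hG : 0 < Real.Gamma (ν / 2) := Real.Gamma_pos_of_pos (by positivity)
  have hG2 : 0 < Real.Gamma (((n : ℝ) + ν) / 2) := Real.Gamma_pos_of_pos (by positivity)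
  have hpi : 0 < √(2 * Real.pi) := Real.sqrt_pos.2 (by positivity)
  refine ⟨(1 / 2) ^ (ν / 2) / Real.Gamma (ν / 2) * (√(2 * Real.pi))⁻¹ ^ n *
    (2 ^ (((n : ℝ) + ν) / 2) * Real.Gamma (((n : ℝ) + ν) / 2)), by positivity, ?_⟩
  intro p c hc X y γ
  rw [marginalLikelihood, integral_chiSquared hν, modelScore]
  set q := ridgeQuad (scaledDesign c X γ) y with hq
  have hq0 : 0 ≤ q := ridgeQuad_nonneg _ _
  set D := (√(1 + scaledDesign c X γ * (scaledDesign c X γ)ᵀ).det)⁻¹ with hD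
  have h1 : ∀ τ ∈ Set.Ioi (0 : ℝ),
      ((1 / 2) ^ (ν / 2) / Real.Gamma (ν / 2) * τ ^ (ν / 2 - 1) * Real.exp (-(1 / 2 * τ))) *
        ∫ β, likelihood X β τ⁻¹ y ∂(coefPrior c γ τ⁻¹) =
      ((1 / 2) ^ (ν / 2) / Real.Gamma (ν / 2) * (√(2 * Real.pi))⁻¹ ^ n * D) *
        (τ ^ (((n : ℝ) + ν) / 2 - 1) * Real.exp (-((1 + q) / 2 * τ))) := by
    intro τ hτ
    rw [integral_likelihood hc X γ hτ y, ← hq, ← hD]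
    have e1 : τ ^ (((n : ℝ) + ν) / 2 - 1) = τ ^ (ν / 2 - 1) * τ ^ ((n : ℝ) / 2) := by
      rw [← Real.rpow_add hτ]; congr 1; ring
    have e2 : Real.exp (-((1 + q) / 2 * τ)) =
        Real.exp (-(1 / 2 * τ)) * Real.exp (-(q / 2 * τ)) := by
      rw [← Real.exp_add]; congr 1; ring
    rw [e1, e2]; ring
  rw [setIntegral_congr_fun measurableSet_Ioi h1, integral_const_mul,
    Real.integral_rpow_mul_exp_neg_mul_Ioi (by positivity) (by positivity)]
  have e3 : (1 / ((1 + q) / 2)) ^ (((n : ℝ) + ν) / 2) =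
      2 ^ (((n : ℝ) + ν) / 2) * (1 + q) ^ (-(((n : ℝ) + ν) / 2)) := by
    rw [one_div_div, Real.div_rpow (by norm_num) (by positivity), Real.rpow_neg (by positivity),
      div_eq_mul_inv]
  rw [e3]; ring

/-! ### Posterior odds -/

lemma posterior_eq {ν : ℝ} (hν : 0 < ν) (prior : PMF (Finset (Fin p))) {c : Fin p → ℝ}
    (hc : ∀ j, 0 ≤ c j) (X : Matrix (Fin n) (Fin p) ℝ) (y : Fin n → ℝ) (γ : Finset (Fin p)) :
    posterior ν prior c X y γ = (prior γ).toReal * modelScore ν c X y γ /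
      ∑ γ', (prior γ').toReal * modelScore ν c X y γ' := by
  obtain ⟨K, hK, h⟩ := marginalLikelihood_eq hν n
  simp only [_root_.posterior, h hc]
  have e : ∀ γ', (prior γ').toReal * (K * modelScore ν c X y γ') =
      K * ((prior γ').toReal * modelScore ν c X y γ') := fun _ => by ring
  simp only [e]
  rw [← Finset.mul_sum, mul_div_mul_left _ _ hK.ne']

section Odds

variable {ν : ℝ} {prior : PMF (Finset (Fin p))} {c : Fin p → ℝ}
  {X : Matrix (Fin n) (Fin p) ℝ} {y : Fin n → ℝ} {γ₀ : Finset (Fin p)}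

lemma sum_score_pos (ν : ℝ) (c : Fin p → ℝ) (X : Matrix (Fin n) (Fin p) ℝ) (y : Fin n → ℝ)
    (h₀ : prior γ₀ ≠ 0) : 0 < ∑ γ', (prior γ').toReal * modelScore ν c X y γ' := by
  refine Finset.sum_pos' (fun γ _ => mul_nonneg ENNReal.toReal_nonneg (modelScore_pos _ _ _ _ _).le)
    ⟨γ₀, Finset.mem_univ _, mul_pos (ENNReal.toReal_pos h₀ (prior.apply_ne_top γ₀))
      (modelScore_pos _ _ _ _ _)⟩

lemma posterior_nonneg (hν : 0 < ν) (hc : ∀ j, 0 ≤ c j) (h₀ : prior γ₀ ≠ 0)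
    (γ : Finset (Fin p)) : 0 ≤ posterior ν prior c X y γ := by
  rw [posterior_eq hν prior hc]
  exact div_nonneg (mul_nonneg ENNReal.toReal_nonneg (modelScore_pos _ _ _ _ _).le)
    (sum_score_pos ν c X y h₀).le

lemma sum_posterior (hν : 0 < ν) (hc : ∀ j, 0 ≤ c j) (h₀ : prior γ₀ ≠ 0) :
    ∑ γ, posterior ν prior c X y γ = 1 := by
  simp only [posterior_eq hν prior hc]
  rw [← Finset.sum_div, div_self (sum_score_pos ν c X y h₀).ne']

lemma posterior_add_sum_erase (hν : 0 < ν) (hc : ∀ j, 0 ≤ c j) (h₀ : prior γ₀ ≠ 0) :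
    posterior ν prior c X y γ₀ + ∑ γ ∈ Finset.univ.erase γ₀, posterior ν prior c X y γ = 1 := by
  rw [Finset.add_sum_erase _ _ (Finset.mem_univ γ₀), sum_posterior hν hc h₀]

lemma posterior_odds_le (hν : 0 < ν) (hc : ∀ j, 0 ≤ c j) (h₀ : prior γ₀ ≠ 0) {C₀ : ℝ}
    {γ : Finset (Fin p)} (hγ : (prior γ).toReal / (prior γ₀).toReal ≤ C₀) :
    posterior ν prior c X y γ / posterior ν prior c X y γ₀ ≤
      C₀ * (modelScore ν c X y γ / modelScore ν c X y γ₀) := by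
  rw [posterior_eq hν prior hc, posterior_eq hν prior hc,
    div_div_div_cancel_right₀ (sum_score_pos ν c X y h₀).ne', mul_div_mul_comm]
  exact mul_le_mul_of_nonneg_right hγ
    (div_nonneg (modelScore_pos _ _ _ _ _).le (modelScore_pos _ _ _ _ _).le)

/-- A posterior probability is at most the odds against the true model, because p(γ₀ | Z) ≤ 1. -/
lemma sum_erase_posterior_le (hν : 0 < ν) (hc : ∀ j, 0 ≤ c j) (h₀ : prior γ₀ ≠ 0) {C₀ : ℝ}
    (hC : ∀ γ, (prior γ).toReal / (prior γ₀).toReal ≤ C₀) :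
    ∑ γ ∈ Finset.univ.erase γ₀, posterior ν prior c X y γ ≤
      C₀ * ∑ γ ∈ Finset.univ.erase γ₀, modelScore ν c X y γ / modelScore ν c X y γ₀ := by
  rw [Finset.mul_sum]
  refine Finset.sum_le_sum fun γ _ => ?_
  refine le_trans ?_ (posterior_odds_le hν hc h₀ (hC γ))
  have hpos : 0 < posterior ν prior c X y γ₀ := by
    rw [posterior_eq hν prior hc]
    exact div_pos (mul_pos (ENNReal.toReal_pos h₀ (prior.apply_ne_top γ₀))
      (modelScore_pos _ _ _ _ _)) (sum_score_pos ν c X y h₀)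
  have hle : posterior ν prior c X y γ₀ ≤ 1 := by
    have h1 := posterior_add_sum_erase (X := X) (y := y) hν hc h₀
    have h2 : 0 ≤ ∑ γ ∈ Finset.univ.erase γ₀, posterior ν prior c X y γ :=
      Finset.sum_nonneg fun γ _ => posterior_nonneg hν hc h₀ γ
    linarith
  exact le_div_self (posterior_nonneg hν hc h₀ γ) hpos hle

end Odds

end Marginal

/-! ### Deterministic bounds on the model scores -/

section Deterministic

variable {n p : ℕ}

/-- Quadratic-form versions of the eigenvalue conditions on the design. -/
structure GoodDesign (X : Matrix (Fin n) (Fin p) ℝ) (γ₀ : Finset (Fin p)) (a b h : ℝ) : Prop where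
  miss : ∀ (γ : Finset (Fin p)) (v : Fin p → ℝ), (∀ j ∉ γ₀ \ γ, v j = 0) →
    a * (v ⬝ᵥ v) ≤ (X *ᵥ v) ⬝ᵥ (1 - projMat X γ) *ᵥ (X *ᵥ v)
  upper : ∀ v : Fin p → ℝ, (∀ j ∉ γ₀, v j = 0) → (X *ᵥ v) ⬝ᵥ (X *ᵥ v) ≤ b * (v ⬝ᵥ v)
  excess : ∀ v : Fin p → ℝ, (∀ j ∈ γ₀, v j = 0) →
    h * (v ⬝ᵥ v) ≤ (X *ᵥ v) ⬝ᵥ (1 - projMat X γ₀) *ᵥ (X *ᵥ v)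

/-- The restriction of a vector to a model, extended by zero. -/
noncomputable def restrictTo (γ : Finset (Fin p)) (v : Fin p → ℝ) : Fin p → ℝ :=
  fun j => if j ∈ γ then v j else 0

lemma restrictTo_notMem {γ : Finset (Fin p)} (v : Fin p → ℝ) {j : Fin p} (hj : j ∉ γ) :
    restrictTo γ v j = 0 := if_neg hj

lemma restrictTo_mem {γ : Finset (Fin p)} (v : Fin p → ℝ) {j : Fin p} (hj : j ∈ γ) :
    restrictTo γ v j = v j := if_pos hj

lemma eq_zero_of_dotProduct_self_nonpos {ι : Type*} [Fintype ι] [DecidableEq ι]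
    {v : ι → ℝ} (h : v ⬝ᵥ v ≤ 0) :
    v = 0 := by
  have h0 : v ⬝ᵥ v = 0 := le_antisymm h (dotProduct_self_nonneg' v)
  exact dotProduct_self_eq_zero.1 h0

variable {X : Matrix (Fin n) (Fin p) ℝ} {γ₀ : Finset (Fin p)} {a b h : ℝ}

lemma GoodDesign.lower (hX : GoodDesign X γ₀ a b h) {v : Fin p → ℝ} (hv : ∀ j ∉ γ₀, v j = 0) :
    a * (v ⬝ᵥ v) ≤ (X *ᵥ v) ⬝ᵥ (X *ᵥ v) :=
  (hX.miss ∅ v (by simpa using hv)).trans (dotProduct_one_sub_hat_le _ _)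

lemma isUnit_colSub_of {γ : Finset (Fin p)}
    (hinj : ∀ v : Fin p → ℝ, (∀ j ∉ γ, v j = 0) → X *ᵥ v = 0 → v = 0) :
    IsUnit ((colSub X γ)ᵀ * colSub X γ).det := by
  refine isUnit_det_gram fun d hd => ?_
  rw [colSub_mulVec] at hd
  have hz : extendZero d = 0 := hinj _ (fun j hj => extendZero_notMem d hj) hd
  rw [← extendZero_val d, hz]
  rfl

lemma GoodDesign.isUnit_true (hX : GoodDesign X γ₀ a b h) (ha : 0 < a) :
    IsUnit ((colSub X γ₀)ᵀ * colSub X γ₀).det := by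
  refine isUnit_colSub_of fun v hv h0 => eq_zero_of_dotProduct_self_nonpos ?_
  have := hX.lower hv
  rw [h0, dotProduct_zero] at this
  exact nonpos_of_mul_nonpos_right this ha

/-- Split v into its parts on and off γ₀. Projecting away the columns of γ₀ kills the first part, so
`excess` forces the second to vanish; then `lower` kills the first. -/
lemma GoodDesign.injective (hX : GoodDesign X γ₀ a b h) (ha : 0 < a) (hh : 0 < h)
    {v : Fin p → ℝ} (h0 : X *ᵥ v = 0) : v = 0 := by
  have hu := hX.isUnit_true ha
  set v1 := restrictTo γ₀ v with hv1
  set v2 := v - v1 with hv2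
  have hv1s : ∀ j ∉ γ₀, v1 j = 0 := fun j hj => restrictTo_notMem v hj
  have hv2s : ∀ j ∈ γ₀, v2 j = 0 := fun j hj => by
    rw [hv2, Pi.sub_apply, hv1, restrictTo_mem v hj, sub_self]
  have hX2 : X *ᵥ v2 = 0 - colSub X γ₀ *ᵥ fun j => v1 j := by
    rw [hv2, Matrix.mulVec_sub, h0, ← mulVec_eq_colSub X hv1s]
  have h2 : v2 = 0 := by
    refine eq_zero_of_dotProduct_self_nonpos (nonpos_of_mul_nonpos_right ?_ hh)
    have := hX.excess v2 hv2s
    rwa [hX2, projMat_eq_hat, one_sub_hat_quad_sub hu, zero_dotProduct] at this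
  have hvv : v = v1 := sub_eq_zero.1 h2
  rw [hvv] at h0 ⊢
  refine eq_zero_of_dotProduct_self_nonpos (nonpos_of_mul_nonpos_right ?_ ha)
  have := hX.lower hv1s
  rwa [h0, dotProduct_zero] at this

lemma GoodDesign.isUnit_colSub (hX : GoodDesign X γ₀ a b h) (ha : 0 < a) (hh : 0 < h)
    (γ : Finset (Fin p)) : IsUnit ((colSub X γ)ᵀ * colSub X γ).det :=
  isUnit_colSub_of fun _ _ h0 => hX.injective ha hh h0

lemma GoodDesign.isUnit_gram (hX : GoodDesign X γ₀ a b h) (ha : 0 < a) (hh : 0 < h) :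
    IsUnit (Xᵀ * X).det :=
  isUnit_det_gram fun _ h0 => hX.injective ha hh h0

/-- A residual attaining a lower bound for the ridge quadratic form of a model. -/
lemma exists_supported_le_ridgeQuad (c : Fin p → ℝ) (X : Matrix (Fin n) (Fin p) ℝ)
    (γ : Finset (Fin p)) (z : Fin n → ℝ) :
    ∃ v : Fin p → ℝ, (∀ j ∉ γ, v j = 0) ∧
      (z - X *ᵥ v) ⬝ᵥ (z - X *ᵥ v) ≤ ridgeQuad (scaledDesign c X γ) z := by
  obtain ⟨b, hb⟩ := exists_le_ridgeQuad (scaledDesign c X γ) z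
  rw [scaledDesign_mulVec] at hb
  exact ⟨_, fun j hj => by rw [priorScale, if_neg hj, zero_mul], hb⟩

lemma residual_le_ridgeQuad (c : Fin p → ℝ) {γ : Finset (Fin p)}
    (hu : IsUnit ((colSub X γ)ᵀ * colSub X γ).det) (z : Fin n → ℝ) :
    z ⬝ᵥ (1 - projMat X γ) *ᵥ z ≤ ridgeQuad (scaledDesign c X γ) z := by
  obtain ⟨v, hv, hle⟩ := exists_supported_le_ridgeQuad c X γ z
  rw [mulVec_eq_colSub X hv] at hle
  exact (one_sub_hat_quad_le hu z _).trans hle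

lemma ridgeQuad_le_supported {c : Fin p → ℝ} {φ : ℝ} (hφ : 0 < φ) (hc : ∀ j, φ ≤ c j)
    (γ : Finset (Fin p)) (z : Fin n → ℝ) {v : Fin p → ℝ} (hv : ∀ j ∉ γ, v j = 0) :
    ridgeQuad (scaledDesign c X γ) z ≤ (z - X *ᵥ v) ⬝ᵥ (z - X *ᵥ v) + (v ⬝ᵥ v) / φ := by
  -- The trial vector undoes the column scaling, so the fit is X v and the penalty is the sum of
  -- v_j²/c_j.
  have h1 := ridgeQuad_le (scaledDesign c X γ) z fun j => v j / √(c j)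
  have e : (fun j => priorScale c γ j * (v j / √(c j))) = v := by
    ext j
    by_cases hj : j ∈ γ
    · rw [priorScale, if_pos hj, mul_div_cancel₀]
      exact (Real.sqrt_pos.2 (hφ.trans_le (hc j))).ne'
    · rw [hv j hj, zero_div, mul_zero]
  rw [scaledDesign_mulVec, e] at h1
  refine h1.trans (add_le_add_right ?_ _)
  rw [dotProduct, dotProduct, Finset.sum_div]
  refine Finset.sum_le_sum fun j _ => ?_
  rw [div_mul_div_comm, Real.mul_self_sqrt (hφ.le.trans (hc j))]
  exact div_le_div_of_nonneg_left (mul_self_nonneg _) hφ (hc j)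

/-- The squared norm of a perturbed noise vector. -/
lemma noise_add_ge (hu : IsUnit (Xᵀ * X).det) (e : Fin n → ℝ) (u : Fin p → ℝ) :
    e ⬝ᵥ e - 2 * (e ⬝ᵥ hat X *ᵥ e) + ((X *ᵥ u) ⬝ᵥ (X *ᵥ u)) / 2 ≤
      (e + X *ᵥ u) ⬝ᵥ (e + X *ᵥ u) := by
  have h1 := dotProduct_one_sub_mulVec (hat X) (e + X *ᵥ u)
  have h2 := one_sub_hat_quad_sub hu e (-u)
  rw [Matrix.mulVec_neg, sub_neg_eq_add, h1, dotProduct_one_sub_mulVec,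
    dotProduct_mulVec_of_symm_idem (hat_transpose X) (hat_mul_hat X) (e + X *ᵥ u),
    Matrix.mulVec_add, Matrix.mulVec_mulVec, hat_mul_self hu] at h2
  -- With H = `hat X`, |e + Xu|² = |(1-H)e|² + |He + Xu|², and |Xu|² ≤ 2(|He + Xu|² + |He|²). The
  -- cross term between noise and signal thus costs only multiples of eᵀHe, uniformly in u.
  have h3 := dotProduct_self_add_le (hat X *ᵥ e + X *ᵥ u) (-(hat X *ᵥ e))
  rw [add_neg_cancel_comm, neg_dotProduct_neg,
    ← dotProduct_mulVec_of_symm_idem (hat_transpose X) (hat_mul_hat X)] at h3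
  linarith

/-- P_γ e lies in the column space of X, so its residual is at least that of the full projection. -/
lemma hat_sub_le (hu : IsUnit (Xᵀ * X).det) (γ : Finset (Fin p)) (e : Fin n → ℝ) :
    e ⬝ᵥ projMat X γ *ᵥ e ≤ e ⬝ᵥ hat X *ᵥ e := by
  have h1 := one_sub_hat_quad_le hu e
    (extendZero ((((colSub X γ)ᵀ * colSub X γ)⁻¹ * (colSub X γ)ᵀ) *ᵥ e))
  have h2 : X *ᵥ extendZero ((((colSub X γ)ᵀ * colSub X γ)⁻¹ * (colSub X γ)ᵀ) *ᵥ e) =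
      hat (colSub X γ) *ᵥ e := by
    rw [← colSub_mulVec, Matrix.mulVec_mulVec, hat, Matrix.mul_assoc]
  have h3 : e - hat (colSub X γ) *ᵥ e = (1 - hat (colSub X γ)) *ᵥ e := by
    rw [Matrix.sub_mulVec, Matrix.one_mulVec]
  rw [h2, h3, ← dotProduct_one_sub_hat, dotProduct_one_sub_mulVec, dotProduct_one_sub_mulVec] at h1
  rw [projMat_eq_hat]
  linarith

/-! #### Models that miss a true covariate -/

/-- For any fit v on γ, the vector β - v agrees with β on γ₀ \ γ and otherwise differs only inside
γ. Projecting out X_γ leaves the missed part of the signal, of squared norm at least aψ²; half of it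
survives `noise_add_ge`. -/
lemma GoodDesign.ridgeQuad_miss_ge (hX : GoodDesign X γ₀ a b h) (ha : 0 < a) (hh : 0 < h)
    (c : Fin p → ℝ) {β : Fin p → ℝ} (hβ : ∀ j ∉ γ₀, β j = 0) {ψ : ℝ} (hψ0 : 0 ≤ ψ)
    (hψ : ∀ j ∈ γ₀, ψ ≤ |β j|) (e : Fin n → ℝ) {γ : Finset (Fin p)} (hγ : ¬ γ₀ ⊆ γ) :
    e ⬝ᵥ e - 2 * (e ⬝ᵥ hat X *ᵥ e) + a * ψ ^ 2 / 2 ≤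
      ridgeQuad (scaledDesign c X γ) (X *ᵥ β + e) := by
  obtain ⟨v, hv, hle⟩ := exists_supported_le_ridgeQuad c X γ (X *ᵥ β + e)
  refine le_trans ?_ hle
  have e1 : X *ᵥ β + e - X *ᵥ v = e + X *ᵥ (β - v) := by rw [Matrix.mulVec_sub]; abel
  rw [e1]
  refine le_trans ?_ (noise_add_ge (hX.isUnit_gram ha hh) e (β - v))
  set βm := restrictTo (γ₀ \ γ) β with hβm
  have hsupp : ∀ j ∉ γ, (βm - (β - v)) j = 0 := by
    intro j hj
    by_cases hj0 : j ∈ γ₀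
    · simp [hβm, restrictTo, hj, hj0, hv j hj]
    · simp [hβm, restrictTo, hj0, hv j hj, hβ j hj0]
  have e2 : X *ᵥ (β - v) = X *ᵥ βm - colSub X γ *ᵥ fun j => (βm - (β - v)) j := by
    rw [← mulVec_eq_colSub X hsupp, ← Matrix.mulVec_sub, sub_sub_cancel]
  have h1 := one_sub_hat_quad_le (hX.isUnit_colSub ha hh γ) (X *ᵥ βm)
    fun j => (βm - (β - v)) j
  rw [← e2, ← projMat_eq_hat] at h1
  have h2 := (hX.miss γ βm fun j hj => restrictTo_notMem β hj).trans h1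
  obtain ⟨j, hj0, hj⟩ := Finset.not_subset.1 hγ
  have h3 : ψ ^ 2 ≤ βm ⬝ᵥ βm := by
    calc ψ ^ 2 ≤ βm j * βm j := by
          rw [hβm, restrictTo_mem β (Finset.mem_sdiff.2 ⟨hj0, hj⟩), ← abs_mul_abs_self, sq]
          exact mul_self_le_mul_self hψ0 (hψ j hj0)
      _ ≤ _ := Finset.single_le_sum (f := fun i => βm i * βm i)
          (fun i _ => mul_self_nonneg _) (Finset.mem_univ j)
  have h4 := mul_le_mul_of_nonneg_left h3 ha.le
  linarith

lemma ridgeQuad_true_le {c : Fin p → ℝ} {φ : ℝ} (hφ : 0 < φ) (hc : ∀ j, φ ≤ c j)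
    {β : Fin p → ℝ} (hβ : ∀ j ∉ γ₀, β j = 0) (e : Fin n → ℝ) :
    ridgeQuad (scaledDesign c X γ₀) (X *ᵥ β + e) ≤ e ⬝ᵥ e + (β ⬝ᵥ β) / φ := by
  have := ridgeQuad_le_supported (X := X) hφ hc γ₀ (X *ᵥ β + e) hβ
  rwa [add_sub_cancel_left] at this

lemma one_le_det_one_add_mul_transpose (W : Matrix (Fin n) (Fin p) ℝ) :
    1 ≤ (1 + W * Wᵀ).det := by
  have := pow_card_le_det (transpose_one_add_mul_transpose W) zero_le_one fun x => by
    rw [quad_one_add_mul_transpose, one_mul]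
    linarith [dotProduct_self_nonneg' (Wᵀ *ᵥ x)]
  rwa [one_pow] at this

lemma GoodDesign.det_true_le (hX : GoodDesign X γ₀ a b h) (hb : 0 ≤ b) {c : Fin p → ℝ}
    (hc0 : ∀ j, 0 ≤ c j) {φ : ℝ} (hc : ∀ j, c j ≤ φ) :
    (1 + scaledDesign c X γ₀ * (scaledDesign c X γ₀)ᵀ).det ≤ (1 + b * φ) ^ p := by
  set W := scaledDesign c X γ₀ with hW
  have hq : ∀ x, x ⬝ᵥ (1 + Wᵀ * W) *ᵥ x = x ⬝ᵥ x + (W *ᵥ x) ⬝ᵥ (W *ᵥ x) := fun x => by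
    simpa using quad_one_add_mul_transpose Wᵀ x
  -- Passing to the p × p determinant gives the exponent p instead of n.
  rw [Matrix.det_one_add_mul_comm]
  refine (det_le_pow_card (a := 1 + b * φ) (by simp [Matrix.transpose_mul])
    (quad_one_add_gram_nonneg W) fun x => ?_).trans_eq (by rw [Fintype.card_fin])
  rw [hq, add_mul, one_mul]
  refine add_le_add_right ?_ _
  rw [hW, scaledDesign_mulVec]
  refine (hX.upper _ fun j hj => by rw [priorScale, if_neg hj, zero_mul]).trans ?_
  rw [mul_assoc]
  refine mul_le_mul_of_nonneg_left ?_ hb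
  rw [dotProduct, dotProduct, Finset.mul_sum]
  refine Finset.sum_le_sum fun j _ => ?_
  rw [mul_mul_mul_comm]
  refine mul_le_mul_of_nonneg_right ?_ (mul_self_nonneg _)
  rw [priorScale]
  split_ifs
  · rw [Real.mul_self_sqrt (hc0 j)]; exact hc j
  · rw [mul_zero]; exact (hc0 j).trans (hc j)

lemma score_ratio_le {ν : ℝ} (hν : 0 < ν) (c : Fin p → ℝ) (y : Fin n → ℝ)
    (γ : Finset (Fin p)) {D R : ℝ}
    (hD : (1 + scaledDesign c X γ₀ * (scaledDesign c X γ₀)ᵀ).det /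
      (1 + scaledDesign c X γ * (scaledDesign c X γ)ᵀ).det ≤ D)
    (hR : (1 + ridgeQuad (scaledDesign c X γ₀) y) / (1 + ridgeQuad (scaledDesign c X γ) y) ≤ R) :
    modelScore ν c X y γ / modelScore ν c X y γ₀ ≤ √D * R ^ (((n : ℝ) + ν) / 2) := by
  have d1 := (posDef_one_add_mul_transpose (scaledDesign c X γ)).det_pos
  have d0 := (posDef_one_add_mul_transpose (scaledDesign c X γ₀)).det_pos
  have q1 := ridgeQuad_nonneg (scaledDesign c X γ) y
  have q0 := ridgeQuad_nonneg (scaledDesign c X γ₀) y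
  have hs : 0 ≤ ((n : ℝ) + ν) / 2 := by positivity
  rw [modelScore, modelScore, mul_div_mul_comm]
  refine mul_le_mul ?_ ?_ (by positivity) (Real.sqrt_nonneg _)
  · rw [inv_div_inv, ← Real.sqrt_div d0.le]
    exact Real.sqrt_le_sqrt hD
  · rw [Real.rpow_neg (by linarith), Real.rpow_neg (by linarith), inv_div_inv,
      ← Real.div_rpow (by linarith) (by linarith)]
    exact Real.rpow_le_rpow (by positivity) hR hs

lemma GoodDesign.score_ratio_miss_le (hX : GoodDesign X γ₀ a b h) (ha : 0 < a) (hb : 0 ≤ b)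
    (hh : 0 < h) {ν : ℝ} (hν : 0 < ν) {c : Fin p → ℝ} {φ φ' : ℝ} (hφ : 0 < φ)
    (hc : ∀ j, φ ≤ c j) (hc' : ∀ j, c j ≤ φ') {β : Fin p → ℝ} (hβ : ∀ j ∉ γ₀, β j = 0) {ψ : ℝ}
    (hψ0 : 0 ≤ ψ) (hψ : ∀ j ∈ γ₀, ψ ≤ |β j|) (e : Fin n → ℝ)
    (hpos : 0 < 1 + (e ⬝ᵥ e - 2 * (e ⬝ᵥ hat X *ᵥ e) + a * ψ ^ 2 / 2))
    {γ : Finset (Fin p)} (hγ : ¬ γ₀ ⊆ γ) :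
    modelScore ν c X (X *ᵥ β + e) γ / modelScore ν c X (X *ᵥ β + e) γ₀ ≤
      √((1 + b * φ') ^ p) *
        ((1 + (e ⬝ᵥ e + (β ⬝ᵥ β) / φ)) /
          (1 + (e ⬝ᵥ e - 2 * (e ⬝ᵥ hat X *ᵥ e) + a * ψ ^ 2 / 2))) ^ (((n : ℝ) + ν) / 2) := by
  refine score_ratio_le hν c _ γ ?_ ?_
  · have d0 := (posDef_one_add_mul_transpose (scaledDesign c X γ₀)).det_pos
    exact (div_le_self d0.le (one_le_det_one_add_mul_transpose _)).trans
      (hX.det_true_le hb (fun j => hφ.le.trans (hc j)) hc')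
  · have h1 := ridgeQuad_true_le (X := X) hφ hc hβ e
    have h2 := hX.ridgeQuad_miss_ge ha hh c hβ hψ0 hψ e hγ
    have h3 := ridgeQuad_nonneg (scaledDesign c X γ₀) (X *ᵥ β + e)
    exact div_le_div₀ (by linarith) (by linarith) hpos (by linarith)

end Deterministic

/-! #### Models that strictly contain the true one -/

section Excess

variable {n p : ℕ} {X : Matrix (Fin n) (Fin p) ℝ} {γ₀ : Finset (Fin p)} {a b h : ℝ}

/-- The columns of `η` projected to the orthogonal complement of those of `γ₀`. -/
noncomputable def excessDesign (X : Matrix (Fin n) (Fin p) ℝ) (γ₀ η : Finset (Fin p)) :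
    Matrix (Fin n) {j // j ∈ η} ℝ :=
  (1 - projMat X γ₀) * colSub X η

lemma transpose_one_sub_projMat (X : Matrix (Fin n) (Fin p) ℝ) (γ : Finset (Fin p)) :
    (1 - projMat X γ)ᵀ = 1 - projMat X γ := one_sub_symm (hat_transpose _)

lemma GoodDesign.isUnit_excess (hX : GoodDesign X γ₀ a b h) (hh : 0 < h) {η : Finset (Fin p)}
    (hη : Disjoint γ₀ η) :
    IsUnit ((excessDesign X γ₀ η)ᵀ * excessDesign X γ₀ η).det := by
  refine isUnit_det_gram fun d hd => eq_zero_of_dotProduct_self_nonpos ?_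
  refine nonpos_of_mul_nonpos_right ?_ hh
  have h1 := hX.excess (extendZero d) fun j hj =>
    extendZero_notMem d (Finset.disjoint_left.1 hη hj)
  rwa [extendZero_dotProduct_self, ← colSub_mulVec, Matrix.mulVec_mulVec, ← excessDesign, hd,
    dotProduct_zero] at h1

/-- The columns of the excess design are orthogonal to those of γ₀, so projecting onto them does not
see P_γ₀. -/
lemma hat_excessDesign_mul (X : Matrix (Fin n) (Fin p) ℝ) (γ₀ η : Finset (Fin p)) :
    hat (excessDesign X γ₀ η) * (1 - projMat X γ₀) = hat (excessDesign X γ₀ η) := by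
  have h1 : (excessDesign X γ₀ η)ᵀ * (1 - projMat X γ₀) = (excessDesign X γ₀ η)ᵀ := by
    rw [excessDesign, Matrix.transpose_mul, transpose_one_sub_projMat, Matrix.mul_assoc,
      projMat_eq_hat, one_sub_idem (hat_mul_hat _)]
  rw [hat, Matrix.mul_assoc, h1]

lemma hat_excessDesign_quad (X : Matrix (Fin n) (Fin p) ℝ) (γ₀ η : Finset (Fin p))
    (e : Fin n → ℝ) :
    ((1 - projMat X γ₀) *ᵥ e) ⬝ᵥ hat (excessDesign X γ₀ η) *ᵥ ((1 - projMat X γ₀) *ᵥ e) =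
      e ⬝ᵥ hat (excessDesign X γ₀ η) *ᵥ e := by
  rw [dotProduct_mulVec_of_symm_idem (hat_transpose _) (hat_mul_hat _), Matrix.mulVec_mulVec,
    hat_excessDesign_mul, ← dotProduct_mulVec_of_symm_idem (hat_transpose _) (hat_mul_hat _)]

/-- The first bound is crude and only keeps denominators away from 0. The second minimises over the
coefficients in γ₀, then over the rest after projecting; its leading term matches that of
`ridgeQuad_true_le_residual` and cancels in the comparison. -/
lemma GoodDesign.ridgeQuad_over_ge (hX : GoodDesign X γ₀ a b h) (ha : 0 < a) (hh : 0 < h)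
    (c : Fin p → ℝ) {β : Fin p → ℝ} (hβ : ∀ j ∉ γ₀, β j = 0) (e : Fin n → ℝ)
    (γ : Finset (Fin p)) :
    e ⬝ᵥ e - e ⬝ᵥ hat X *ᵥ e ≤ ridgeQuad (scaledDesign c X γ) (X *ᵥ β + e) ∧
    e ⬝ᵥ (1 - projMat X γ₀) *ᵥ e - e ⬝ᵥ hat (excessDesign X γ₀ (γ \ γ₀)) *ᵥ e ≤
      ridgeQuad (scaledDesign c X γ) (X *ᵥ β + e) := by
  obtain ⟨v, hv, hle⟩ := exists_supported_le_ridgeQuad c X γ (X *ᵥ β + e)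
  have e1 : X *ᵥ β + e - X *ᵥ v = e - X *ᵥ (v - β) := by rw [Matrix.mulVec_sub]; abel
  rw [e1] at hle
  refine ⟨le_trans ?_ hle, le_trans ?_ hle⟩
  · rw [← dotProduct_one_sub_mulVec]
    exact one_sub_hat_quad_le (hX.isUnit_gram ha hh) e _
  · set u := v - β with hu
    set u0 := restrictTo γ₀ u with hu0
    have hu0s : ∀ j ∉ γ₀, u0 j = 0 := fun j hj => restrictTo_notMem u hj
    have hu1s : ∀ j ∉ γ \ γ₀, (u - u0) j = 0 := by
      intro j hj
      by_cases hj0 : j ∈ γ₀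
      · simp [hu0, restrictTo, hj0]
      · have hjγ : j ∉ γ := fun hc => hj (Finset.mem_sdiff.2 ⟨hc, hj0⟩)
        simp [hu0, restrictTo, hj0, hu, hβ j hj0, hv j hjγ]
    have e2 : e - X *ᵥ u = (e - X *ᵥ (u - u0)) - colSub X γ₀ *ᵥ fun j => u0 j := by
      rw [← mulVec_eq_colSub X hu0s, sub_sub, ← Matrix.mulVec_add, sub_add_cancel]
    rw [e2]
    refine le_trans ?_ (one_sub_hat_quad_le (hX.isUnit_true ha) _ _)
    rw [dotProduct_one_sub_hat, ← projMat_eq_hat, Matrix.mulVec_sub,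
      mulVec_eq_colSub X hu1s, Matrix.mulVec_mulVec, ← excessDesign]
    refine le_trans (le_of_eq ?_)
      (one_sub_hat_quad_le (hX.isUnit_excess hh Finset.disjoint_sdiff) _ _)
    rw [dotProduct_one_sub_mulVec (hat _), hat_excessDesign_quad, projMat_eq_hat,
      dotProduct_one_sub_hat]

/-- The trial vector is β plus the least squares coefficients d of the noise on X_γ₀: its residual
is (1 - P_γ₀)e exactly, and a|d|² ≤ |P_γ₀ e|² ≤ eᵀ `hat X` e bounds the extra penalty. -/
lemma GoodDesign.ridgeQuad_true_le_residual (hX : GoodDesign X γ₀ a b h) (ha : 0 < a)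
    (hh : 0 < h) {c : Fin p → ℝ} {φ : ℝ} (hφ : 0 < φ) (hc : ∀ j, φ ≤ c j)
    {β : Fin p → ℝ} (hβ : ∀ j ∉ γ₀, β j = 0) (e : Fin n → ℝ) :
    ridgeQuad (scaledDesign c X γ₀) (X *ᵥ β + e) ≤ e ⬝ᵥ (1 - projMat X γ₀) *ᵥ e +
      2 * (β ⬝ᵥ β + (e ⬝ᵥ hat X *ᵥ e) / a) / φ := by
  set d := (((colSub X γ₀)ᵀ * colSub X γ₀)⁻¹ * (colSub X γ₀)ᵀ) *ᵥ e with hd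
  have hd0 : ∀ j ∉ γ₀, extendZero d j = 0 := fun j hj => extendZero_notMem d hj
  have hXd : X *ᵥ extendZero d = projMat X γ₀ *ᵥ e := by
    rw [← colSub_mulVec, hd, Matrix.mulVec_mulVec, projMat, Matrix.mul_assoc]
  have hle := ridgeQuad_le_supported (X := X) hφ hc γ₀ (X *ᵥ β + e) (v := β + extendZero d)
    fun j hj => by rw [Pi.add_apply, hβ j hj, hd0 j hj, add_zero]
  have e1 : X *ᵥ β + e - X *ᵥ (β + extendZero d) = (1 - projMat X γ₀) *ᵥ e := by
    rw [Matrix.mulVec_add, hXd, Matrix.sub_mulVec, Matrix.one_mulVec]; abel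
  rw [e1, projMat_eq_hat, ← dotProduct_one_sub_hat] at hle
  refine hle.trans (add_le_add_right ?_ _)
  refine div_le_div_of_nonneg_right ((dotProduct_self_add_le _ _).trans ?_) hφ.le
  have h1 := hX.lower hd0
  rw [hXd, projMat_eq_hat, ← dotProduct_mulVec_of_symm_idem (hat_transpose _) (hat_mul_hat _)] at h1
  have h2 := h1.trans (hat_sub_le (hX.isUnit_gram ha hh) γ₀ e)
  have h3 : extendZero d ⬝ᵥ extendZero d ≤ (e ⬝ᵥ hat X *ᵥ e) / a := by
    rw [le_div_iff₀ ha]; linarith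
  linarith

lemma scaledDesign_mul_transpose_union (c : Fin p → ℝ) (X : Matrix (Fin n) (Fin p) ℝ)
    {γ : Finset (Fin p)} (hγ : γ₀ ⊆ γ) :
    scaledDesign c X γ * (scaledDesign c X γ)ᵀ =
      scaledDesign c X γ₀ * (scaledDesign c X γ₀)ᵀ +
        (colSub X (γ \ γ₀) * Matrix.diagonal fun j : {j // j ∈ γ \ γ₀} => √(c j)) *
          (colSub X (γ \ γ₀) * Matrix.diagonal fun j : {j // j ∈ γ \ γ₀} => √(c j))ᵀ := by
  ext i l
  have h1 : ∀ γ' : Finset (Fin p), (scaledDesign c X γ' * (scaledDesign c X γ')ᵀ) i l =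
      ∑ j, X i j * X l j * (priorScale c γ' j * priorScale c γ' j) := by
    intro γ'
    rw [Matrix.mul_apply]
    refine Finset.sum_congr rfl fun j _ => ?_
    rw [Matrix.transpose_apply, scaledDesign, Matrix.mul_diagonal, Matrix.mul_diagonal]
    ring
  have h2 : ((colSub X (γ \ γ₀) * Matrix.diagonal fun j : {j // j ∈ γ \ γ₀} => √(c j)) *
      (colSub X (γ \ γ₀) * Matrix.diagonal fun j : {j // j ∈ γ \ γ₀} => √(c j))ᵀ) i l =
      ∑ j, X i j * X l j * (priorScale c (γ \ γ₀) j * priorScale c (γ \ γ₀) j) := by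
    rw [Matrix.mul_apply, sum_supported (γ := γ \ γ₀) fun j hj => by
      rw [priorScale, if_neg hj, mul_zero, mul_zero]]
    refine Finset.sum_congr rfl fun j _ => ?_
    rw [Matrix.transpose_apply, Matrix.mul_diagonal, Matrix.mul_diagonal, priorScale,
      if_pos j.2]
    simp only [colSub, Matrix.submatrix_apply, id]
    ring
  rw [Matrix.add_apply, h1, h1, h2, ← Finset.sum_add_distrib]
  refine Finset.sum_congr rfl fun j _ => ?_
  rw [← mul_add]
  congr 1
  by_cases hj0 : j ∈ γ₀
  · simp [priorScale, hj0, hγ hj0]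
  · simp [priorScale, hj0]

/-- By the matrix determinant lemma the inverse ratio is det(1 + Uᵀ(1 + W Wᵀ)⁻¹U), with U the scaled
extra columns. Its quadratic form is |x|² plus the ridge form of Ux for γ₀, which dominates the
projection residual and hence h φ |x|². -/
lemma GoodDesign.det_ratio_le (hX : GoodDesign X γ₀ a b h) (ha : 0 < a) (hh : 0 ≤ h)
    {c : Fin p → ℝ} {φ : ℝ} (hφ : 0 < φ) (hc : ∀ j, φ ≤ c j)
    {γ : Finset (Fin p)} (hγ : γ₀ ⊆ γ) :
    (1 + scaledDesign c X γ₀ * (scaledDesign c X γ₀)ᵀ).det /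
      (1 + scaledDesign c X γ * (scaledDesign c X γ)ᵀ).det ≤ ((1 + h * φ) ^ (γ \ γ₀).card)⁻¹ := by
  set W := scaledDesign c X γ₀ with hW
  set U := colSub X (γ \ γ₀) * Matrix.diagonal fun j : {j // j ∈ γ \ γ₀} => √(c j) with hU
  have hpd := posDef_one_add_mul_transpose W
  have hunit : IsUnit (1 + W * Wᵀ).det := (Matrix.isUnit_iff_isUnit_det _).1 hpd.isUnit
  have hsymm : ((1 + W * Wᵀ)⁻¹)ᵀ = (1 + W * Wᵀ)⁻¹ := by
    rw [Matrix.transpose_nonsing_inv, transpose_one_add_mul_transpose]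
  rw [scaledDesign_mul_transpose_union c X hγ, ← hW, ← hU, ← add_assoc,
    Matrix.det_add_mul U Uᵀ hunit]
  have hpow : (1 + h * φ) ^ (γ \ γ₀).card ≤ (1 + Uᵀ * (1 + W * Wᵀ)⁻¹ * U).det := by
    have := pow_card_le_det (A := 1 + Uᵀ * (1 + W * Wᵀ)⁻¹ * U) (a := 1 + h * φ)
      (by simp only [Matrix.transpose_add, Matrix.transpose_one, Matrix.transpose_mul,
        Matrix.transpose_transpose, hsymm, Matrix.mul_assoc]) (by positivity) fun x => ?_
    · rwa [Fintype.card_coe] at this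
    · have hUx : U *ᵥ x = X *ᵥ extendZero fun j => √(c j) * x j := by
        rw [hU, ← Matrix.mulVec_mulVec, ← colSub_mulVec]
        congr 1
        ext j
        rw [Matrix.mulVec_diagonal]
      have hq : x ⬝ᵥ (1 + Uᵀ * (1 + W * Wᵀ)⁻¹ * U) *ᵥ x = x ⬝ᵥ x + ridgeQuad W (U *ᵥ x) := by
        rw [Matrix.add_mulVec, Matrix.one_mulVec, dotProduct_add, ridgeQuad,
          ← Matrix.mulVec_mulVec, ← Matrix.mulVec_mulVec, dotProduct_mulVec_transpose Uᵀ,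
          Matrix.transpose_transpose]
      have h1 := residual_le_ridgeQuad c (hX.isUnit_true ha) (U *ᵥ x)
      have h2 := hX.excess (extendZero fun j : {j // j ∈ γ \ γ₀} => √(c j) * x j) fun j hj =>
        extendZero_notMem _ (fun hc => (Finset.mem_sdiff.1 hc).2 hj)
      rw [← hUx, extendZero_dotProduct_self] at h2
      have h3 : φ * (x ⬝ᵥ x) ≤ (fun j : {j // j ∈ γ \ γ₀} => √(c j) * x j) ⬝ᵥ
          fun j => √(c j) * x j := by
        rw [dotProduct, dotProduct, Finset.mul_sum]
        refine Finset.sum_le_sum fun j _ => ?_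
        rw [mul_mul_mul_comm, Real.mul_self_sqrt (hφ.le.trans (hc j))]
        exact mul_le_mul_of_nonneg_right (hc j) (mul_self_nonneg _)
      rw [hq]
      have h4 := mul_le_mul_of_nonneg_left h3 hh
      rw [← hW] at h1
      linarith
  have hpos : 0 < (1 + h * φ) ^ (γ \ γ₀).card := by positivity
  rw [div_mul_cancel_left₀ hpd.det_pos.ne']
  exact inv_anti₀ hpos hpow

/-- Q bounds the drop in the ridge form from γ₀ to γ and L bounds the form for γ from below. The
base is then at most 1 + Q/L ≤ exp(Q/L), a form in which the large power is harmless. -/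
lemma GoodDesign.score_ratio_over_le (hX : GoodDesign X γ₀ a b h) (ha : 0 < a)
    (hh : 0 < h) {ν : ℝ} (hν : 0 < ν) {c : Fin p → ℝ} {φ : ℝ} (hφ : 0 < φ)
    (hc : ∀ j, φ ≤ c j) {β : Fin p → ℝ} (hβ : ∀ j ∉ γ₀, β j = 0) (e : Fin n → ℝ)
    {L Q : ℝ} (hL : 0 < L) (hL' : L ≤ e ⬝ᵥ e - e ⬝ᵥ hat X *ᵥ e)
    {γ : Finset (Fin p)} (hγ : γ₀ ⊆ γ)
    (hQ : e ⬝ᵥ hat (excessDesign X γ₀ (γ \ γ₀)) *ᵥ e +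
      2 * (β ⬝ᵥ β + (e ⬝ᵥ hat X *ᵥ e) / a) / φ ≤ Q) :
    modelScore ν c X (X *ᵥ β + e) γ / modelScore ν c X (X *ᵥ β + e) γ₀ ≤
      √(((1 + h * φ) ^ (γ \ γ₀).card)⁻¹) * Real.exp (((n : ℝ) + ν) / 2 * (Q / L)) := by
  have key := score_ratio_le hν c (X *ᵥ β + e) γ (R := Real.exp (Q / L))
    (hX.det_ratio_le ha hh.le hφ hc hγ) ?_
  · refine key.trans_eq ?_
    rw [← Real.exp_mul, mul_comm (Q / L)]
  · obtain ⟨h1, h2⟩ := hX.ridgeQuad_over_ge ha hh c hβ e γ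
    have h3 := hX.ridgeQuad_true_le_residual ha hh hφ hc hβ e
    set q := ridgeQuad (scaledDesign c X γ) (X *ᵥ β + e)
    set q₀ := ridgeQuad (scaledDesign c X γ₀) (X *ᵥ β + e)
    have hQ0 : 0 ≤ Q := by
      refine le_trans (add_nonneg (dotProduct_hat_nonneg _ _) ?_) hQ
      have := dotProduct_self_nonneg' β
      have := dotProduct_hat_nonneg X e
      positivity
    have hq : L ≤ 1 + q := by linarith
    have hq0 : 1 + q₀ ≤ (1 + q) + Q := by linarith
    calc (1 + q₀) / (1 + q) ≤ ((1 + q) + Q) / (1 + q) :=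
          div_le_div_of_nonneg_right hq0 (hL.le.trans hq)
      _ = Q / (1 + q) + 1 := by rw [add_div, div_self (hL.trans_le hq).ne', add_comm]
      _ ≤ Q / L + 1 := add_le_add_left (div_le_div_of_nonneg_left hQ0 hL hq) _
      _ ≤ Real.exp (Q / L) := Real.add_one_le_exp _

end Excess

/-! ### Entrywise measurability of matrix expressions -/

section EntryMeasurable

set_option linter.unusedSectionVars false

variable {α : Type*} [MeasurableSpace α] {l m k : Type*} [Fintype l] [Fintype m] [Fintype k]

/-- A matrix-valued map all of whose entries are measurable. -/
def EntryMeasurable {l m : Type*} (M : α → Matrix l m ℝ) : Prop :=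
  ∀ i j, Measurable fun a => M a i j

lemma EntryMeasurable.mul {M : α → Matrix l m ℝ} {N : α → Matrix m k ℝ} (hM : EntryMeasurable M)
    (hN : EntryMeasurable N) : EntryMeasurable fun a => M a * N a := fun i j => by
  simp only [Matrix.mul_apply]
  exact Finset.measurable_sum _ fun x _ => (hM i x).mul (hN x j)

lemma EntryMeasurable.transpose {M : α → Matrix l m ℝ} (hM : EntryMeasurable M) :
    EntryMeasurable fun a => (M a)ᵀ := fun i j => hM j i

lemma EntryMeasurable.one_sub [DecidableEq m] {M : α → Matrix m m ℝ} (hM : EntryMeasurable M) :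
    EntryMeasurable fun a => 1 - M a := fun i j => by
  simp only [Matrix.sub_apply]
  exact measurable_const.sub (hM i j)

lemma EntryMeasurable.det [DecidableEq m] {M : α → Matrix m m ℝ} (hM : EntryMeasurable M) :
    Measurable fun a => (M a).det := by
  simp only [Matrix.det_apply']
  exact Finset.measurable_sum _ fun σ _ =>
    (Finset.measurable_prod _ fun i _ => hM _ _).const_mul _

/-- The inverse is the adjugate times the inverted determinant; this formula also covers singular
matrices, where both sides are 0. -/
lemma EntryMeasurable.inv [DecidableEq m] {M : α → Matrix m m ℝ} (hM : EntryMeasurable M) :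
    EntryMeasurable fun a => (M a)⁻¹ := fun i j => by
  simp only [Matrix.inv_def, Matrix.smul_apply, Ring.inverse_eq_inv', smul_eq_mul,
    Matrix.adjugate_apply]
  refine hM.det.inv.mul (EntryMeasurable.det fun x z => ?_)
  simp only [Matrix.updateRow_apply]
  split_ifs
  · exact measurable_const
  · exact hM x z

lemma EntryMeasurable.hat [DecidableEq m] {M : α → Matrix l m ℝ} (hM : EntryMeasurable M) :
    EntryMeasurable fun a => hat (M a) :=
  (hM.mul (hM.transpose.mul hM).inv).mul hM.transpose

lemma EntryMeasurable.colSub {n p : ℕ} {M : α → Matrix (Fin n) (Fin p) ℝ} (hM : EntryMeasurable M)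
    (γ : Finset (Fin p)) : EntryMeasurable fun a => colSub (M a) γ := fun i j => hM i j

lemma EntryMeasurable.excessDesign {n p : ℕ} {M : α → Matrix (Fin n) (Fin p) ℝ}
    (hM : EntryMeasurable M) (γ₀ η : Finset (Fin p)) :
    EntryMeasurable fun a => excessDesign (M a) γ₀ η :=
  (hM.colSub γ₀).hat.one_sub.mul (hM.colSub η)

lemma EntryMeasurable.quad {M : α → Matrix m m ℝ} (hM : EntryMeasurable M) {v : α → m → ℝ}
    (hv : Measurable v) : Measurable fun a => v a ⬝ᵥ M a *ᵥ v a := by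
  simp only [dotProduct, Matrix.mulVec]
  have h : ∀ i, Measurable fun a => v a i := fun i => (measurable_pi_apply i).comp hv
  exact Finset.measurable_sum _ fun i _ => (h i).mul
    (Finset.measurable_sum _ fun j _ => (hM i j).mul (h j))

end EntryMeasurable

/-! ### Tail bounds for Gaussian quadratic forms -/

section Tails

variable {n : ℕ} {ι : Type*} [Fintype ι] [DecidableEq ι]

lemma det_one_sub_smul_hat {W : Matrix (Fin n) ι ℝ} (hu : IsUnit (Wᵀ * W).det) (r : ℝ) :
    (1 - r • hat W).det = (1 - r) ^ Fintype.card ι := by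
  have h1 : r • hat W = (r • W) * ((Wᵀ * W)⁻¹ * Wᵀ) := by
    rw [hat, Matrix.smul_mul, Matrix.mul_assoc]
  rw [h1, Matrix.det_one_sub_mul_comm, Matrix.mul_smul, Matrix.mul_assoc,
    Matrix.nonsing_inv_mul _ hu]
  have h2 : (1 : Matrix ι ι ℝ) - r • (1 : Matrix ι ι ℝ) = (1 - r) • (1 : Matrix ι ι ℝ) := by
    rw [sub_smul, one_smul]
  rw [h2, Matrix.det_smul, Matrix.det_one, mul_one]

lemma posDef_one_sub_smul_hat (W : Matrix (Fin n) ι ℝ) {r : ℝ} (hr : r < 1) :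
    (1 - r • hat W).PosDef := by
  refine Matrix.PosDef.of_dotProduct_mulVec_pos
    (isHermitian_of_transpose (by simp [hat_transpose])) fun x hx => ?_
  rw [star_trivial, dotProduct_one_sub_mulVec, Matrix.smul_mulVec, dotProduct_smul, smul_eq_mul]
  have h0 : 0 < x ⬝ᵥ x := lt_of_le_of_ne (dotProduct_self_nonneg' x)
    fun h => hx (dotProduct_self_eq_zero.1 h.symm)
  have h1 := dotProduct_hat_nonneg W x
  have h2 := dotProduct_hat_le W x
  rcases le_or_gt r 0 with hr0 | hr0
  · nlinarith
  · nlinarith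

lemma sqrt_pow_nat {x : ℝ} (hx : 0 ≤ x) (k : ℕ) : √(x ^ k) = √x ^ k := by
  rw [Real.sqrt_eq_iff_mul_self_eq (by positivity) (by positivity), ← mul_pow,
    Real.mul_self_sqrt hx]

/-- A Gaussian integral with precision matrix 1 - 2t H: the form has the chi-squared law with as
many degrees of freedom as columns. -/
lemma mgf_hat {W : Matrix (Fin n) ι ℝ} (hu : IsUnit (Wᵀ * W).det) {t : ℝ} (ht : t < 1 / 2) :
    mgf (fun z => z ⬝ᵥ hat W *ᵥ z) (stdGauss (Fin n)) t = (√(1 - 2 * t))⁻¹ ^ Fintype.card ι := by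
  have h := integral_stdGauss_quad (posDef_one_sub_smul_hat W (r := 2 * t) (by linarith)) 0
  rw [det_one_sub_smul_hat hu] at h
  rw [inv_pow, ← sqrt_pow_nat (by linarith : (0 : ℝ) ≤ 1 - 2 * t), ← h, mgf]
  refine integral_congr_ae (Eventually.of_forall fun z => ?_)
  simp only [sub_zero, dotProduct_one_sub_mulVec, Matrix.smul_mulVec, dotProduct_smul, smul_eq_mul]
  congr 1
  ring

/-- A non-integrable function has integral 0 by convention, whereas `mgf_hat` gives a positive
value. -/
lemma integrable_exp_hat {W : Matrix (Fin n) ι ℝ} (hu : IsUnit (Wᵀ * W).det) {t : ℝ}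
    (ht : t < 1 / 2) :
    Integrable (fun z => Real.exp (t * (z ⬝ᵥ hat W *ᵥ z))) (stdGauss (Fin n)) := by
  by_contra hni
  have h := mgf_hat hu ht
  rw [mgf, integral_undef hni] at h
  have : 0 < √(1 - 2 * t) := Real.sqrt_pos.2 (by linarith)
  exact absurd h (by positivity)

lemma stdGauss_tail_upper (W : Matrix (Fin n) ι ℝ) [Nonempty ι] {t s : ℝ} (ht0 : 0 ≤ t)
    (ht : t < 1 / 2) (hs : 0 < s) :
    (stdGauss (Fin n)).real {z | Fintype.card ι * s ≤ z ⬝ᵥ hat W *ᵥ z} ≤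
      (Real.exp (-t * s) * (√(1 - 2 * t))⁻¹) ^ Fintype.card ι := by
  by_cases hu : IsUnit (Wᵀ * W).det
  · refine (measure_ge_le_exp_mul_mgf _ ht0 (integrable_exp_hat hu ht)).trans_eq ?_
    rw [mgf_hat hu ht, mul_pow, ← Real.exp_nat_mul]
    congr 2
    ring
  -- For a singular Gram matrix `hat W` is 0 and the event is empty. The bound thus holds for every
  -- matrix, as conditioning on the design requires.
  · have : {z : Fin n → ℝ | Fintype.card ι * s ≤ z ⬝ᵥ hat W *ᵥ z} = ∅ := by
      ext z
      have h0 : 0 < (Fintype.card ι : ℝ) * s := mul_pos (by exact_mod_cast Fintype.card_pos) hs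
      simp [hat, Matrix.nonsing_inv_apply_not_isUnit _ hu, h0]
    rw [this, measureReal_empty]
    positivity

lemma hat_one : hat (1 : Matrix ι ι ℝ) = 1 := by simp [hat]

lemma stdGauss_tail_lower {t : ℝ} (ht : 0 ≤ t) (s : ℝ) :
    (stdGauss (Fin n)).real {z | z ⬝ᵥ z ≤ n * s} ≤
      (Real.exp (t * s) * (√(1 + 2 * t))⁻¹) ^ n := by
  have hu : IsUnit ((1 : Matrix (Fin n) (Fin n) ℝ)ᵀ * 1).det := by simp
  have hlt : -t < 1 / 2 := by linarith
  have h := measure_le_le_exp_mul_mgf (n * s) (neg_nonpos.2 ht) (integrable_exp_hat hu hlt)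
  rw [mgf_hat hu hlt] at h
  simp only [hat_one, Matrix.one_mulVec, Fintype.card_fin] at h
  refine h.trans_eq ?_
  rw [mul_pow, ← Real.exp_nat_mul]
  congr 2
  · ring
  · congr 3; ring

/-- The law of the noise. -/
noncomputable abbrev noiseLaw (n : ℕ) (σ : ℝ) : Measure (Fin n → ℝ) :=
  Measure.pi fun _ => gaussianReal 0 (σ ^ 2).toNNReal

lemma noiseLaw_eq_map (n : ℕ) (σ : ℝ) :
    noiseLaw n σ = (stdGauss (Fin n)).map fun z => σ • z := by
  have h : (fun z : Fin n → ℝ => σ • z) = fun z i => σ * z i := rfl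
  rw [h, Measure.pi_map_pi fun j => by fun_prop]
  refine congrArg Measure.pi (funext fun j => ?_)
  rw [gaussianReal_map_const_mul, mul_zero, mul_one]
  congr 1
  ext
  rw [NNReal.coe_mk, Real.coe_toNNReal _ (sq_nonneg σ)]

lemma noiseLaw_quad_real {σ : ℝ} (hσ : 0 < σ) (A : Matrix (Fin n) (Fin n) ℝ) (t : ℝ) :
    (noiseLaw n σ).real {e | σ ^ 2 * t ≤ e ⬝ᵥ A *ᵥ e} =
      (stdGauss (Fin n)).real {z | t ≤ z ⬝ᵥ A *ᵥ z} := by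
  have hq : Measurable fun e : Fin n → ℝ => e ⬝ᵥ A *ᵥ e :=
    EntryMeasurable.quad (M := fun _ => A) (v := fun e => e) (fun i j => measurable_const)
      measurable_id
  rw [noiseLaw_eq_map, map_measureReal_apply (measurable_const_smul σ)
    (measurableSet_le measurable_const hq)]
  congr 1
  ext z
  simp only [Set.mem_preimage, Set.mem_ofPred_eq, Matrix.mulVec_smul, smul_dotProduct,
    dotProduct_smul, smul_eq_mul, ← mul_assoc, ← sq]
  exact mul_le_mul_iff_right₀ (by positivity)

lemma noiseLaw_self_real {σ : ℝ} (hσ : 0 < σ) (t : ℝ) :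
    (noiseLaw n σ).real {e | e ⬝ᵥ e ≤ σ ^ 2 * t} =
      (stdGauss (Fin n)).real {z | z ⬝ᵥ z ≤ t} := by
  have hq : Measurable fun e : Fin n → ℝ => e ⬝ᵥ e := by unfold dotProduct; fun_prop
  rw [noiseLaw_eq_map, map_measureReal_apply (measurable_const_smul σ)
    (measurableSet_le hq measurable_const)]
  congr 1
  ext z
  simp only [Set.mem_preimage, Set.mem_ofPred_eq, smul_dotProduct,
    dotProduct_smul, smul_eq_mul, ← mul_assoc, ← sq]
  exact mul_le_mul_iff_right₀ (by positivity)

end Tails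

/-! ### Tail bounds for random designs -/

section RandomDesign

set_option linter.unusedSectionVars false

variable {Ω : Type*} [MeasurableSpace Ω] {μ : Measure Ω} [IsProbabilityMeasure μ] {n p : ℕ}
  {X : Ω → Matrix (Fin n) (Fin p) ℝ} {ε : Ω → Fin n → ℝ} {σ : ℝ}

/-- Independence makes the joint law a product, so by Fubini a noise bound valid for every fixed
design passes to the random one. -/
lemma measure_le_of_indep (hX : ∀ i j, Measurable fun ω => X ω i j)
    (hε : HasLaw ε (noiseLaw n σ) μ) (hi : IndepFun (fun ω i j => X ω i j) ε μ)
    {f : (Fin n → Fin p → ℝ) × (Fin n → ℝ) → ℝ} (hf : Measurable f) {t q : ℝ}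
    (hq : ∀ x, (noiseLaw n σ).real {e | t ≤ f (x, e)} ≤ q) :
    μ {ω | t ≤ f (fun i j => X ω i j, ε ω)} ≤ ENNReal.ofReal q := by
  have hXm : Measurable fun ω i j => X ω i j :=
    measurable_pi_lambda _ fun i => measurable_pi_lambda _ fun j => hX i j
  have hB : MeasurableSet {xe | t ≤ f xe} := measurableSet_le measurable_const hf
  have hprob : IsProbabilityMeasure (μ.map fun ω i j => X ω i j) :=
    Measure.isProbabilityMeasure_map hXm.aemeasurable
  have hmap := (indepFun_iff_map_prod_eq_prod_map_map hXm.aemeasurable hε.aemeasurable).1 hi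
  rw [hε.map_eq] at hmap
  have h1 : μ {ω | t ≤ f (fun i j => X ω i j, ε ω)} =
      (μ.map fun ω => ((fun i j => X ω i j), ε ω)) {xe | t ≤ f xe} :=
    (Measure.map_apply_of_aemeasurable (hXm.aemeasurable.prodMk hε.aemeasurable) hB).symm
  rw [h1, hmap, Measure.prod_apply hB]
  calc _ ≤ ∫⁻ _, ENNReal.ofReal q ∂(μ.map fun ω i j => X ω i j) := by
        refine lintegral_mono fun x => ?_
        have := ENNReal.ofReal_le_ofReal (hq x)
        rwa [ofReal_measureReal] at this
    _ = ENNReal.ofReal q := by rw [lintegral_const, measure_univ, mul_one]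

lemma entryMeasurable_fst : EntryMeasurable
    fun xe : (Fin n → Fin p → ℝ) × (Fin n → ℝ) => (Matrix.of xe.1) := fun i j => by
  simp only [Matrix.of_apply]
  fun_prop

lemma measure_hat_design_tail (hX : ∀ i j, Measurable fun ω => X ω i j) (hσ : 0 < σ)
    (hε : HasLaw ε (noiseLaw n σ) μ) (hi : IndepFun (fun ω i j => X ω i j) ε μ)
    (hp : 0 < p) {t s : ℝ} (ht0 : 0 ≤ t) (ht : t < 1 / 2)
    (hs : 0 < s) :
    μ {ω | σ ^ 2 * (p * s) ≤ ε ω ⬝ᵥ hat (X ω) *ᵥ ε ω} ≤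
      ENNReal.ofReal ((Real.exp (-t * s) * (√(1 - 2 * t))⁻¹) ^ p) := by
  have : Nonempty (Fin p) := ⟨⟨0, hp⟩⟩
  refine measure_le_of_indep hX hε hi
    (f := fun xe => xe.2 ⬝ᵥ hat (Matrix.of xe.1) *ᵥ xe.2)
    (entryMeasurable_fst.hat.quad measurable_snd) fun x => ?_
  refine (noiseLaw_quad_real hσ (hat (Matrix.of x)) _).trans_le ?_
  simpa using stdGauss_tail_upper (Matrix.of x) ht0 ht hs

lemma measure_hat_excess_tail (hX : ∀ i j, Measurable fun ω => X ω i j) (hσ : 0 < σ)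
    (hε : HasLaw ε (noiseLaw n σ) μ) (hi : IndepFun (fun ω i j => X ω i j) ε μ)
    (γ₀ : Finset (Fin p)) {η : Finset (Fin p)} (hη : η.Nonempty)
    {t s : ℝ} (ht0 : 0 ≤ t) (ht : t < 1 / 2) (hs : 0 < s) :
    μ {ω | σ ^ 2 * (η.card * s) ≤ ε ω ⬝ᵥ hat (excessDesign (X ω) γ₀ η) *ᵥ ε ω} ≤
      ENNReal.ofReal ((Real.exp (-t * s) * (√(1 - 2 * t))⁻¹) ^ η.card) := by
  have : Nonempty {j // j ∈ η} := hη.to_subtype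
  refine measure_le_of_indep hX hε hi
    (f := fun xe => xe.2 ⬝ᵥ hat (excessDesign (Matrix.of xe.1) γ₀ η) *ᵥ xe.2)
    ((entryMeasurable_fst.excessDesign γ₀ η).hat.quad measurable_snd) fun x => ?_
  refine (noiseLaw_quad_real hσ (hat (excessDesign (Matrix.of x) γ₀ η)) _).trans_le ?_
  simpa using stdGauss_tail_upper (excessDesign (Matrix.of x) γ₀ η) ht0 ht hs

lemma measure_noise_upper_tail (hσ : 0 < σ) (hε : HasLaw ε (noiseLaw n σ) μ)
    (hn : 0 < n) {t s : ℝ} (ht0 : 0 ≤ t) (ht : t < 1 / 2)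
    (hs : 0 < s) :
    μ {ω | σ ^ 2 * (n * s) ≤ ε ω ⬝ᵥ ε ω} ≤
      ENNReal.ofReal ((Real.exp (-t * s) * (√(1 - 2 * t))⁻¹) ^ n) := by
  have : Nonempty (Fin n) := ⟨⟨0, hn⟩⟩
  have hq : Measurable fun e : Fin n → ℝ => e ⬝ᵥ e := by unfold dotProduct; fun_prop
  rw [hε.measure_eq (p := fun e => σ ^ 2 * (n * s) ≤ e ⬝ᵥ e)
    (measurableSet_le measurable_const hq), ← ofReal_measureReal]
  refine ENNReal.ofReal_le_ofReal ?_
  have h1 := noiseLaw_quad_real (n := n) hσ 1 (n * s)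
  have h2 := stdGauss_tail_upper (1 : Matrix (Fin n) (Fin n) ℝ) ht0 ht hs
  simp only [hat_one, Matrix.one_mulVec, Fintype.card_fin] at h1 h2
  rw [h1]
  exact h2

lemma measure_noise_lower_tail (hσ : 0 < σ) (hε : HasLaw ε (noiseLaw n σ) μ)
    {t : ℝ} (ht0 : 0 ≤ t) (s : ℝ) :
    μ {ω | ε ω ⬝ᵥ ε ω ≤ σ ^ 2 * (n * s)} ≤
      ENNReal.ofReal ((Real.exp (t * s) * (√(1 + 2 * t))⁻¹) ^ n) := by
  have hq : Measurable fun e : Fin n → ℝ => e ⬝ᵥ e := by unfold dotProduct; fun_prop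
  rw [hε.measure_eq (p := fun e => e ⬝ᵥ e ≤ σ ^ 2 * (n * s))
    (measurableSet_le hq measurable_const), ← ofReal_measureReal]
  refine ENNReal.ofReal_le_ofReal ?_
  rw [noiseLaw_self_real hσ]
  exact stdGauss_tail_lower ht0 s

/-- Summing x^|η| over all subsets gives (1 + x)^p ≤ exp(px); the empty set contributes the 1. -/
lemma sum_pow_card_nonempty_le {x : ℝ} (hx : 0 ≤ x) (p : ℕ) :
    ∑ η ∈ Finset.univ.erase (∅ : Finset (Fin p)), x ^ η.card ≤ Real.exp (p * x) - 1 := by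
  have h1 : ∑ η : Finset (Fin p), x ^ η.card = (1 + x) ^ p := by
    have := Finset.prod_one_add (f := fun _ : Fin p => x) Finset.univ
    simp only [Finset.prod_const, Finset.card_univ, Fintype.card_fin, Finset.powerset_univ] at this
    exact this.symm
  have h2 := Finset.add_sum_erase Finset.univ (fun η : Finset (Fin p) => x ^ η.card)
    (Finset.mem_univ ∅)
  rw [h1, Finset.card_empty, pow_zero] at h2
  have h3 : (1 + x) ^ p ≤ Real.exp (p * x) := by
    rw [Real.exp_nat_mul]
    exact pow_le_pow_left₀ (by linarith) (by linarith [Real.add_one_le_exp x]) p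
  linarith

lemma measure_exists_hat_excess_tail (hX : ∀ i j, Measurable fun ω => X ω i j) (hσ : 0 < σ)
    (hε : HasLaw ε (noiseLaw n σ) μ) (hi : IndepFun (fun ω i j => X ω i j) ε μ)
    (γ₀ : Finset (Fin p)) {t s : ℝ} (ht0 : 0 ≤ t)
    (ht : t < 1 / 2) (hs : 0 < s) :
    μ {ω | ∃ η : Finset (Fin p), η.Nonempty ∧
        σ ^ 2 * (η.card * s) ≤ ε ω ⬝ᵥ hat (excessDesign (X ω) γ₀ η) *ᵥ ε ω} ≤
      ENNReal.ofReal (Real.exp (p * (Real.exp (-t * s) * (√(1 - 2 * t))⁻¹)) - 1) := by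
  set x := Real.exp (-t * s) * (√(1 - 2 * t))⁻¹ with hx
  have hx0 : 0 ≤ x := by positivity
  have hsub : {ω | ∃ η : Finset (Fin p), η.Nonempty ∧
      σ ^ 2 * (η.card * s) ≤ ε ω ⬝ᵥ hat (excessDesign (X ω) γ₀ η) *ᵥ ε ω} ⊆
      ⋃ η ∈ Finset.univ.erase (∅ : Finset (Fin p)),
        {ω | σ ^ 2 * (η.card * s) ≤ ε ω ⬝ᵥ hat (excessDesign (X ω) γ₀ η) *ᵥ ε ω} := by
    rintro ω ⟨η, hη, hω⟩
    simp only [Set.mem_iUnion]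
    exact ⟨η, Finset.mem_erase.2 ⟨hη.ne_empty, Finset.mem_univ _⟩, hω⟩
  refine (measure_mono hsub).trans ((measure_biUnion_finset_le _ _).trans ?_)
  refine le_trans ?_ (ENNReal.ofReal_le_ofReal (sum_pow_card_nonempty_le hx0 p))
  rw [ENNReal.ofReal_sum_of_nonneg fun η _ => pow_nonneg hx0 _]
  exact Finset.sum_le_sum fun η hη => measure_hat_excess_tail hX hσ hε hi γ₀
    (Finset.nonempty_iff_ne_empty.2 (Finset.mem_erase.1 hη).1) ht0 ht hs

/-! #### Measurability of the design conditions -/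

/-- The uncountable quantifier over v is harmless: the admissible matrices form an intersection of
closed half-spaces, a closed set. -/
lemma measurableSet_forall_quad {α : Type*} [MeasurableSpace α] {P : (Fin p → ℝ) → Prop}
    {M : α → Matrix (Fin p) (Fin p) ℝ} (hM : EntryMeasurable M) (a : ℝ) :
    MeasurableSet {x | ∀ v, P v → a * (v ⬝ᵥ v) ≤ v ⬝ᵥ M x *ᵥ v} := by
  have hc : IsClosed {m : Fin p → Fin p → ℝ |
      ∀ v, P v → a * (v ⬝ᵥ v) ≤ v ⬝ᵥ (Matrix.of m) *ᵥ v} := by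
    simp only [Set.ofPred_forall]
    refine isClosed_iInter fun v => isClosed_iInter fun _ => isClosed_le continuous_const ?_
    simp only [dotProduct, Matrix.mulVec, Matrix.of_apply]
    fun_prop
  have hm : Measurable fun x => (fun i j => M x i j : Fin p → Fin p → ℝ) :=
    measurable_pi_lambda _ fun i => measurable_pi_lambda _ fun j => hM i j
  exact hm hc.measurableSet

end RandomDesign

/-! ### Asymptotic bounds on the model scores -/

section Asymptotic

variable {p : ℕ → ℕ} {ψ φlo φhi : ℕ → ℝ}

/-- The noise is of typical size, relative to the design. -/
structure GoodNoise {n p : ℕ} (X : Matrix (Fin n) (Fin p) ℝ) (γ₀ : Finset (Fin p))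
    (e : Fin n → ℝ) (σ κ s : ℝ) : Prop where
  proj : e ⬝ᵥ hat X *ᵥ e ≤ σ ^ 2 * (p * 4)
  upper : e ⬝ᵥ e ≤ σ ^ 2 * (n * 4)
  lower : σ ^ 2 * (n * κ) ≤ e ⬝ᵥ e
  excess : ∀ η : Finset (Fin p), η.Nonempty →
    e ⬝ᵥ hat (excessDesign X γ₀ η) *ᵥ e ≤ σ ^ 2 * (η.card * s)

lemma min_sq_one_nonneg (x : ℝ) : 0 ≤ min (x ^ 2) 1 := le_min (sq_nonneg x) zero_le_one

lemma log_one_add_nonneg {x : ℝ} (hx : 0 ≤ x) : 0 ≤ Real.log (1 + x) :=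
  Real.log_nonneg (by linarith)

lemma log_one_add_le {x : ℝ} (hx : 0 ≤ x) : Real.log (1 + x) ≤ x := by
  have := Real.log_le_sub_one_of_pos (by linarith : 0 < 1 + x)
  linarith

lemma eventually_one_le_log : ∀ᶠ n : ℕ in atTop, 1 ≤ Real.log n :=
  (Real.tendsto_log_atTop.comp tendsto_natCast_atTop_atTop).eventually_ge_atTop 1

lemma eventually_rate
    (hp_rate : (fun n : ℕ => (p n : ℝ) * Real.log n) =o[atTop]
      fun n : ℕ => (n : ℝ) * Real.log (1 + min (ψ n ^ 2) 1)) {C : ℝ} (hC : 0 < C) :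
    ∀ᶠ n : ℕ in atTop, C * (p n * Real.log n) ≤ n * Real.log (1 + min (ψ n ^ 2) 1) := by
  filter_upwards [hp_rate.def (inv_pos.2 hC)] with n h
  have h2 : 0 ≤ (n : ℝ) * Real.log (1 + min (ψ n ^ 2) 1) :=
    mul_nonneg (Nat.cast_nonneg n) (log_one_add_nonneg (min_sq_one_nonneg _))
  rw [Real.norm_of_nonneg h2] at h
  have h3 := (le_abs_self _).trans h
  rwa [inv_mul_eq_div, le_div_iff₀ hC, mul_comm] at h3

lemma eventually_dim_le
    (hp_rate : (fun n : ℕ => (p n : ℝ) * Real.log n) =o[atTop]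
      fun n : ℕ => (n : ℝ) * Real.log (1 + min (ψ n ^ 2) 1)) {C : ℝ} (hC : 0 < C) :
    ∀ᶠ n : ℕ in atTop, C * p n ≤ n * min (ψ n ^ 2) 1 := by
  filter_upwards [eventually_rate hp_rate hC, eventually_one_le_log] with n h hl
  have h1 : C * p n ≤ C * (p n * Real.log n) :=
    mul_le_mul_of_nonneg_left (le_mul_of_one_le_right (Nat.cast_nonneg _) hl) hC.le
  exact h1.trans (h.trans (mul_le_mul_of_nonneg_left
    (log_one_add_le (min_sq_one_nonneg _)) (Nat.cast_nonneg n)))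

/-- Bernoulli's inequality (1 + x)^c ≤ 1 + cx for exponents c in [0, 1]. -/
lemma mul_log_one_add_le {c x : ℝ} (hc0 : 0 ≤ c) (hc1 : c ≤ 1) (hx : 0 ≤ x) :
    c * Real.log (1 + x) ≤ Real.log (1 + c * x) := by
  rw [← Real.log_rpow (by linarith)]
  exact Real.log_le_log (Real.rpow_pos_of_pos (by linarith) _)
    (rpow_one_add_le_one_add_mul_self (by linarith) hc0 hc1)

lemma eventually_one_add_mul_le_exp {C₂ δ₀ : ℝ} (hC₂ : 0 < C₂) (hδ₀ : 0 < δ₀)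
    (hφhi : φhi =O[atTop] fun n : ℕ => (n : ℝ) ^ δ₀) :
    ∀ᶠ n : ℕ in atTop, 1 + n * (2 * C₂) * φhi n ≤ Real.exp ((δ₀ + 2) * Real.log n) := by
  obtain ⟨C, hC, hb⟩ := hφhi.exists_pos
  filter_upwards [hb.bound, eventually_ge_atTop 1,
    tendsto_natCast_atTop_atTop.eventually_ge_atTop (1 + 2 * C₂ * C)] with n h hn hlarge
  have hn1 : (1 : ℝ) ≤ n := by exact_mod_cast hn
  have hn0 : (0 : ℝ) < n := by linarith
  have hpow : (1 : ℝ) ≤ (n : ℝ) ^ δ₀ := Real.one_le_rpow hn1 hδ₀.le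
  have h1 : φhi n ≤ C * (n : ℝ) ^ δ₀ := by
    refine (le_abs_self _).trans (h.trans_eq ?_)
    rw [Real.norm_of_nonneg (by linarith)]
  have e1 : Real.exp ((δ₀ + 2) * Real.log n) = (n : ℝ) ^ δ₀ * n * n := by
    rw [mul_comm, ← Real.rpow_def_of_pos hn0, Real.rpow_add hn0]
    norm_num
    ring
  rw [e1]
  calc 1 + n * (2 * C₂) * φhi n ≤ 1 + n * (2 * C₂) * (C * (n : ℝ) ^ δ₀) := by gcongr
    _ ≤ (n : ℝ) ^ δ₀ * n + n * (2 * C₂) * (C * (n : ℝ) ^ δ₀) := by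
        gcongr; exact one_le_mul_of_one_le_of_one_le hpow hn1
    _ = (n : ℝ) ^ δ₀ * n * (1 + 2 * C₂ * C) := by ring
    _ ≤ (n : ℝ) ^ δ₀ * n * n := by gcongr

lemma eventually_score_miss_le {σ C₁ C₂ C₅ δ₀ ν κ : ℝ} (hC₁ : 0 < C₁)
    (hC₂ : 0 < C₂) (hC₅ : 0 < C₅) (hδ₀ : 0 < δ₀) (hν : 0 < ν) {s : ℕ → ℝ}
    (hψ_pos : ∀ n, 1 ≤ n → 0 < ψ n) (hφlo_pos : ∀ n, 1 ≤ n → 0 < φlo n)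
    (hp_lim : Tendsto p atTop atTop)
    (hp_rate : (fun n : ℕ => (p n : ℝ) * Real.log n) =o[atTop]
      fun n : ℕ => (n : ℝ) * Real.log (1 + min (ψ n ^ 2) 1))
    (hφhi : φhi =O[atTop] fun n : ℕ => (n : ℝ) ^ δ₀) :
    ∀ᶠ n : ℕ in atTop, ∀ (X : Matrix (Fin n) (Fin (p n)) ℝ) (γ₀ : Finset (Fin (p n))) (h : ℝ)
      (β : Fin (p n) → ℝ) (e : Fin n → ℝ) (c : Fin (p n) → ℝ),
      GoodDesign X γ₀ (n * (C₁ / 2)) (n * (2 * C₂)) h → 0 < h → GoodNoise X γ₀ e σ κ (s n) →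
      (∀ j ∉ γ₀, β j = 0) → (∀ j ∈ γ₀, ψ n ≤ |β j|) → β ⬝ᵥ β ≤ C₅ * φlo n →
      (∀ j, φlo n ≤ c j) → (∀ j, c j ≤ φhi n) → ∀ γ, ¬ γ₀ ⊆ γ →
      modelScore ν c X (X *ᵥ β + e) γ / modelScore ν c X (X *ᵥ β + e) γ₀ ≤
        Real.exp (-2 * p n) := by
  -- A₁ n bounds the numerator 1 + |e|² + C₅. The signal term is at least n C₁ m/4 with m = min(ψ²,
  -- 1): one half absorbs the losses 8σ²p + C₅, and c₀ is small enough for the other half to exceed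
  -- c₀ m times the numerator.
  set A₁ : ℝ := 1 + 4 * σ ^ 2 + C₅ with hA₁
  have hA₁0 : 0 < A₁ := by positivity
  set c₀ : ℝ := min 1 (C₁ / (8 * A₁)) with hc₀
  have hc₀0 : 0 < c₀ := lt_min one_pos (by positivity)
  have hc₀1 : c₀ ≤ 1 := min_le_left _ _
  have hc₀2 : c₀ * A₁ ≤ C₁ / 8 := by
    have : c₀ ≤ C₁ / (8 * A₁) := min_le_right _ _
    calc c₀ * A₁ ≤ C₁ / (8 * A₁) * A₁ := by gcongr
      _ = C₁ / 8 := by field_simp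
  filter_upwards [eventually_ge_atTop 1, eventually_one_le_log, hp_lim.eventually_ge_atTop 1,
    eventually_dim_le hp_rate (C := (8 * σ ^ 2 + C₅) * (8 / C₁)) (by positivity),
    eventually_rate hp_rate (C := (δ₀ + 2 + 4) / c₀) (by positivity),
    eventually_one_add_mul_le_exp hC₂ hδ₀ hφhi] with n hn hlog hp hdim hrate hhi
  intro X γ₀ h β e c hX hh hE hβ hψ hββ hclo hchi γ hγ
  have hn1 : (1 : ℝ) ≤ n := by exact_mod_cast hn
  have hp1 : (1 : ℝ) ≤ p n := by exact_mod_cast hp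
  have hφ := hφlo_pos n hn
  have hψn := hψ_pos n hn
  set m := min (ψ n ^ 2) 1 with hm
  have hm0 : 0 ≤ m := min_sq_one_nonneg _
  have hmψ : m ≤ ψ n ^ 2 := min_le_left _ _
  have hee := dotProduct_self_nonneg' e
  have hββ' : (β ⬝ᵥ β) / φlo n ≤ C₅ := by rw [div_le_iff₀ hφ]; exact hββ
  have hββ0 : 0 ≤ (β ⬝ᵥ β) / φlo n := div_nonneg (dotProduct_self_nonneg' β) hφ.le
  set A : ℝ := 1 + (e ⬝ᵥ e + C₅) with hA
  have hA0 : 0 < A := by positivity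
  have hAn : A ≤ A₁ * n := by
    have h1 := hE.upper
    have : A₁ * n = n + σ ^ 2 * (n * 4) + C₅ * n := by rw [hA₁]; ring
    have h2 : C₅ ≤ C₅ * n := le_mul_of_one_le_right hC₅.le hn1
    rw [this, hA]; linarith
  have hdim' : 8 * σ ^ 2 * p n + C₅ ≤ C₁ / 8 * (n * m) := by
    have h1 : (8 * σ ^ 2 + C₅) * p n ≤ C₁ / 8 * (n * m) := by
      have h2 := mul_le_mul_of_nonneg_left hdim (by positivity : 0 ≤ C₁ / 8)
      have h3 : C₁ / 8 * ((8 * σ ^ 2 + C₅) * (8 / C₁) * p n) = (8 * σ ^ 2 + C₅) * p n := by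
        field_simp
      linarith
    have h2 : C₅ ≤ C₅ * p n := le_mul_of_one_le_right hC₅.le hp1
    linarith
  have hden : A * (1 + c₀ * m) ≤
      1 + (e ⬝ᵥ e - 2 * (e ⬝ᵥ hat X *ᵥ e) + n * (C₁ / 2) * ψ n ^ 2 / 2) := by
    have h1 := hE.proj
    have h2 : n * (C₁ / 2) * m ≤ n * (C₁ / 2) * ψ n ^ 2 := by gcongr
    have h3 : A * (c₀ * m) ≤ C₁ / 8 * (n * m) := by
      calc A * (c₀ * m) ≤ A₁ * n * (c₀ * m) := by gcongr
        _ = (c₀ * A₁) * (n * m) := by ring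
        _ ≤ C₁ / 8 * (n * m) := by gcongr
    have h4 : A * (1 + c₀ * m) = A + A * (c₀ * m) := by ring
    rw [h4, hA]
    linarith
  have hcm : 0 < 1 + c₀ * m := by positivity
  have hden0 := (mul_pos hA0 hcm).trans_le hden
  have key := hX.score_ratio_miss_le (by positivity) (by positivity) hh hν hφ hclo hchi hβ
    hψn.le hψ e hden0 hγ
  refine key.trans ?_
  have hbase : (1 + (e ⬝ᵥ e + (β ⬝ᵥ β) / φlo n)) /
      (1 + (e ⬝ᵥ e - 2 * (e ⬝ᵥ hat X *ᵥ e) + n * (C₁ / 2) * ψ n ^ 2 / 2)) ≤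
      Real.exp (-(c₀ * Real.log (1 + m))) := by
    calc _ ≤ A / (A * (1 + c₀ * m)) :=
          div_le_div₀ hA0.le (by rw [hA]; linarith) (mul_pos hA0 hcm) hden
      _ = (1 + c₀ * m)⁻¹ := by rw [div_mul_cancel_left₀ hA0.ne']
      _ = Real.exp (-Real.log (1 + c₀ * m)) := by rw [Real.exp_neg, Real.exp_log hcm]
      _ ≤ _ := Real.exp_le_exp.2 (neg_le_neg (mul_log_one_add_le hc₀0.le hc₀1 hm0))
  have hb0 : 0 ≤ 1 + n * (2 * C₂) * φhi n := by
    have : 0 ≤ φhi n := hφ.le.trans ((hclo ⟨0, hp⟩).trans (hchi ⟨0, hp⟩))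
    positivity
  have hpow1 : √((1 + n * (2 * C₂) * φhi n) ^ p n) ≤
      Real.exp ((δ₀ + 2) / 2 * (p n * Real.log n)) := by
    rw [Real.sqrt_le_left (Real.exp_pos _).le, ← Real.exp_nat_mul]
    refine (pow_le_pow_left₀ hb0 hhi _).trans_eq ?_
    rw [← Real.exp_nat_mul]
    congr 1
    push_cast
    ring
  have hbase0 : 0 ≤ (1 + (e ⬝ᵥ e + (β ⬝ᵥ β) / φlo n)) /
      (1 + (e ⬝ᵥ e - 2 * (e ⬝ᵥ hat X *ᵥ e) + n * (C₁ / 2) * ψ n ^ 2 / 2)) :=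
    div_nonneg (by positivity) hden0.le
  have hlm := log_one_add_nonneg hm0
  have hpow2 := Real.rpow_le_rpow hbase0 hbase (by positivity : 0 ≤ ((n : ℝ) + ν) / 2)
  rw [← Real.exp_mul] at hpow2
  refine (mul_le_mul hpow1 hpow2 (Real.rpow_nonneg hbase0 _) (Real.exp_pos _).le).trans ?_
  rw [← Real.exp_add, Real.exp_le_exp]
  -- The determinant costs (δ₀ + 2)/2 · p log n in the exponent; the extra 4, also halved, leaves
  -- -2p log n ≤ -2p.
  have hr : (δ₀ + 2 + 4) * (p n * Real.log n) ≤ c₀ * (n * Real.log (1 + m)) := by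
    have := mul_le_mul_of_nonneg_left hrate hc₀0.le
    rwa [← mul_assoc, mul_div_cancel₀ _ hc₀0.ne'] at this
  have h5 : 0 ≤ c₀ * Real.log (1 + m) * ν := by positivity
  have h6 : (p n : ℝ) ≤ p n * Real.log n := le_mul_of_one_le_right (Nat.cast_nonneg _) hlog
  linarith

/-- The geometric ratio in the bound for models that strictly contain the true one. -/
noncomputable def excessRatio (C₃ δ α₀ : ℝ) (p : ℕ → ℕ) (φlo : ℕ → ℝ) (n : ℕ) : ℝ :=
  √((p n : ℝ) ^ α₀ / (n * (C₃ * (n : ℝ) ^ (-δ)) * φlo n))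

lemma eventually_score_over_le {σ C₁ b C₃ C₅ δ ν κ α α₀ : ℝ} (hσ : 0 < σ) (hC₁ : 0 < C₁)
    (hC₃ : 0 < C₃) (hδ : 0 ≤ δ) (hC₅ : 0 < C₅) (hν : 0 < ν) (hα : 0 < α)
    (hα₀ : 1 ≤ α₀) (hκ : 1 < α₀ / α * κ) (hφlo_pos : ∀ n, 1 ≤ n → 0 < φlo n)
    (hp_lim : Tendsto p atTop atTop)
    (hp_rate : (fun n : ℕ => (p n : ℝ) * Real.log n) =o[atTop]
      fun n : ℕ => (n : ℝ) * Real.log (1 + min (ψ n ^ 2) 1))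
    (hpα : (fun n => (p n : ℝ) ^ α₀) =o[atTop] fun n : ℕ => (n : ℝ) ^ (1 - δ) * φlo n) :
    ∃ K : ℝ, 0 < K ∧
    ∀ᶠ n : ℕ in atTop, ∀ (X : Matrix (Fin n) (Fin (p n)) ℝ) (γ₀ : Finset (Fin (p n)))
      (β : Fin (p n) → ℝ) (e : Fin n → ℝ) (c : Fin (p n) → ℝ),
      GoodDesign X γ₀ (n * (C₁ / 2)) (n * b) (n * (C₃ * (n : ℝ) ^ (-δ))) →
      GoodNoise X γ₀ e σ κ (α * Real.log (p n)) →
      (∀ j ∉ γ₀, β j = 0) → β ⬝ᵥ β ≤ C₅ * φlo n →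
      (∀ j, φlo n ≤ c j) → ∀ γ, γ₀ ⊆ γ → γ ≠ γ₀ →
      modelScore ν c X (X *ᵥ β + e) γ / modelScore ν c X (X *ᵥ β + e) γ₀ ≤
        K * excessRatio C₃ δ α₀ p φlo n ^ (γ \ γ₀).card := by
  set r := α₀ / α with hr
  have hr0 : 0 < r := div_pos (by linarith) hα
  have hκ0 : 0 < κ := pos_of_mul_pos_right (one_pos.trans hκ) hr0.le
  set T₀ : ℝ := 2 * (C₅ + 8 * σ ^ 2 / C₁) with hT₀
  refine ⟨Real.exp (r / 2 * (T₀ / σ ^ 2)), Real.exp_pos _, ?_⟩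
  have hgap : 0 < r * κ - 1 := by linarith
  filter_upwards [eventually_ge_atTop 1, hp_lim.eventually_ge_atTop 2,
    eventually_dim_le hp_rate (C := 2 * (4 * r) / (r * κ - 1)) (by positivity),
    tendsto_natCast_atTop_atTop.eventually_ge_atTop (2 * ν / (r * κ - 1)),
    eventually_dim_le hp_rate (C := 8 / κ) (by positivity), hpα.def one_pos] with
    n hn hp hdim hlarge hdim2 hpα'
  intro X γ₀ β e c hX hE hβ hββ hc γ hγ hne
  have hn1 : (1 : ℝ) ≤ n := by exact_mod_cast hn
  have hn0 : (0 : ℝ) < n := by linarith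
  have hp1 : (1 : ℝ) ≤ p n := by exact_mod_cast (by omega : 1 ≤ p n)
  have hp0 : (0 : ℝ) < p n := by linarith
  have hφ := hφlo_pos n hn
  have hm1 : (n : ℝ) * min (ψ n ^ 2) 1 ≤ n :=
    mul_le_of_le_one_right hn0.le (min_le_right _ _)
  have hnδ : 0 < (n : ℝ) ^ (-δ) := Real.rpow_pos_of_pos hn0 _
  have hh : 0 < n * (C₃ * (n : ℝ) ^ (-δ)) := by positivity
  set L : ℝ := σ ^ 2 * (n * κ - 4 * p n) with hL
  have h8 : 8 * (p n : ℝ) ≤ κ * n := by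
    have := hdim2.trans hm1
    rw [div_mul_eq_mul_div, div_le_iff₀ hκ0] at this
    linarith
  have hLpos : 0 < n * κ - 4 * p n := by
    have : 0 < κ * n := by positivity
    linarith
  have hL0 : 0 < L := by positivity
  have hL' : L ≤ e ⬝ᵥ e - e ⬝ᵥ hat X *ᵥ e := by
    have h1 := hE.lower
    have h2 := hE.proj
    have : L = σ ^ 2 * (n * κ) - σ ^ 2 * (p n * 4) := by rw [hL]; ring
    linarith
  -- Since rκ > 1 and p = o(n), the factor r absorbs both ν and the projection loss 4p. The noise
  -- exponent then becomes rα/2 = α₀/2 per extra covariate.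
  have hratio : (n : ℝ) + ν ≤ r * (n * κ - 4 * p n) := by
    have h1 := hdim.trans hm1
    rw [div_mul_eq_mul_div, div_le_iff₀ hgap] at h1
    rw [div_le_iff₀ hgap] at hlarge
    linarith
  have hη : (γ \ γ₀).Nonempty := by
    rw [Finset.sdiff_nonempty]
    exact fun h => hne (Finset.Subset.antisymm h hγ)
  -- From p ≤ p^α₀ ≤ n^(1-δ) φ ≤ n φ. This bounds the penalty of the fitted noise by a constant,
  -- which ends up in K.
  have hpφ : (p n : ℝ) ≤ n * φlo n := by
    have h1 : (p n : ℝ) ≤ (p n : ℝ) ^ α₀ := by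
      conv_lhs => rw [← Real.rpow_one (p n : ℝ)]
      exact Real.rpow_le_rpow_of_exponent_le hp1 hα₀
    rw [one_mul, Real.norm_of_nonneg (by positivity), Real.norm_of_nonneg (by positivity)] at hpα'
    refine h1.trans (hpα'.trans (mul_le_mul_of_nonneg_right ?_ hφ.le))
    conv_rhs => rw [← Real.rpow_one (n : ℝ)]
    exact Real.rpow_le_rpow_of_exponent_le hn1 (by linarith)
  have hT : 2 * (β ⬝ᵥ β + (e ⬝ᵥ hat X *ᵥ e) / (n * (C₁ / 2))) / φlo n ≤ T₀ := by
    rw [div_le_iff₀ hφ]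
    have h1 : (e ⬝ᵥ hat X *ᵥ e) / (n * (C₁ / 2)) ≤ 8 * σ ^ 2 / C₁ * φlo n := by
      rw [div_le_iff₀ (by positivity)]
      have h2 : 8 * σ ^ 2 / C₁ * φlo n * (n * (C₁ / 2)) = 4 * σ ^ 2 * (n * φlo n) := by
        field_simp; ring
      have h3 : 4 * σ ^ 2 * p n ≤ 4 * σ ^ 2 * (n * φlo n) := by gcongr
      have h4 := hE.proj
      linarith
    rw [hT₀]; linarith
  set k := (γ \ γ₀).card with hk
  have key := hX.score_ratio_over_le (by positivity) hh hν hφ hc hβ e hL0 hL' hγ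
    (add_le_add (hE.excess _ hη) hT)
  refine key.trans ?_
  rw [← hk]
  have hlogp : 0 ≤ Real.log (p n) := Real.log_nonneg hp1
  have hexp : ((n : ℝ) + ν) / 2 *
      ((σ ^ 2 * (k * (α * Real.log (p n))) + T₀) / L) ≤
      r / 2 * (T₀ / σ ^ 2) + α₀ / 2 * Real.log (p n) * k := by
    have e1 : (σ ^ 2 * (k * (α * Real.log (p n))) + T₀) / L =
        (k * (α * Real.log (p n)) + T₀ / σ ^ 2) / (n * κ - 4 * p n) := by
      rw [hL]; field_simp
    have h1 : 0 ≤ k * (α * Real.log (p n)) + T₀ / σ ^ 2 := by positivity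
    have e2 : r * α = α₀ := by rw [hr]; field_simp
    rw [e1]
    calc ((n : ℝ) + ν) / 2 *
          ((k * (α * Real.log (p n)) + T₀ / σ ^ 2) / (n * κ - 4 * p n))
        ≤ (r * (n * κ - 4 * p n)) / 2 *
          ((k * (α * Real.log (p n)) + T₀ / σ ^ 2) / (n * κ - 4 * p n)) := by gcongr
      _ = r / 2 * (T₀ / σ ^ 2) + (r * α) / 2 * Real.log (p n) * k := by
          field_simp; ring
      _ = _ := by rw [e2]
  have hsq : √(((1 + n * (C₃ * (n : ℝ) ^ (-δ)) * φlo n) ^ k)⁻¹) ≤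
      (√(n * (C₃ * (n : ℝ) ^ (-δ)) * φlo n))⁻¹ ^ k := by
    rw [← inv_pow, sqrt_pow_nat (by positivity), Real.sqrt_inv]
    gcongr
    linarith
  have hpe : Real.exp (α₀ / 2 * Real.log (p n) * k) = √((p n : ℝ) ^ α₀) ^ k := by
    rw [Real.sqrt_eq_rpow, ← Real.rpow_mul hp0.le, Real.rpow_def_of_pos hp0, ← Real.exp_nat_mul]
    congr 1
    ring
  calc _ ≤ (√(n * (C₃ * (n : ℝ) ^ (-δ)) * φlo n))⁻¹ ^ k *
        Real.exp (r / 2 * (T₀ / σ ^ 2) + α₀ / 2 * Real.log (p n) * k) :=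
        mul_le_mul hsq (Real.exp_le_exp.2 hexp) (Real.exp_pos _).le (by positivity)
    _ = Real.exp (r / 2 * (T₀ / σ ^ 2)) * excessRatio C₃ δ α₀ p φlo n ^ k := by
        rw [Real.exp_add, hpe, excessRatio, Real.sqrt_div (by positivity), div_pow, div_eq_mul_inv _ (√_ ^ k),
          ← inv_pow]
        ring

/-- Under the square root p^q becomes p^(2q). Part (a) uses q = 0 and part (b) uses q = 1, whence
its exponent α₀ + 2. -/
lemma tendsto_excessRatio {C₃ δ α₀ : ℝ} (q : ℕ) (hpα : (fun n => (p n : ℝ) ^ (α₀ + 2 * q)) =o[atTop]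
      fun n : ℕ => (n : ℝ) ^ (1 - δ) * φlo n) (hp_lim : Tendsto p atTop atTop) :
    Tendsto (fun n => (p n : ℝ) ^ q * excessRatio C₃ δ α₀ p φlo n) atTop (𝓝 0) := by
  have h1 := hpα.tendsto_div_nhds_zero
  have h2 : Tendsto (fun n : ℕ => √((p n : ℝ) ^ (α₀ + 2 * q) /
      ((n : ℝ) ^ (1 - δ) * φlo n) / C₃)) atTop (𝓝 0) := by
    have := (h1.div_const C₃).sqrt
    simpa using this
  refine h2.congr' ?_
  filter_upwards [eventually_ge_atTop 1, hp_lim.eventually_ge_atTop 1] with n hn hp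
  have hn0 : (0 : ℝ) < n := by exact_mod_cast hn
  have hp0 : (0 : ℝ) < p n := by exact_mod_cast hp
  rw [excessRatio, ← Real.sqrt_sq (by positivity : 0 ≤ (p n : ℝ) ^ q),
    ← Real.sqrt_mul (by positivity)]
  congr 1
  rw [Real.rpow_add hp0, sub_eq_add_neg, Real.rpow_add hn0, Real.rpow_one, mul_comm 2 (q : ℝ),
    Real.rpow_mul hp0.le, Real.rpow_natCast, Real.rpow_two, div_div, ← mul_div_assoc]
  congr 1 <;> ring

end Asymptotic

/-! ### The exceptional event -/

section ExceptionalEvent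

variable {Ω : Type*} [MeasurableSpace Ω] {μ : Measure Ω} [IsProbabilityMeasure μ]

/-- The indicators of the complements tend to 0 almost surely, and the measure is finite. -/
lemma tendsto_measure_compl_of_eventually {B : ℕ → Set Ω} (hB : ∀ n, MeasurableSet (B n))
    (h : ∀ᵐ ω ∂μ, ∀ᶠ n in atTop, ω ∈ B n) : Tendsto (fun n => μ (B n)ᶜ) atTop (𝓝 0) := by
  have := tendsto_measure_of_ae_tendsto_indicator (μ := μ) (A := ∅) (As := fun n => (B n)ᶜ) atTop
    MeasurableSet.empty (fun n => (hB n).compl) MeasurableSet.univ (measure_ne_top μ _)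
    (Eventually.of_forall fun n => Set.subset_univ _) ?_
  · simpa using this
  · filter_upwards [h] with ω hω
    filter_upwards [hω] with n hn
    simp [hn]

variable {p : ℕ → ℕ} {X : ∀ n, Ω → Matrix (Fin n) (Fin (p n)) ℝ}
  {γ₀ : ∀ n, Finset (Fin (p n))}

/-- The factors 1/2 and 2 turn the liminf and limsup into strict bounds that hold eventually. The
event is stated by quadratic forms, so measurability of `phiMin` and `phiMax` is never needed. -/
lemma exists_design_event (hX_meas : ∀ n i j, Measurable fun ω => X n ω i j)
    (hnonnull : ∀ n, 1 ≤ n → (γ₀ n).Nonempty) {C₁ C₂ : ℝ} (hC₁ : 0 < C₁) (hC₂ : 0 < C₂)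
    (hphiMin : ∀ᵐ ω ∂μ,
      (C₁ : EReal) ≤ liminf (fun n => (phiMin (X n ω) (γ₀ n) : EReal)) atTop)
    (hphiMax : ∀ᵐ ω ∂μ,
      limsup (fun n => (phiMax (X n ω) (γ₀ n) : EReal)) atTop ≤ (C₂ : EReal)) :
    ∃ B : ℕ → Set Ω, Tendsto (fun n => μ (B n)ᶜ) atTop (𝓝 0) ∧ ∀ n, ∀ ω ∈ B n,
      (∀ (γ : Finset (Fin (p n))) (v : Fin (p n) → ℝ), (∀ j ∉ γ₀ n \ γ, v j = 0) →
        n * (C₁ / 2) * (v ⬝ᵥ v) ≤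
          (X n ω *ᵥ v) ⬝ᵥ (1 - projMat (X n ω) γ) *ᵥ (X n ω *ᵥ v)) ∧
      (∀ v : Fin (p n) → ℝ, (∀ j ∉ γ₀ n, v j = 0) →
        (X n ω *ᵥ v) ⬝ᵥ (X n ω *ᵥ v) ≤ n * (2 * C₂) * (v ⬝ᵥ v)) := by
  have hquad : ∀ (n : ℕ) (ω : Ω) (γ : Finset (Fin (p n))) (v : Fin (p n) → ℝ),
      v ⬝ᵥ ((X n ω)ᵀ * ((1 - projMat (X n ω) γ) * X n ω)) *ᵥ v =
        (X n ω *ᵥ v) ⬝ᵥ (1 - projMat (X n ω) γ) *ᵥ (X n ω *ᵥ v) := by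
    intro n ω γ v
    rw [← Matrix.mulVec_mulVec, dotProduct_mulVec_transpose, Matrix.transpose_transpose,
      Matrix.mulVec_mulVec]
  have hquad2 : ∀ (n : ℕ) (ω : Ω) (v : Fin (p n) → ℝ),
      v ⬝ᵥ (-((X n ω)ᵀ * X n ω)) *ᵥ v = -((X n ω *ᵥ v) ⬝ᵥ (X n ω *ᵥ v)) := by
    intro n ω v
    rw [Matrix.neg_mulVec, dotProduct_neg, dotProduct_gram]
  refine ⟨fun n => {ω | (∀ γ : Finset (Fin (p n)), ∀ v : Fin (p n) → ℝ,
      (∀ j ∉ γ₀ n \ γ, v j = 0) → n * (C₁ / 2) * (v ⬝ᵥ v) ≤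
        v ⬝ᵥ ((X n ω)ᵀ * ((1 - projMat (X n ω) γ) * X n ω)) *ᵥ v) ∧
      -- The upper bound is written as a lower bound for -XᵀX so that `measurableSet_forall_quad`
      -- covers both.
      ∀ v : Fin (p n) → ℝ, (∀ j ∉ γ₀ n, v j = 0) →
        -(n * (2 * C₂)) * (v ⬝ᵥ v) ≤ v ⬝ᵥ (-((X n ω)ᵀ * X n ω)) *ᵥ v}, ?_, ?_⟩
  · refine tendsto_measure_compl_of_eventually (fun n => ?_) ?_
    · have hXn : EntryMeasurable (X n) := hX_meas n
      refine MeasurableSet.inter ?_ ?_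
      · change MeasurableSet {ω | ∀ γ : Finset (Fin (p n)), _}
        rw [Set.ofPred_forall]
        exact MeasurableSet.iInter fun γ => measurableSet_forall_quad
          (hXn.transpose.mul ((hXn.colSub γ).hat.one_sub.mul hXn)) _
      · exact measurableSet_forall_quad
          (fun i j => ((hXn.transpose.mul hXn) i j).neg) _
    · filter_upwards [hphiMin, hphiMax] with ω h1 h2
      have e1 : ((C₁ / 2 : ℝ) : EReal) < liminf (fun n => (phiMin (X n ω) (γ₀ n) : EReal)) atTop :=
        lt_of_lt_of_le (EReal.coe_lt_coe_iff.2 (by linarith)) h1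
      have e2 : limsup (fun n => (phiMax (X n ω) (γ₀ n) : EReal)) atTop < ((2 * C₂ : ℝ) : EReal) :=
        lt_of_le_of_lt h2 (EReal.coe_lt_coe_iff.2 (by linarith))
      filter_upwards [eventually_lt_of_lt_liminf e1, eventually_lt_of_limsup_lt e2,
        eventually_ge_atTop 1] with n h3 h4 hn
      refine ⟨fun γ v hv => ?_, fun v hv => ?_⟩
      · rw [hquad]
        exact phiMin_bound (X n ω) hn (EReal.coe_lt_coe_iff.1 h3).le γ hv
      · rw [hquad2, neg_mul]
        exact neg_le_neg (phiMax_bound (X n ω) hn (hnonnull n hn) (EReal.coe_lt_coe_iff.1 h4).le hv)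
  · rintro n ω ⟨h1, h2⟩
    refine ⟨fun γ v hv => ?_, fun v hv => ?_⟩
    · rw [← hquad]; exact h1 γ v hv
    · have := h2 v hv
      rw [hquad2, neg_mul] at this
      exact neg_le_neg_iff.1 this

/-- The full model alone suffices, its extra covariates being all those outside γ₀; if γ₀ is already
full, then v = 0. -/
lemma excess_of_minEig {n p : ℕ} (hn : 0 < n) (X : Matrix (Fin n) (Fin p) ℝ)
    (γ₀ : Finset (Fin p)) {h : ℝ}
    (hover : ∀ γ ∈ overModels γ₀, h ≤ minEig (residGram X (γ \ γ₀) γ₀)) {v : Fin p → ℝ}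
    (hv : ∀ j ∈ γ₀, v j = 0) :
    n * h * (v ⬝ᵥ v) ≤ (X *ᵥ v) ⬝ᵥ (1 - projMat X γ₀) *ᵥ (X *ᵥ v) := by
  by_cases hu : γ₀ = Finset.univ
  · have : v = 0 := by
      ext j
      exact hv j (by rw [hu]; exact Finset.mem_univ j)
    simp [this]
  · exact minEig_residGram_bound X hn
      (hover Finset.univ ⟨Finset.subset_univ _, fun hc => hu hc.symm⟩)
      fun j hj => hv j (by simpa using hj)

/-- The Chernoff base for t = 1/4 and s = 4 is √2/e; this is why the threshold 4 appears in
`GoodNoise`. -/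
lemma exp_neg_one_mul_lt_one :
    Real.exp (-(1 / 4) * 4) * (√(1 - 2 * (1 / 4)))⁻¹ < 1 := by
  have h1 : (1 / 2 : ℝ) ≤ √(1 - 2 * (1 / 4)) := Real.le_sqrt_of_sq_le (by norm_num)
  have h2 : (√(1 - 2 * (1 / 4)))⁻¹ ≤ (1 / 2 : ℝ)⁻¹ := inv_anti₀ (by norm_num) h1
  have h3 : Real.exp (-(1 / 4) * 4) = (Real.exp 1)⁻¹ := by rw [← Real.exp_neg]; norm_num
  have h4 : (2 : ℝ) < Real.exp 1 := by linarith [Real.exp_one_gt_d9]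
  rw [h3, inv_mul_lt_iff₀ (Real.exp_pos 1)]
  calc _ ≤ (1 / 2 : ℝ)⁻¹ := h2
    _ < _ := by norm_num; linarith

lemma exists_lower_tail_rate {κ : ℝ} (hκ0 : 0 < κ) (hκ1 : κ < 1) :
    ∃ t : ℝ, 0 ≤ t ∧ Real.exp (t * κ) * (√(1 + 2 * t))⁻¹ < 1 := by
  -- With t = 1 - κ the claim is 2t(1 - t) < log(1 + 2t), which follows from log(1 + x) ≥ 2x/(x + 2)
  -- at x = 2t because (1 - t)(1 + t) < 1.
  refine ⟨1 - κ, by linarith, ?_⟩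
  set t := 1 - κ with ht
  have ht0 : 0 < t := by linarith
  have h1 : 0 < 1 + 2 * t := by linarith
  have h2 := Real.le_log_one_add_of_nonneg (x := 2 * t) (by linarith)
  have h3 : 2 * t * κ < 2 * (2 * t) / (2 * t + 2) := by
    rw [lt_div_iff₀ (by linarith)]
    have : κ = 1 - t := by rw [ht]; ring
    rw [this]
    nlinarith [pow_pos ht0 3]
  rw [← div_eq_mul_inv, div_lt_one (Real.sqrt_pos.2 h1), Real.lt_sqrt (Real.exp_pos _).le,
    ← Real.exp_nat_mul, ← Real.lt_log_iff_exp_lt h1]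
  push_cast
  linarith

lemma tendsto_union_bound (hp_lim : Tendsto p atTop atTop) {t α : ℝ} (htα : 1 < t * α) (r : ℝ) :
    Tendsto (fun n => Real.exp (p n * (Real.exp (-t * (α * Real.log (p n))) * r)) - 1) atTop
      (𝓝 0) := by
  have h1 : Tendsto (fun n => (p n : ℝ) ^ (-(t * α - 1)) * r) atTop (𝓝 0) := by
    have := ((tendsto_rpow_neg_atTop (by linarith : 0 < t * α - 1)).comp
      (tendsto_natCast_atTop_atTop.comp hp_lim)).mul_const r
    simpa using this
  have h2 : Tendsto (fun n => (p n : ℝ) * (Real.exp (-t * (α * Real.log (p n))) * r)) atTop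
      (𝓝 0) := by
    refine h1.congr' ?_
    filter_upwards [hp_lim.eventually_ge_atTop 1] with n hn
    have hp0 : (0 : ℝ) < p n := by exact_mod_cast hn
    have e1 : Real.exp (-t * (α * Real.log (p n))) = (p n : ℝ) ^ (-(t * α)) := by
      rw [Real.rpow_def_of_pos hp0]; congr 1; ring
    have e2 : -(t * α - 1) = 1 + -(t * α) := by ring
    rw [e1, e2, Real.rpow_add hp0, Real.rpow_one, mul_assoc]
  have h3 := (Real.continuous_exp.tendsto 0).comp h2
  simpa using h3.sub_const 1

lemma tendsto_ofReal_zero {u : ℕ → ℝ} (h : Tendsto u atTop (𝓝 0)) :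
    Tendsto (fun n => ENNReal.ofReal (u n)) atTop (𝓝 0) := by
  simpa using ENNReal.tendsto_ofReal h

lemma tendsto_zero_of_eventually_le {u v : ℕ → ℝ≥0∞} (hv : Tendsto v atTop (𝓝 0))
    (h : ∀ᶠ n in atTop, u n ≤ v n) : Tendsto u atTop (𝓝 0) :=
  tendsto_of_tendsto_of_tendsto_of_le_of_le' tendsto_const_nhds hv
    (Eventually.of_forall fun _ => zero_le) h

lemma exists_bad_event {ε : ∀ n, Ω → Fin n → ℝ} {σ : ℝ} (hσ : 0 < σ)
    (hX_meas : ∀ n i j, Measurable fun ω => X n ω i j)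
    (hε_law : ∀ n, HasLaw (ε n) (noiseLaw n σ) μ)
    (hindep : ∀ n, IndepFun (fun ω i j => X n ω i j) (ε n) μ)
    (hnonnull : ∀ n, 1 ≤ n → (γ₀ n).Nonempty) {C₁ C₂ : ℝ} (hC₁ : 0 < C₁) (hC₂ : 0 < C₂)
    (hphiMin : ∀ᵐ ω ∂μ,
      (C₁ : EReal) ≤ liminf (fun n => (phiMin (X n ω) (γ₀ n) : EReal)) atTop)
    (hphiMax : ∀ᵐ ω ∂μ,
      limsup (fun n => (phiMax (X n ω) (γ₀ n) : EReal)) atTop ≤ (C₂ : EReal))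
    (hp_lim : Tendsto p atTop atTop) {C₃ δ : ℝ}
    (hover : ∀ n, 1 ≤ n → ∀ᵐ ω ∂μ, ∀ γ ∈ overModels (γ₀ n),
      C₃ * (n : ℝ) ^ (-δ) ≤ minEig (residGram (X n ω) (γ \ γ₀ n) (γ₀ n)))
    {α κ : ℝ} (hα : 2 < α) (hκ0 : 0 < κ) (hκ1 : κ < 1) :
    ∃ bad : ℕ → Set Ω, Tendsto (fun n => μ (bad n)) atTop (𝓝 0) ∧
      ∀ᶠ n : ℕ in atTop, ∀ ω ∉ bad n,
        GoodDesign (X n ω) (γ₀ n) (n * (C₁ / 2)) (n * (2 * C₂)) (n * (C₃ * (n : ℝ) ^ (-δ))) ∧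
        GoodNoise (X n ω) (γ₀ n) (ε n ω) σ κ (α * Real.log (p n)) := by
  obtain ⟨B, hB, hBgood⟩ := exists_design_event hX_meas hnonnull hC₁ hC₂ hphiMin hphiMax
  obtain ⟨t, ht0, ht⟩ := exists_lower_tail_rate hκ0 hκ1
  -- The Chernoff parameter lies midway between 1/α and 1/2: l < 1/2 keeps the moment generating
  -- function finite, and lα > 1 makes the union bound p · p^(-lα) vanish. Both are possible because
  -- α > 2.
  set l : ℝ := (1 / α + 1 / 2) / 2 with hl
  have hα0 : 0 < α := by linarith
  have hα2 : 1 / α < 1 / 2 := one_div_lt_one_div_of_lt two_pos hα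
  have hl0 : 0 ≤ l := by positivity
  have hl2 : l < 1 / 2 := by rw [hl]; linarith
  have hlα : 1 < l * α := by
    have : 1 / α < l := by rw [hl]; linarith
    rwa [div_lt_iff₀ hα0] at this
  let N : ℕ → Set Ω := fun n => {ω | ¬ ∀ γ ∈ overModels (γ₀ n),
    C₃ * (n : ℝ) ^ (-δ) ≤ minEig (residGram (X n ω) (γ \ γ₀ n) (γ₀ n))}
  let E₁ : ℕ → Set Ω := fun n => {ω | σ ^ 2 * (p n * 4) ≤ ε n ω ⬝ᵥ hat (X n ω) *ᵥ ε n ω}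
  let E₂ : ℕ → Set Ω := fun n => {ω | σ ^ 2 * (n * 4) ≤ ε n ω ⬝ᵥ ε n ω}
  let E₃ : ℕ → Set Ω := fun n => {ω | ε n ω ⬝ᵥ ε n ω ≤ σ ^ 2 * (n * κ)}
  let E₄ : ℕ → Set Ω := fun n => {ω | ∃ η : Finset (Fin (p n)), η.Nonempty ∧
    σ ^ 2 * (η.card * (α * Real.log (p n))) ≤
      ε n ω ⬝ᵥ hat (excessDesign (X n ω) (γ₀ n) η) *ᵥ ε n ω}
  have hr0 : 0 ≤ Real.exp (-(1 / 4) * 4) * (√(1 - 2 * (1 / 4)))⁻¹ := by positivity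
  have hpow := tendsto_pow_atTop_nhds_zero_of_lt_one hr0 exp_neg_one_mul_lt_one
  have hN : Tendsto (fun n => μ (N n)) atTop (𝓝 0) := by
    refine tendsto_zero_of_eventually_le tendsto_const_nhds ?_
    filter_upwards [eventually_ge_atTop 1] with n hn
    exact (ae_iff.1 (hover n hn)).le
  have h₁ : Tendsto (fun n => μ (E₁ n)) atTop (𝓝 0) := by
    refine tendsto_zero_of_eventually_le (tendsto_ofReal_zero (hpow.comp hp_lim)) ?_
    filter_upwards [hp_lim.eventually_ge_atTop 1] with n hn
    exact measure_hat_design_tail (hX_meas n) hσ (hε_law n) (hindep n) hn (by norm_num)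
      (by norm_num) (by norm_num)
  have h₂ : Tendsto (fun n => μ (E₂ n)) atTop (𝓝 0) := by
    refine tendsto_zero_of_eventually_le (tendsto_ofReal_zero hpow) ?_
    filter_upwards [eventually_ge_atTop 1] with n hn
    exact measure_noise_upper_tail hσ (hε_law n) hn (by norm_num) (by norm_num) (by norm_num)
  have h₃ : Tendsto (fun n => μ (E₃ n)) atTop (𝓝 0) := by
    refine tendsto_zero_of_eventually_le (tendsto_ofReal_zero
      (tendsto_pow_atTop_nhds_zero_of_lt_one (by positivity) ht)) ?_
    exact Eventually.of_forall fun n => measure_noise_lower_tail hσ (hε_law n) ht0 κ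
  have h₄ : Tendsto (fun n => μ (E₄ n)) atTop (𝓝 0) := by
    refine tendsto_zero_of_eventually_le
      (tendsto_ofReal_zero (tendsto_union_bound hp_lim hlα (√(1 - 2 * l))⁻¹)) ?_
    filter_upwards [hp_lim.eventually_ge_atTop 2] with n hn
    have hlog : 0 < Real.log (p n) := Real.log_pos (by exact_mod_cast hn)
    exact measure_exists_hat_excess_tail (hX_meas n) hσ (hε_law n) (hindep n) (γ₀ n) hl0 hl2
      (mul_pos hα0 hlog)
  refine ⟨fun n => (B n)ᶜ ∪ (N n ∪ (E₁ n ∪ (E₂ n ∪ (E₃ n ∪ E₄ n)))), ?_, ?_⟩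
  · refine tendsto_zero_of_eventually_le
      (v := fun n => μ (B n)ᶜ + (μ (N n) + (μ (E₁ n) + (μ (E₂ n) + (μ (E₃ n) + μ (E₄ n))))))
      (by simpa using hB.add (hN.add (h₁.add (h₂.add (h₃.add h₄))))) ?_
    refine Eventually.of_forall fun n => ?_
    refine (measure_union_le _ _).trans (add_le_add le_rfl ?_)
    refine (measure_union_le _ _).trans (add_le_add le_rfl ?_)
    refine (measure_union_le _ _).trans (add_le_add le_rfl ?_)
    refine (measure_union_le _ _).trans (add_le_add le_rfl ?_)
    exact measure_union_le _ _
  · filter_upwards [eventually_ge_atTop 1] with n hn ω hω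
    simp only [Set.mem_union, not_or, Set.mem_compl_iff, not_not] at hω
    obtain ⟨hωB, hωN, hω₁, hω₂, hω₃, hω₄⟩ := hω
    have hωN' := not_not.1 hωN
    refine ⟨⟨(hBgood n ω hωB).1, (hBgood n ω hωB).2, fun v hv =>
      excess_of_minEig hn (X n ω) (γ₀ n) hωN' hv⟩, ⟨(not_le.1 hω₁).le, (not_le.1 hω₂).le,
      (not_le.1 hω₃).le, fun η hη => ?_⟩⟩
    by_contra hc
    exact hω₄ ⟨η, hη, (not_le.1 hc).le⟩

end ExceptionalEvent

/-! ### Summation over the models and the conclusion -/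

section Conclusion

lemma edist_zero_ennreal (x : ℝ≥0∞) : edist x 0 = x := by
  cases x with
  | top => rfl
  | coe a =>
    change edist a 0 = _
    rw [edist_nndist, NNReal.nndist_zero_eq_val']

/-- Only monotonicity of the outer measure is used, so neither f nor the bad sets need be
measurable; f will be a supremum or infimum over uncountably many c. -/
lemma tendstoInMeasure_of_bad {Ω E : Type*} [MeasurableSpace Ω] [EDist E] {μ : Measure Ω}
    {f : ℕ → Ω → E} {g : Ω → E} {bad : ℕ → Set Ω}
    (hbad : Tendsto (fun n => μ (bad n)) atTop (𝓝 0)) {u : ℕ → ℝ} (hu : Tendsto u atTop (𝓝 0))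
    (h : ∀ᶠ n in atTop, ∀ ω ∉ bad n, edist (f n ω) (g ω) ≤ ENNReal.ofReal (u n)) :
    TendstoInMeasure μ f atTop g := by
  intro ε hε
  refine tendsto_zero_of_eventually_le hbad ?_
  filter_upwards [h, (tendsto_ofReal_zero hu).eventually_lt_const hε] with n hn hlt
  refine measure_mono fun ω hω => ?_
  by_contra hc
  exact absurd (hω.trans (hn ω hc)) (not_le.2 hlt)

/-- On supersets of γ₀ the map γ ↦ γ \ γ₀ is injective, with nonempty values once γ₀ itself is
removed. -/
lemma sum_pow_card_sdiff_le {p : ℕ} (γ₀ : Finset (Fin p)) {z : ℝ} (hz : 0 ≤ z) :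
    ∑ γ ∈ (Finset.univ.erase γ₀).filter (γ₀ ⊆ ·), z ^ (γ \ γ₀).card ≤
      Real.exp (p * z) - 1 := by
  have hinj : Set.InjOn (fun γ : Finset (Fin p) => γ \ γ₀)
      ((Finset.univ.erase γ₀).filter (γ₀ ⊆ ·) : Finset (Finset (Fin p))) := by
    intro γ hγ γ' hγ' h
    have h1 := (Finset.mem_filter.1 hγ).2
    have h2 := (Finset.mem_filter.1 hγ').2
    simp only at h
    rw [← Finset.sdiff_union_of_subset h1, ← Finset.sdiff_union_of_subset h2, h]
  rw [← Finset.sum_image (f := fun η : Finset (Fin p) => z ^ η.card) hinj]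
  refine le_trans (Finset.sum_le_sum_of_subset_of_nonneg ?_ fun η _ _ => pow_nonneg hz _)
    (sum_pow_card_nonempty_le hz p)
  intro η hη
  obtain ⟨γ, hγ, rfl⟩ := Finset.mem_image.1 hη
  obtain ⟨hne, hsub⟩ := Finset.mem_filter.1 hγ
  refine Finset.mem_erase.2 ⟨fun h => ?_, Finset.mem_univ _⟩
  exact (Finset.mem_erase.1 hne).1 (Finset.Subset.antisymm
    (Finset.sdiff_eq_empty_iff_subset.1 h) hsub)

/-- At most 2^p ≤ e^p models miss a true covariate, so exp(-2p) for each leaves exp(-p) in total. -/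
lemma sum_model_bounds_le {p : ℕ} {γ₀ : Finset (Fin p)} {f : Finset (Fin p) → ℝ} {K z : ℝ}
    (hK : 0 ≤ K) (hz : 0 ≤ z) (hover : ∀ γ, γ₀ ⊆ γ → γ ≠ γ₀ → f γ ≤ K * z ^ (γ \ γ₀).card)
    (hmiss : ∀ γ, ¬ γ₀ ⊆ γ → f γ ≤ Real.exp (-2 * p)) :
    ∑ γ ∈ Finset.univ.erase γ₀, f γ ≤ K * (Real.exp (p * z) - 1) + Real.exp (-(p : ℝ)) := by
  rw [← Finset.sum_filter_add_sum_filter_not _ (γ₀ ⊆ ·)]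
  refine add_le_add ?_ ?_
  · refine le_trans (Finset.sum_le_sum fun γ hγ => ?_)
      (mul_le_mul_of_nonneg_left (sum_pow_card_sdiff_le γ₀ hz) hK |>.trans' (Finset.mul_sum ..).ge)
    obtain ⟨hne, hsub⟩ := Finset.mem_filter.1 hγ
    exact hover γ hsub (Finset.mem_erase.1 hne).1
  · refine (Finset.sum_le_card_nsmul _ _ (Real.exp (-2 * p)) fun γ hγ =>
      hmiss γ (Finset.mem_filter.1 hγ).2).trans ?_
    have hcard : ((Finset.univ.erase γ₀).filter (¬ γ₀ ⊆ ·)).card ≤ 2 ^ p := by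
      refine (Finset.card_le_univ _).trans_eq ?_
      rw [Fintype.card_finset, Fintype.card_fin]
    have h2 : ((2 : ℝ) ^ p) ≤ Real.exp p := by
      have : (2 : ℝ) ≤ Real.exp 1 := by linarith [Real.exp_one_gt_d9]
      calc (2 : ℝ) ^ p ≤ Real.exp 1 ^ p := pow_le_pow_left₀ zero_le_two this p
        _ = Real.exp p := by rw [← Real.exp_nat_mul, mul_one]
    rw [nsmul_eq_mul]
    calc _ ≤ Real.exp p * Real.exp (-2 * p) := by
          refine mul_le_mul_of_nonneg_right (le_trans ?_ h2) (Real.exp_pos _).le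
          exact_mod_cast hcard
      _ = Real.exp (-(p : ℝ)) := by rw [← Real.exp_add]; congr 1; ring

lemma tendsto_exp_neg_dim {p : ℕ → ℕ} (hp_lim : Tendsto p atTop atTop) :
    Tendsto (fun n => Real.exp (-(p n : ℝ))) atTop (𝓝 0) :=
  Real.tendsto_exp_neg_atTop_nhds_zero.comp (tendsto_natCast_atTop_atTop.comp hp_lim)

end Conclusion

theorem mainTheorem1
    {Ω : Type*} [MeasurableSpace Ω] (μ : Measure Ω) [IsProbabilityMeasure μ]
    -- dimensions, true coefficients, design, noise
    (p : ℕ → ℕ) (β₀ : ∀ n, Fin (p n) → ℝ)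
    (X : ∀ n, Ω → Matrix (Fin n) (Fin (p n)) ℝ) (ε : ∀ n, Ω → Fin n → ℝ)
    (σ₀ : ℝ) (hσ₀ : 0 < σ₀)
    (hX_meas : ∀ n i j, Measurable fun ω => X n ω i j)
    (hε_law : ∀ n, HasLaw (ε n) (Measure.pi fun _ => gaussianReal 0 (σ₀ ^ 2).toNNReal) μ)
    (hindep : ∀ n, IndepFun (fun ω i j => X n ω i j) (ε n) μ)
    -- prior on models and degrees of freedom
    (ν : ℝ) (hν : 0 < ν) (prior : ∀ n, PMF (Finset (Fin (p n))))
    -- the true model is nonnull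
    (hnonnull : ∀ n, 1 ≤ n → (stateVector (β₀ n)).Nonempty)
    -- prior odds
    (C₀ : ℝ) (hC₀ : 0 < C₀)
    (hprior_pos : ∀ n, 1 ≤ n → prior n (stateVector (β₀ n)) ≠ 0)
    (hprior : ∀ n, 1 ≤ n → ∀ γ,
      (prior n γ).toReal / (prior n (stateVector (β₀ n))).toReal ≤ C₀)
    -- eigenvalue condition on the models that miss a true covariate
    (C₁ C₂ : ℝ) (hC₁ : 0 < C₁) (hC₂ : 0 < C₂)
    (hphiMin : ∀ᵐ ω ∂μ,
      (C₁ : EReal) ≤ liminf (fun n => (phiMin (X n ω) (stateVector (β₀ n)) : EReal)) atTop)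
    (hphiMax : ∀ᵐ ω ∂μ,
      limsup (fun n => (phiMax (X n ω) (stateVector (β₀ n)) : EReal)) atTop ≤ (C₂ : EReal))
    -- minimal signal
    (ψ : ℕ → ℝ) (hψ_pos : ∀ n, 1 ≤ n → 0 < ψ n)
    (hψ : ∀ n, 1 ≤ n → ∀ j ∈ stateVector (β₀ n), ψ n ≤ |β₀ n j|)
    (hψ_lim : Tendsto (fun n : ℕ => ψ n * Real.sqrt n) atTop atTop)
    -- growth of the dimension
    (hp_lim : Tendsto p atTop atTop) (hp_le : ∀ n, p n ≤ n)
    (hp_rate : (fun n : ℕ => (p n : ℝ) * Real.log n) =o[atTop]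
      fun n : ℕ => (n : ℝ) * Real.log (1 + min (ψ n ^ 2) 1))
    -- range of the prior variances
    (φlo φhi : ℕ → ℝ) (hφlo_pos : ∀ n, 1 ≤ n → 0 < φlo n) (hφ_le : ∀ n, 1 ≤ n → φlo n ≤ φhi n)
    (δ₀ : ℝ) (hδ₀ : 0 < δ₀)
    (hφhi : φhi =O[atTop] fun n : ℕ => (n : ℝ) ^ δ₀)
    (hφlo : (fun n => ∑ j, β₀ n j ^ 2) =O[atTop] φlo)
    -- eigenvalue condition on the models that strictly contain the true one
    (C₃ δ : ℝ) (hC₃ : 0 < C₃) (hδ : 0 ≤ δ)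
    (hδ_lim : Tendsto (fun n : ℕ => (n : ℝ) ^ (1 - δ) * φlo n) atTop atTop)
    (hover : ∀ n, 1 ≤ n → ∀ᵐ ω ∂μ, ∀ γ ∈ overModels (stateVector (β₀ n)),
      C₃ * (n : ℝ) ^ (-δ) ≤
        minEig (residGram (X n ω) (γ \ stateVector (β₀ n)) (stateVector (β₀ n))))
    -- the responses
    (y : ∀ n, Ω → Fin n → ℝ) (hy : ∀ n ω, y n ω = X n ω *ᵥ β₀ n + ε n ω) :
    ((∃ α₀ : ℝ, 2 < α₀ ∧
        (fun n => (p n : ℝ) ^ α₀) =o[atTop] fun n : ℕ => (n : ℝ) ^ (1 - δ) * φlo n) →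
      TendstoInMeasure μ
        (fun n ω =>
          ⨆ c : Set.Icc (fun _ : Fin (p n) => φlo n) (fun _ => φhi n),
            ⨆ γ : {γ : Finset (Fin (p n)) // γ ≠ stateVector (β₀ n)},
              ENNReal.ofReal
                (posterior ν (prior n) c.1 (X n ω) (y n ω) γ.1 /
                  posterior ν (prior n) c.1 (X n ω) (y n ω) (stateVector (β₀ n))))
        atTop (fun _ => 0)) ∧
    ((∃ α₀ : ℝ, 2 < α₀ ∧
        (fun n => (p n : ℝ) ^ (α₀ + 2)) =o[atTop] fun n : ℕ => (n : ℝ) ^ (1 - δ) * φlo n) →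
      TendstoInMeasure μ
        (fun n ω =>
          ⨆ c : Set.Icc (fun _ : Fin (p n) => φlo n) (fun _ => φhi n),
            ∑ γ ∈ Finset.univ.erase (stateVector (β₀ n)),
              posterior ν (prior n) c.1 (X n ω) (y n ω) γ)
        atTop (fun _ => 0) ∧
      TendstoInMeasure μ
        (fun n ω =>
          ⨅ c : Set.Icc (fun _ : Fin (p n) => φlo n) (fun _ => φhi n),
            posterior ν (prior n) c.1 (X n ω) (y n ω) (stateVector (β₀ n)))
        atTop (fun _ => 1)) := by
  have hβ0 : ∀ n, ∀ j ∉ stateVector (β₀ n), β₀ n j = 0 := fun n j hj => by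
    by_contra hc
    exact hj (Finset.mem_filter.2 ⟨Finset.mem_univ _, hc⟩)
  obtain ⟨C₅, hC₅, hβb⟩ := hφlo.exists_pos
  have key : ∀ α₀ : ℝ, 2 < α₀ →
      ((fun n => (p n : ℝ) ^ α₀) =o[atTop] fun n : ℕ => (n : ℝ) ^ (1 - δ) * φlo n) →
      ∃ bad : ℕ → Set Ω, Tendsto (fun n => μ (bad n)) atTop (𝓝 0) ∧ ∃ K : ℝ, 0 < K ∧
        ∀ᶠ n : ℕ in atTop, ∀ ω ∉ bad n,
        ∀ c : Set.Icc (fun _ : Fin (p n) => φlo n) (fun _ => φhi n), ∀ γ,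
        (stateVector (β₀ n) ⊆ γ → γ ≠ stateVector (β₀ n) →
          modelScore ν c.1 (X n ω) (y n ω) γ /
            modelScore ν c.1 (X n ω) (y n ω) (stateVector (β₀ n)) ≤
          K * excessRatio C₃ δ α₀ p φlo n ^ (γ \ stateVector (β₀ n)).card) ∧
        (¬ stateVector (β₀ n) ⊆ γ →
          modelScore ν c.1 (X n ω) (y n ω) γ /
            modelScore ν c.1 (X n ω) (y n ω) (stateVector (β₀ n)) ≤ Real.exp (-2 * p n)) := by
    intro α₀ hα₀ hpα
    -- The gap α₀ > 2 is split: α > 2 serves the union bound, and α < α₀ leaves room for κ, midway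
    -- between α/α₀ and 1, to satisfy both κ < 1 (lower tail of |e|²) and κα₀/α > 1.
    set α : ℝ := (α₀ + 2) / 2 with hα
    have hα2 : 2 < α := by rw [hα]; linarith
    have hαα₀ : α < α₀ := by rw [hα]; linarith
    have hα00 : 0 < α₀ := by linarith
    have hα0 : 0 < α := by linarith
    set κ : ℝ := (1 + α / α₀) / 2 with hκ
    have hdiv : α / α₀ < 1 := (div_lt_one hα00).2 hαα₀
    have hκ0 : 0 < κ := by positivity
    have hκ1 : κ < 1 := by rw [hκ]; linarith
    have hκr : 1 < α₀ / α * κ := by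
      have e : α₀ / α * κ = (α₀ / α + 1) / 2 := by rw [hκ]; field_simp
      have : 1 < α₀ / α := (one_lt_div hα0).2 hαα₀
      rw [e]; linarith
    obtain ⟨bad, hbad, hgood⟩ := exists_bad_event (γ₀ := fun n => stateVector (β₀ n)) hσ₀ hX_meas
      hε_law hindep hnonnull hC₁ hC₂ hphiMin hphiMax hp_lim hover hα2 hκ0 hκ1
    obtain ⟨K, hK, hscore⟩ := eventually_score_over_le (b := 2 * C₂) (C₅ := C₅) hσ₀ hC₁ hC₃ hδ hC₅
      hν hα0 (by linarith) hκr hφlo_pos hp_lim hp_rate hpα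
    refine ⟨bad, hbad, K, hK, ?_⟩
    filter_upwards [hgood, hscore, hβb.bound, eventually_ge_atTop 1,
      eventually_score_miss_le (σ := σ₀) (κ := κ) (s := fun n => α * Real.log (p n)) hC₁ hC₂ hC₅
        hδ₀ hν hψ_pos hφlo_pos hp_lim hp_rate hφhi] with n hg hs hb hn hm ω hω c γ
    obtain ⟨hD, hN⟩ := hg ω hω
    have hn0 : (0 : ℝ) < n := by exact_mod_cast hn
    have hh : 0 < n * (C₃ * (n : ℝ) ^ (-δ)) := by positivity
    have hββ : β₀ n ⬝ᵥ β₀ n ≤ C₅ * φlo n := by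
      have h1 := (le_abs_self _).trans hb
      rw [Real.norm_of_nonneg (hφlo_pos n hn).le] at h1
      simpa [dotProduct, sq] using h1
    rw [hy n ω]
    exact ⟨fun h1 h2 => hs (X n ω) _ (β₀ n) (ε n ω) c.1 hD hN (hβ0 n) hββ (fun j => c.2.1 j) γ h1 h2,
      fun h1 => hm (X n ω) _ _ (β₀ n) (ε n ω) c.1 hD hh hN (hβ0 n) (hψ n hn) hββ
        (fun j => c.2.1 j) (fun j => c.2.2 j) γ h1⟩
  have hcpos : ∀ n, 1 ≤ n → ∀ c : Set.Icc (fun _ : Fin (p n) => φlo n) (fun _ => φhi n),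
      ∀ j, 0 ≤ c.1 j := fun n hn c j => (hφlo_pos n hn).le.trans (c.2.1 j)
  refine ⟨?_, ?_⟩
  · rintro ⟨α₀, hα₀, hpα⟩
    obtain ⟨bad, hbad, K, hK, hev⟩ := key α₀ hα₀ hpα
    have hz : Tendsto (excessRatio C₃ δ α₀ p φlo) atTop (𝓝 0) := by
      have := tendsto_excessRatio (C₃ := C₃) (δ := δ) (α₀ := α₀) (p := p) (φlo := φlo) 0
        (by simpa using hpα) hp_lim
      simpa using this
    refine tendstoInMeasure_of_bad hbad
      (u := fun n => C₀ * (K * excessRatio C₃ δ α₀ p φlo n + Real.exp (-(p n : ℝ)))) ?_ ?_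
    · simpa using ((hz.const_mul K).add (tendsto_exp_neg_dim hp_lim)).const_mul C₀
    · filter_upwards [hev, eventually_ge_atTop 1, hz.eventually_le_const zero_lt_one] with
        n hn hn1 hz1 ω hω
      rw [edist_zero_ennreal]
      refine iSup_le fun c => iSup_le fun γ => ENNReal.ofReal_le_ofReal ?_
      refine (posterior_odds_le hν (hcpos n hn1 c) (hprior_pos n hn1) (hprior n hn1 γ.1)).trans ?_
      refine mul_le_mul_of_nonneg_left ?_ hC₀.le
      have hz0 : 0 ≤ excessRatio C₃ δ α₀ p φlo n := Real.sqrt_nonneg _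
      obtain ⟨h1, h2⟩ := hn ω hω c γ.1
      by_cases hsub : stateVector (β₀ n) ⊆ γ.1
      · have hk : (γ.1 \ stateVector (β₀ n)).card ≠ 0 := by
          rw [Finset.card_ne_zero, Finset.sdiff_nonempty]
          exact fun h => γ.2 (Finset.Subset.antisymm h hsub)
        -- Once z ≤ 1, the worst strict superset has one extra covariate: z^k ≤ z.
        have h3 := mul_le_mul_of_nonneg_left (pow_le_of_le_one hz0 hz1 hk) hK.le
        linarith [h1 hsub γ.2, Real.exp_pos (-(p n : ℝ))]
      · have h3 : Real.exp (-2 * (p n : ℝ)) ≤ Real.exp (-(p n : ℝ)) := by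
          rw [Real.exp_le_exp]
          linarith [(Nat.cast_nonneg (p n) : (0 : ℝ) ≤ p n)]
        linarith [h2 hsub, mul_nonneg hK.le hz0]
  · rintro ⟨α₀, hα₀, hpα⟩
    have hpα' : (fun n => (p n : ℝ) ^ α₀) =o[atTop] fun n : ℕ => (n : ℝ) ^ (1 - δ) * φlo n := by
      refine IsBigO.trans_isLittleO (IsBigO.of_bound 1 ?_) hpα
      filter_upwards [hp_lim.eventually_ge_atTop 1] with n hn
      have hp1 : (1 : ℝ) ≤ p n := by exact_mod_cast hn
      rw [one_mul, Real.norm_of_nonneg (by positivity), Real.norm_of_nonneg (by positivity)]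
      exact Real.rpow_le_rpow_of_exponent_le hp1 (by linarith)
    obtain ⟨bad, hbad, K, hK, hev⟩ := key α₀ hα₀ hpα'
    have hz : Tendsto (fun n => (p n : ℝ) * excessRatio C₃ δ α₀ p φlo n) atTop (𝓝 0) := by
      have := tendsto_excessRatio (C₃ := C₃) (δ := δ) (α₀ := α₀) (p := p) (φlo := φlo) 1
        (by simpa using hpα) hp_lim
      simpa using this
    have hu : Tendsto (fun n => C₀ * (K * (Real.exp (p n * excessRatio C₃ δ α₀ p φlo n) - 1) +
        Real.exp (-(p n : ℝ)))) atTop (𝓝 0) := by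
      have h1 := (((Real.continuous_exp.tendsto 0).comp hz).sub_const 1).const_mul K
      have h2 := (h1.add (tendsto_exp_neg_dim hp_lim)).const_mul C₀
      simpa using h2
    have hsum : ∀ᶠ n in atTop, ∀ ω ∉ bad n,
        ∀ c : Set.Icc (fun _ : Fin (p n) => φlo n) (fun _ => φhi n),
        ∑ γ ∈ Finset.univ.erase (stateVector (β₀ n)),
          posterior ν (prior n) c.1 (X n ω) (y n ω) γ ≤
        C₀ * (K * (Real.exp (p n * excessRatio C₃ δ α₀ p φlo n) - 1) +
          Real.exp (-(p n : ℝ))) := by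
      filter_upwards [hev, eventually_ge_atTop 1] with n hn hn1 ω hω c
      refine (sum_erase_posterior_le hν (hcpos n hn1 c) (hprior_pos n hn1) (hprior n hn1)).trans ?_
      exact mul_le_mul_of_nonneg_left (sum_model_bounds_le hK.le (Real.sqrt_nonneg _)
        (fun γ => (hn ω hω c γ).1) fun γ => (hn ω hω c γ).2) hC₀.le
    -- The supremum and infimum are now real-valued, and bounding them through their members needs a
    -- nonempty box.
    have hne : ∀ n, 1 ≤ n →
        Nonempty (Set.Icc (fun _ : Fin (p n) => φlo n) (fun _ => φhi n)) := fun n hn =>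
      ⟨⟨fun _ => φlo n, le_refl _, fun _ => hφ_le n hn⟩⟩
    refine ⟨tendstoInMeasure_of_bad hbad hu ?_, tendstoInMeasure_of_bad hbad hu ?_⟩
    · filter_upwards [hsum, eventually_ge_atTop 1] with n hs hn1 ω hω
      have := hne n hn1
      rw [edist_dist, Real.dist_0_eq_abs]
      refine ENNReal.ofReal_le_ofReal ?_
      rw [abs_of_nonneg (Real.iSup_nonneg fun c => Finset.sum_nonneg fun γ _ =>
        posterior_nonneg hν (hcpos n hn1 c) (hprior_pos n hn1) γ)]
      exact ciSup_le fun c => hs ω hω c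
    · filter_upwards [hsum, eventually_ge_atTop 1] with n hs hn1 ω hω
      have := hne n hn1
      rw [edist_dist, Real.dist_eq, abs_sub_comm]
      refine ENNReal.ofReal_le_ofReal ?_
      -- The posterior mass of the true model is one minus the sum already bounded, so the same rate
      -- serves for the infimum.
      have hsplit : ∀ c : Set.Icc (fun _ : Fin (p n) => φlo n) (fun _ => φhi n),
          posterior ν (prior n) c.1 (X n ω) (y n ω) (stateVector (β₀ n)) = 1 -
            ∑ γ ∈ Finset.univ.erase (stateVector (β₀ n)),
              posterior ν (prior n) c.1 (X n ω) (y n ω) γ := fun c =>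
        eq_sub_of_add_eq (posterior_add_sum_erase hν (hcpos n hn1 c) (hprior_pos n hn1))
      have hnn : ∀ c : Set.Icc (fun _ : Fin (p n) => φlo n) (fun _ => φhi n),
          0 ≤ ∑ γ ∈ Finset.univ.erase (stateVector (β₀ n)),
              posterior ν (prior n) c.1 (X n ω) (y n ω) γ := fun c =>
        Finset.sum_nonneg fun γ _ => posterior_nonneg hν (hcpos n hn1 c) (hprior_pos n hn1) γ
      have hbdd : BddBelow (Set.range fun c : Set.Icc (fun _ : Fin (p n) => φlo n)
          (fun _ => φhi n) =>
          posterior ν (prior n) c.1 (X n ω) (y n ω) (stateVector (β₀ n))) :=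
        ⟨0, by
          rintro _ ⟨c, rfl⟩
          exact posterior_nonneg hν (hcpos n hn1 c) (hprior_pos n hn1) _⟩
      have hle : (⨅ c : Set.Icc (fun _ : Fin (p n) => φlo n) (fun _ => φhi n),
          posterior ν (prior n) c.1 (X n ω) (y n ω) (stateVector (β₀ n))) ≤ 1 := by
        obtain ⟨c⟩ := this
        refine (ciInf_le hbdd c).trans ?_
        rw [hsplit c]
        linarith [hnn c]
      rw [abs_of_nonneg (sub_nonneg.2 hle), sub_le_comm]
      refine le_ciInf fun c => ?_
      rw [hsplit c]
      linarith [hs ω hω c]
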